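/- **Conventions.** Let $\mathbf{k}$ be a field and $[n]=\{1,\dots,n\}$. A permutation $\sigma\in\mathfrak S_n$ is written as the word $\sigma_1\cdots\sigma_n$. The weak order on $\mathfrak S_n$ is the inclusion of the inversion sets $\{(\sigma_i,\sigma_j) : i<j,\ \sigma_i>\sigma_j\}$. For $R\subseteq[p]$ and $\rho\in\mathfrak S_p$, let $\mathrm{stdp}(\rho,R)$ (resp. $\mathrm{stdv}(\rho,R)$) be the standardization of the subword of $\rho$ formed by the entries whose positions (resp. values) are in $R$. **Arcs.** An arc is a quadruple $(a,b,n,S)$ with $1\le a<b\le n$ and $S\subseteq\,]a,b[\,=\{a+1,\dots,b-1\}$; $\mathcal A_n$ is the set of arcs with third entry $n$. An arc ideal is a set $I\subseteq\mathcal A_n$ such that $(a,d,n,S)\in I$ and $a\le b<c\le d$ imply $(b,c,n,S\cap{]b,c[})\in I$; $\mathfrak I_n$ is the set of arc ideals of $\mathcal A_n$. Arcs $(a,b,n,R)$ and $(c,d,n,S)$ cross if there are $r,s\in([a,b]\cap[c,d])\smallsetminus(\{a,b\}\cap\{c,d\})$ with $r\in(R\cup\{a,b\})\smallsetminus S$ and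 $s\in(S\cup\{c,d\})\smallsetminus R$. A noncrossing arc diagram is a set of arcs of $\mathcal A_n$ that pairwise do not cross and have distinct left endpoints and distinct right endpoints. Let $\underline\delta(\sigma)$ be the set of arcs $(\sigma_{i+1},\sigma_i,n,\{\sigma_j : j<i,\ \sigma_{i+1}<\sigma_j<\sigma_i\})$ over the descents $\sigma_i>\sigma_{i+1}$ of $\sigma\in\mathfrak S_n$. For an arc ideal $I\subseteq\mathcal A_n$, let $\equiv_I$ be the (unique, by a theorem of Reading) lattice congruence of the weak order on $\mathfrak S_n$ for which $I$ is the set of arcs in $\underline\delta(\lambda)$, where $\lambda$ ranges over the join-irreducible permutations that are minimal in their class. Set $\underline\eta_I(\sigma)=\underline\delta(\pi_\downarrow(\sigma))$, where $\pi_\downarrow(\sigma)$ is the bottom element of the $\equiv_I$-class of $\sigma$. **Decoration sets.** A decoration set is a graded set $\mathfrak X=\bigsqcup_{n\ge0}\mathfrak X_n$ with a concatenation $\mathfrak X_m\times\mathfrak X_n\to\mathfrak X_{m+n}$, $(X,Y)\mapsto XY$, and a selection $(X,R)\mapsto X|_R\in\mathfrak X_k$ for $X\in\mathfrak X_m$ and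 $R\subseteq[m]$ with $|R|=k$, such that $X(YZ)=(XY)Z$; $(X|_R)|_S=X|_{\{r_s : s\in S\}}$ for $R=\{r_1<\dots<r_q\}\subseteq[p]$ and $S\subseteq[q]$; and $X|_R\,Y|_S=(XY)|_{R\cup\{s+m\,:\,s\in S\}}$ for $X\in\mathfrak X_m$, $Y\in\mathfrak X_n$, $R\subseteq[m]$, $S\subseteq[n]$. A graded map $\Psi:\mathfrak X\to\mathfrak I=\bigsqcup_n\mathfrak I_n$ is conservative if (i) for $X\in\mathfrak X_m$ and $Y\in\mathfrak X_n$, $(a,b,m,S)\in\Psi(X)$ implies $(a,b,m+n,S)\in\Psi(XY)$, and $(a,b,n,S)\in\Psi(Y)$ implies $(a+m,b+m,m+n,\{s+m : s\in S\})\in\Psi(XY)$; (ii) for $Z\in\mathfrak X_p$, $R=\{r_1<\dots<r_q\}\subseteq[p]$, $1\le a<b\le q$ and $S\subseteq{]r_a,r_b[}$, $(r_a,r_b,p,S)\in\Psi(Z)$ implies $(a,b,q,\{c\in[q] : r_c\in S\})\in\Psi(Z|_R)$. **Hopf algebras.** Here, a (combinatorial, graded) Hopf algebra is a graded $\mathbf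 k$-vector space with a graded associative product and a graded coassociative coproduct $\Delta$ such that $\Delta$ is multiplicative; no unit, counit or antipode is required. A Hopf subalgebra is a subspace $V$ stable by the product and with $\Delta(V)\subseteq V\otimes V$. **Decorated permutations and arc diagrams.** Let $\mathbf k\mathfrak P$ be the vector space with basis $F_{(\sigma,X)}$ for $\sigma\in\mathfrak S_n$, $X\in\mathfrak X_n$, $n\ge0$, with product $F_{(\sigma,X)}\cdot F_{(\tau,Y)}=\sum_\rho F_{(\rho,XY)}$, where (for $\sigma\in\mathfrak S_m$, $\tau\in\mathfrak S_n$) $\rho$ ranges over the permutations in $\mathfrak S_{m+n}$ with $\mathrm{stdv}(\rho,[m])=\sigma$ and $\mathrm{stdv}(\rho,[m+n]\smallsetminus[m])=\tau$, and with coproduct $$\Delta F_{(\rho,Z)}=\sum_{k=0}^{p}F_{(\mathrm{stdp}(\rho,[k]),\,Z|_{\rho([k])})}\otimes F_{(\mathrm{stdp}(\rho,[p]\smallsetminus[k]),\,Z|_{\rho([p]\smallsetminus[k])})}\qquad(\rho\in\mathfrak S_p).$$ For a conservative $\Psi:\mathfrak X\to\mathfrak I$, let $\mathbf k\mathfrak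 D\subseteq\mathbf k\mathfrak P$ be the subspace, graded by size, spanned by the sums $P_{(D,X)}=\sum_{\sigma\,:\,\underline\eta_{\Psi(X)}(\sigma)=D}F_{(\sigma,X)}$ over all $n\ge0$, all $X\in\mathfrak X_n$ and all noncrossing arc diagrams $D\subseteq\Psi(X)$. With the product and coproduct inherited from $\mathbf k\mathfrak P$, this is the Hopf algebra constructed from $\Psi$. **Proposition.** Let $\mathfrak X'$ be a decoration set, let $\mathfrak X\subseteq\mathfrak X'$ be a graded subset stable by concatenation and selection (hence itself a decoration set), and let $\Psi':\mathfrak X'\to\mathfrak I$ be conservative. Then the restriction $\Psi$ of $\Psi'$ to $\mathfrak X$ is conservative. Consequently, the Hopf algebra $\mathbf k\mathfrak D$ constructed from $\Psi$ is a Hopf subalgebra of the Hopf algebra $\mathbf k\mathfrak D'$ constructed from $\Psi'$: both $\mathbf k\mathfrak D$ and $\mathbf k\mathfrak D'$ are graded Hopf algebras for the operations inherited from $\mathbf k\mathfrak P$ and $\mathbf k\mathfrak P'$, and the inclusion $F_{(\sigma,X)}\mapsto F_{(\sigma,X)}$ of $\mathbf k\mathfrak P$ in $\mathbf k\mathfrak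 P'$ restricts to an injective graded map $\mathbf k\mathfrak D\to\mathbf k\mathfrak D'$ that is compatible with products and coproducts and whose image is a Hopf subalgebra of $\mathbf k\mathfrak D'$. -/

import Mathlib

open scoped TensorProduct

universe u v

/-! ## Permutations, standardization, weak order

Positions and values are numbered from `0`, so `[n]` is `Fin n`; a permutation `σ` of `[n]` is
identified with the word `σ 0, σ 1, …, σ (n-1)`.  A `q`-element subset
`R = {r_1 < ⋯ < r_q}` of `[p]` is encoded by its increasing enumeration `Fin q ↪o Fin p`. -/

/-- Increasing enumeration of the image `ρ(R)` of a subset `R` of `[p]`. -/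
def imageEmb {p q : ℕ} (ρ : Equiv.Perm (Fin p)) (R : Fin q ↪o Fin p) : Fin q ↪o Fin p :=
  ((Finset.univ.map R.toEmbedding).map ρ.toEmbedding).orderEmbOfFin (by simp)

/-- The subset `R ∪ S^{→ m}` of `[m + n]`, for `R ⊆ [m]` and `S ⊆ [n]`. -/
def sumEmb {k l m n : ℕ} (R : Fin k ↪o Fin m) (S : Fin l ↪o Fin n) :
    Fin (k + l) ↪o Fin (m + n) :=
  OrderEmbedding.ofStrictMono
    (Fin.append (fun i => Fin.castAdd n (R i)) (fun j => Fin.natAdd m (S j))) (by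
      intro i j hij
      induction i using Fin.addCases with
      | left i =>
        induction j using Fin.addCases with
        | left j =>
          have h : R i < R j := R.strictMono (Fin.lt_def.2 hij)
          simp only [Fin.append_left]
          exact Fin.lt_def.2 (Fin.lt_def.1 h)
        | right j =>
          have h := (R i).isLt
          simp only [Fin.append_left, Fin.append_right]
          rw [Fin.lt_def, Fin.val_castAdd, Fin.val_natAdd]
          omega
      | right i =>
        induction j using Fin.addCases with
        | left j =>
          exfalso
          have h := j.isLt
          rw [Fin.lt_def, Fin.val_castAdd, Fin.val_natAdd] at hij
          omega
        | right j =>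
          have h : S i < S j := S.strictMono (Fin.lt_def.2 (by
            rw [Fin.lt_def, Fin.val_natAdd, Fin.val_natAdd] at hij
            omega))
          simp only [Fin.append_right]
          exact Fin.lt_def.2 (Nat.add_lt_add_left (Fin.lt_def.1 h) m))

/-- The subset `[p] ∖ [k]` of the last `p - k` elements of `[p]`. -/
def lastEmb {k p : ℕ} (h : k ≤ p) : Fin (p - k) ↪o Fin p :=
  OrderEmbedding.ofStrictMono (fun i => ⟨k + i.1, by omega⟩) (by
    intro i j hij
    exact Fin.lt_def.2 (Nat.add_lt_add_left (Fin.lt_def.1 hij) k))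

/-- Standardization of a word with distinct entries: the permutation of `[q]` with the same
relative order of entries. (`Tuple.sort w` lists the positions by increasing entry.) -/
def stdWord {p q : ℕ} (w : Fin q → Fin p) : Equiv.Perm (Fin q) := (Tuple.sort w)⁻¹

/-- Standardization of the subword of `ρ` at the positions in `R`. -/
def stdPos {p q : ℕ} (ρ : Equiv.Perm (Fin p)) (R : Fin q ↪o Fin p) : Equiv.Perm (Fin q) :=
  stdWord (fun i => ρ (R i))

/-- Standardization of the subword of `ρ` formed by the values in `R`. -/
def stdVal {p q : ℕ} (ρ : Equiv.Perm (Fin p)) (R : Fin q ↪o Fin p) : Equiv.Perm (Fin q) :=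
  stdPos ρ (imageEmb ρ⁻¹ R)

/-- The shifted shuffle of two permutations. -/
def shiftedShuffle {m n : ℕ} (σ : Equiv.Perm (Fin m)) (τ : Equiv.Perm (Fin n)) :
    Finset (Equiv.Perm (Fin (m + n))) :=
  Finset.univ.filter fun ρ =>
    stdVal ρ (Fin.castAddOrderEmb n) = σ ∧ stdVal ρ (Fin.natAddOrderEmb m) = τ

/-- The inversion set: pairs of values `(σ i, σ j)` with `i < j` and `σ i > σ j`. -/
def inversionSet {n : ℕ} (σ : Equiv.Perm (Fin n)) : Set (Fin n × Fin n) :=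
  {p | ∃ i j, i < j ∧ σ j < σ i ∧ p = (σ i, σ j)}

/-- The weak order: inclusion of inversion sets. -/
instance weakOrder (n : ℕ) : Preorder (Equiv.Perm (Fin n)) := Preorder.lift inversionSet

/-- Lattice congruences of the weak order: equivalence relations compatible with joins and
meets. -/
structure IsLatticeCongruence {n : ℕ} (r : Setoid (Equiv.Perm (Fin n))) : Prop where
  join : ∀ x x' y y' z z' : Equiv.Perm (Fin n), r x x' → r y y' →
    IsLUB {x, y} z → IsLUB {x', y'} z' → r z z'
  meet : ∀ x x' y y' z z' : Equiv.Perm (Fin n), r x x' → r y y' →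
    IsGLB {x, y} z → IsGLB {x', y'} z' → r z z'

/-- `τ` is the bottom element of the congruence class of `σ`. -/
def IsProjDown {n : ℕ} (r : Setoid (Equiv.Perm (Fin n))) (σ τ : Equiv.Perm (Fin n)) : Prop :=
  IsLeast {ρ | r σ ρ} τ

/-- A join-irreducible permutation: it covers a single element of the weak order. -/
def IsJoinIrreduciblePerm {n : ℕ} (σ : Equiv.Perm (Fin n)) : Prop := ∃! τ, τ ⋖ σ

/-! ## Arcs, arc ideals, noncrossing arc diagrams -/

/-- An arc `(a, b, n, S)` with `a < b` in `[n]` and `S ⊆ ]a, b[`. -/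
@[ext]
structure Arc (n : ℕ) where
  left : Fin n
  right : Fin n
  lt : left < right
  pts : Finset (Fin n)
  sub : pts ⊆ Finset.Ioo left right

namespace Arc

variable {n : ℕ}

/-- `α` is forced by `β`: `β` is the restriction of `α` to a subinterval. -/
def IsForcedBy (α β : Arc n) : Prop :=
  α.left ≤ β.left ∧ β.right ≤ α.right ∧ β.pts = α.pts ∩ Finset.Ioo β.left β.right

/-- The interiors of the curves representing `α` and `β` intersect: at some abscissa `r` the
first curve is above the second one, and at some abscissa `s` it is below. -/
def Cross (α β : Arc n) : Prop :=
  ∃ r s : Fin n,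
    (r ∈ Finset.Icc α.left α.right ∩ Finset.Icc β.left β.right ∧
      r ∉ ({α.left, α.right} : Finset (Fin n)) ∩ {β.left, β.right}) ∧
    (s ∈ Finset.Icc α.left α.right ∩ Finset.Icc β.left β.right ∧
      s ∉ ({α.left, α.right} : Finset (Fin n)) ∩ {β.left, β.right}) ∧
    (r ∈ α.pts ∪ {α.left, α.right} ∧ r ∉ β.pts) ∧
    (s ∈ β.pts ∪ {β.left, β.right} ∧ s ∉ α.pts)

/-- The augmented arc `α^{+n}`: add `n` points to the right. -/
def augment {m : ℕ} (α : Arc m) (n : ℕ) : Arc (m + n) where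
  left := Fin.castAdd n α.left
  right := Fin.castAdd n α.right
  lt := (Fin.castAddOrderEmb n).strictMono α.lt
  pts := α.pts.map (Fin.castAddOrderEmb n).toEmbedding
  sub := by
    intro x hx
    obtain ⟨y, hy, rfl⟩ := Finset.mem_map.1 hx
    have h := Finset.mem_Ioo.1 (α.sub hy)
    exact Finset.mem_Ioo.2 ⟨(Fin.castAddOrderEmb n).strictMono h.1,
      (Fin.castAddOrderEmb n).strictMono h.2⟩

/-- The shifted arc `α^{→ m}`: add `m` points to the left. -/
def shift (m : ℕ) (α : Arc n) : Arc (m + n) where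
  left := Fin.natAdd m α.left
  right := Fin.natAdd m α.right
  lt := (Fin.natAddOrderEmb m).strictMono α.lt
  pts := α.pts.map (Fin.natAddOrderEmb m).toEmbedding
  sub := by
    intro x hx
    obtain ⟨y, hy, rfl⟩ := Finset.mem_map.1 hx
    have h := Finset.mem_Ioo.1 (α.sub hy)
    exact Finset.mem_Ioo.2 ⟨(Fin.natAddOrderEmb m).strictMono h.1,
      (Fin.natAddOrderEmb m).strictMono h.2⟩

/-- For a subset `R = {r_1 < ⋯ < r_q}` of `[p]`, the arc `(a, b, q, {c | r_c ∈ S})` obtained from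
`S ⊆ ]r_a, r_b[`. -/
def select {p q : ℕ} (R : Fin q ↪o Fin p) (a b : Fin q) (hab : a < b) (S : Finset (Fin p))
    (hS : S ⊆ Finset.Ioo (R a) (R b)) : Arc q where
  left := a
  right := b
  lt := hab
  pts := Finset.univ.filter fun c => R c ∈ S
  sub := by
    intro c hc
    have h := Finset.mem_Ioo.1 (hS (Finset.mem_filter.1 hc).2)
    exact Finset.mem_Ioo.2 ⟨R.lt_iff_lt.1 h.1, R.lt_iff_lt.1 h.2⟩

end Arc

/-- An arc ideal: a set of arcs of `[n]` closed under restriction of arcs, i.e. an upper ideal of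
the forcing order. -/
structure ArcIdeal (n : ℕ) where
  carrier : Set (Arc n)
  closed : ∀ α ∈ carrier, ∀ β : Arc n, α.IsForcedBy β → β ∈ carrier

/-- Noncrossing arc diagrams. -/
def IsNoncrossing {n : ℕ} (D : Set (Arc n)) : Prop :=
  ∀ α ∈ D, ∀ β ∈ D, α ≠ β → ¬ α.Cross β ∧ α.left ≠ β.left ∧ α.right ≠ β.right

/-- The diagram of the descents of `σ`: a descent of `σ` at the consecutive positions `i`, `j`
gives the arc `(σ j, σ i, n, {σ l | l < i, σ l ∈ ]σ j, σ i[})`. -/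
def descentDiagram {n : ℕ} (σ : Equiv.Perm (Fin n)) : Set (Arc n) :=
  {α | ∃ i j : Fin n, j.1 = i.1 + 1 ∧ α.left = σ j ∧ α.right = σ i ∧
    ∀ v, v ∈ α.pts ↔ ∃ l, l < i ∧ v = σ l ∧ σ j < σ l ∧ σ l < σ i}

/-- The arcs of the join-irreducible permutations that are not contracted by `r`, i.e. that are
the bottom elements of their classes. -/
def uncontractedArcs {n : ℕ} (r : Setoid (Equiv.Perm (Fin n))) : Set (Arc n) :=
  {α | ∃ σ, IsJoinIrreduciblePerm σ ∧ IsProjDown r σ σ ∧ α ∈ descentDiagram σ}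

/-- The map `η_I` from permutations to noncrossing arc diagrams: if `r` is the lattice
congruence of the weak order whose set of uncontracted arcs is the arc ideal `I`, then `η_I σ` is
the descent diagram of the bottom element of the `r`-class of `σ`.
(By a theorem of Reading there is exactly one such `r` for each arc ideal `I`.) -/
def eta {n : ℕ} (I : ArcIdeal n) (σ : Equiv.Perm (Fin n)) : Set (Arc n) :=
  {α | ∃ r : Setoid (Equiv.Perm (Fin n)), IsLatticeCongruence r ∧
    uncontractedArcs r = I.carrier ∧ ∃ τ, IsProjDown r σ τ ∧ α ∈ descentDiagram τ}

/-! ## Decoration sets and conservative maps -/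

/-- A decoration set: a graded set with a concatenation and a selection. -/
structure DecorationSet where
  Deco : ℕ → Type u
  concat : ∀ {m n : ℕ}, Deco m → Deco n → Deco (m + n)
  select : ∀ {m k : ℕ}, Deco m → (Fin k ↪o Fin m) → Deco k
  concat_assoc : ∀ {m n p : ℕ} (x : Deco m) (y : Deco n) (z : Deco p),
    cast (congrArg Deco (Nat.add_assoc m n p)) (concat (concat x y) z) = concat x (concat y z)
  select_select : ∀ {p q k : ℕ} (x : Deco p) (R : Fin q ↪o Fin p) (S : Fin k ↪o Fin q),
    select (select x R) S = select x (S.trans R)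
  concat_select : ∀ {m n k l : ℕ} (x : Deco m) (y : Deco n) (R : Fin k ↪o Fin m)
    (S : Fin l ↪o Fin n),
    concat (select x R) (select y S) = select (concat x y) (sumEmb R S)

/-- Graded functions from a decoration set to arc ideals. -/
abbrev ArcMap (X : DecorationSet.{u}) := ∀ n : ℕ, X.Deco n → ArcIdeal n

/-- Conservative functions. -/
structure IsConservative (X : DecorationSet.{u}) (Ψ : ArcMap X) : Prop where
  augment_mem : ∀ {m n : ℕ} (x : X.Deco m) (y : X.Deco n), ∀ α ∈ (Ψ m x).carrier,
    α.augment n ∈ (Ψ (m + n) (X.concat x y)).carrier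
  shift_mem : ∀ {m n : ℕ} (x : X.Deco m) (y : X.Deco n), ∀ β ∈ (Ψ n y).carrier,
    β.shift m ∈ (Ψ (m + n) (X.concat x y)).carrier
  select_mem : ∀ {p q : ℕ} (z : X.Deco p) (R : Fin q ↪o Fin p) (a b : Fin q) (hab : a < b)
    (S : Finset (Fin p)) (hS : S ⊆ Finset.Ioo (R a) (R b)),
    (⟨R a, R b, R.lt_iff_lt.2 hab, S, hS⟩ : Arc p) ∈ (Ψ p z).carrier →
    Arc.select R a b hab S hS ∈ (Ψ q (X.select z R)).carrier

/-- A decoration subset: a graded subset stable by concatenation and selection. -/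
structure DecorationSubset (X : DecorationSet.{u}) where
  carrier : ∀ n : ℕ, Set (X.Deco n)
  concat_mem : ∀ {m n : ℕ} {x : X.Deco m} {y : X.Deco n}, x ∈ carrier m → y ∈ carrier n →
    X.concat x y ∈ carrier (m + n)
  select_mem : ∀ {m k : ℕ} {x : X.Deco m} (R : Fin k ↪o Fin m), x ∈ carrier m →
    X.select x R ∈ carrier k

namespace DecorationSubset

variable {X : DecorationSet.{u}}

theorem coe_cast (Y : DecorationSubset X) {m n : ℕ} (h : m = n) (x : Y.carrier m) :
    ((cast (congrArg (fun i => (Y.carrier i : Type u)) h) x : Y.carrier n) : X.Deco n) =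
      cast (congrArg X.Deco h) (x : X.Deco m) := by
  subst h
  rfl

/-- A decoration subset, as a decoration set with the restricted operations. -/
def toDecorationSet (Y : DecorationSubset X) : DecorationSet.{u} where
  Deco n := Y.carrier n
  concat x y := ⟨X.concat x.1 y.1, Y.concat_mem x.2 y.2⟩
  select x R := ⟨X.select x.1 R, Y.select_mem R x.2⟩
  concat_assoc {m n p} x y z := by
    apply Subtype.ext
    exact (Y.coe_cast (Nat.add_assoc m n p) _).trans (X.concat_assoc x.1 y.1 z.1)
  select_select x R S := Subtype.ext (X.select_select x.1 R S)
  concat_select x y R S := Subtype.ext (X.concat_select x.1 y.1 R S)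

/-- Restriction of a map to a decoration subset. -/
def restrict (Y : DecorationSubset X) (Ψ : ArcMap X) : ArcMap Y.toDecorationSet :=
  fun n x => Ψ n x.1

end DecorationSubset

/-! ## Hopf algebras

Following the convention used for combinatorial Hopf algebras on decorated objects, a Hopf algebra
is a graded vector space with an associative product and a coassociative coproduct such that the
coproduct is multiplicative; no unit, counit or antipode is part of the structure. -/

/-- A product and a coproduct on a vector space. -/
structure HopfOps (k : Type v) [Field k] (A : Type*) [AddCommGroup A] [Module k A] where
  mul : A →ₗ[k] A →ₗ[k] A
  comul : A →ₗ[k] A ⊗[k] A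

namespace HopfOps

variable {k : Type v} [Field k] {A B : Type*} [AddCommGroup A] [Module k A]
  [AddCommGroup B] [Module k B]

/-- The product and coproduct define a graded Hopf algebra, for the grading `gr`. -/
structure IsGradedHopf (H : HopfOps k A) (gr : ℕ → Submodule k A) : Prop where
  assoc : ∀ a b c : A, H.mul (H.mul a b) c = H.mul a (H.mul b c)
  coassoc : ∀ a : A, TensorProduct.assoc k A A A (H.comul.rTensor A (H.comul a)) =
    H.comul.lTensor A (H.comul a)
  compat : ∀ a b : A, H.comul (H.mul a b) =
    TensorProduct.map (TensorProduct.lift H.mul) (TensorProduct.lift H.mul)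
      (TensorProduct.tensorTensorTensorComm k A A A A (H.comul a ⊗ₜ[k] H.comul b))
  internal : DirectSum.IsInternal gr
  mul_mem : ∀ (m n : ℕ), ∀ a ∈ gr m, ∀ b ∈ gr n, H.mul a b ∈ gr (m + n)
  comul_mem : ∀ (n : ℕ), ∀ a ∈ gr n, H.comul a ∈
    ⨆ ij ∈ Finset.HasAntidiagonal.antidiagonal n, LinearMap.range (TensorProduct.mapIncl (gr ij.1) (gr ij.2))

/-- A linear map compatible with products and coproducts. -/
structure IsHom (H : HopfOps k A) (K : HopfOps k B) (f : A →ₗ[k] B) : Prop where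
  map_mul : ∀ a b : A, f (H.mul a b) = K.mul (f a) (f b)
  map_comul : ∀ a : A, TensorProduct.map f f (H.comul a) = K.comul (f a)

/-- A Hopf subalgebra: a subspace stable by product and coproduct. -/
structure IsHopfSubalgebra (H : HopfOps k A) (V : Submodule k A) : Prop where
  mul_mem : ∀ a ∈ V, ∀ b ∈ V, H.mul a b ∈ V
  comul_mem : ∀ a ∈ V, H.comul a ∈ LinearMap.range (TensorProduct.mapIncl V V)

end HopfOps

/-! ## Decorated permutations and decorated noncrossing arc diagrams -/

/-- `X`-decorated permutations. -/
abbrev DecPerm (X : DecorationSet.{u}) := Σ n : ℕ, Equiv.Perm (Fin n) × X.Deco n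

/-- The vector space with basis `F_{(σ, x)}`, where `(σ, x)` is an `X`-decorated permutation. -/
abbrev PermSpace (k : Type v) [Field k] (X : DecorationSet.{u}) := DecPerm X →₀ k

/-- The basis element `F_{(σ, x)}`. -/
noncomputable def basisF (k : Type v) [Field k] {X : DecorationSet.{u}} (d : DecPerm X) :
    PermSpace k X :=
  Finsupp.single d 1

/-- The standardization of `(ρ, z)` at the set of positions `R`: standardize the subword of `ρ` at
the positions in `R`, and select in `z` the set `ρ(R)` of values of this subword. -/
def DecPerm.std {X : DecorationSet.{u}} {q : ℕ} (d : DecPerm X) (R : Fin q ↪o Fin d.1) :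
    DecPerm X :=
  ⟨q, stdPos d.2.1 R, X.select d.2.2 (imageEmb d.2.1 R)⟩

/-- The product `F_{(σ, x)} · F_{(τ, y)} = ∑ F_{(ρ, xy)}` over the shifted shuffle of `σ` and `τ`,
and the coproduct `Δ F_d = ∑ F_{std(d, [i])} ⊗ F_{std(d, [p] ∖ [i])}` over `0 ≤ i ≤ p`. -/
noncomputable def permOps (k : Type v) [Field k] (X : DecorationSet.{u}) :
    HopfOps k (PermSpace k X) where
  mul := Finsupp.linearCombination k fun d : DecPerm X =>
    Finsupp.linearCombination k fun e : DecPerm X =>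
      ∑ ρ ∈ shiftedShuffle d.2.1 e.2.1,
        basisF k (⟨d.1 + e.1, ρ, X.concat d.2.2 e.2.2⟩ : DecPerm X)
  comul := Finsupp.linearCombination k fun d : DecPerm X =>
    ∑ i : Fin (d.1 + 1),
      basisF k (d.std (Fin.castLEOrderEmb (Nat.le_of_lt_succ i.isLt))) ⊗ₜ[k]
        basisF k (d.std (lastEmb (Nat.le_of_lt_succ i.isLt)))

open Classical in
/-- `P_{(D, x)}`: the sum of `F_{(σ, x)}` over the permutations `σ` with `η_{Ψ(x)}(σ) = D`. -/
noncomputable def diagramSum (k : Type v) [Field k] {X : DecorationSet.{u}} (Ψ : ArcMap X)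
    {n : ℕ} (D : Set (Arc n)) (x : X.Deco n) : PermSpace k X :=
  ∑ σ ∈ Finset.univ.filter (fun σ : Equiv.Perm (Fin n) => eta (Ψ n x) σ = D),
    basisF k (⟨n, σ, x⟩ : DecPerm X)

/-- The span of the `P_{(D, x)}`, over `X`-decorated noncrossing arc diagrams `(D, x)` of
size `n`. -/
noncomputable def diagramSpaceDeg (k : Type v) [Field k] {X : DecorationSet.{u}} (Ψ : ArcMap X)
    (n : ℕ) : Submodule k (PermSpace k X) :=
  Submodule.span k {v | ∃ (x : X.Deco n) (D : Set (Arc n)),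
    IsNoncrossing D ∧ D ⊆ (Ψ n x).carrier ∧ v = diagramSum k Ψ D x}

/-- The space of decorated noncrossing arc diagrams. -/
noncomputable def diagramSpace (k : Type v) [Field k] {X : DecorationSet.{u}} (Ψ : ArcMap X) :
    Submodule k (PermSpace k X) :=
  ⨆ n, diagramSpaceDeg k Ψ n

/-- The grading by size of the space of decorated noncrossing arc diagrams. -/
noncomputable def diagramGrading (k : Type v) [Field k] {X : DecorationSet.{u}} (Ψ : ArcMap X)
    (n : ℕ) : Submodule k (diagramSpace k Ψ) :=
  (diagramSpaceDeg k Ψ n).comap (diagramSpace k Ψ).subtype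

/-- The inclusion `F_{(σ, x)} ↦ F_{(σ, x)}` for a decoration subset. -/
noncomputable def permInclusion (k : Type v) [Field k] {X : DecorationSet.{u}}
    (Y : DecorationSubset X) : PermSpace k Y.toDecorationSet →ₗ[k] PermSpace k X :=
  Finsupp.lmapDomain k k fun d : DecPerm Y.toDecorationSet =>
    (⟨d.1, d.2.1, d.2.2.1⟩ : DecPerm X)

/-! ## The weak order -/

section WeakOrder

variable {n : ℕ}

/-! Conservativity passes to the subset because both the operations and the map are restrictions.
The inclusion of decorated permutations commutes with the operations and sends each `P_{(D,x)}` to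
the sum with the same name, since `Ψ(x) = Ψ'(x)`. What remains is the theorem that a conservative
`Ψ` makes the span of the `P_{(D,x)}` stable under product and coproduct. Tensoring over a field
preserves injectivity, so the operations then restrict to the span, and the axioms descend from
decorated permutations (`permOps_assoc`, `permOps_coassoc`, `permOps_compat`).

Stability rests on a local description of the fibers of `eta I`. Call two permutations congruent
when they lie above the same join-irreducibles with arc in `I`. This relation visibly respects
meets. Because `I` is closed under restriction, it can also be tested on meet-irreducibles
(`congruence_iff_le_mirr`), so it respects joins. It is the only congruence with uncontracted arcs
`I` (`eq_congruence`). Exchanging adjacent letters whose arc is outside `I` stays inside a class,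
and doing so at descents leads down to the unique bottom element. Hence a set of permutations stable
under all such exchanges is a union of fibers (`Stable.iff_of_eta_eq`), and the sum of `F` over it
is a sum of elements `P`.

For the product, an exchange in a shuffle either leaves a factor alone or exchanges an arc of it. By
the first conservativity condition, the latter arc is outside the ideal of the factor if the
original one is outside the ideal of `xy`. For the coproduct, an exchange in a standardized prefix
or suffix lifts to an exchange in the whole word, and the second condition keeps the lifted arc
outside the ideal.

Order arguments are phrased with `σ.symm`: a word is handled through the positions of its values. -/

theorem perm_le_iff {σ τ : Equiv.Perm (Fin n)} :
    σ ≤ τ ↔ ∀ x y, x < y → σ.symm y < σ.symm x → τ.symm y < τ.symm x := by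
  change inversionSet σ ⊆ inversionSet τ ↔ _
  constructor
  · intro h x y hxy hpos
    obtain ⟨i, j, hij, -, he⟩ :=
      h (show (y, x) ∈ inversionSet σ from ⟨σ.symm y, σ.symm x, hpos, by simpa using hxy, by simp⟩)
    simp only [Prod.mk.injEq] at he
    simpa [he.1, he.2] using hij
  · rintro h _ ⟨i, j, hij, hlt, rfl⟩
    exact ⟨τ.symm (σ i), τ.symm (σ j), h _ _ hlt (by simpa using hij), by simpa using hlt, by simp⟩

theorem perm_eq_of_symm_lt {σ τ : Equiv.Perm (Fin n)}
    (h : ∀ u v, σ.symm u < σ.symm v → τ.symm u < τ.symm v) : σ = τ := by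
  have hm : StrictMono fun i => τ.symm (σ i) := fun i j hij => h _ _ (by simpa using hij)
  have he := (StrictMono.range_inj hm strictMono_id).1
    (by rw [Set.range_id]; exact (σ.trans τ.symm).surjective.range_eq)
  ext i
  have := congrFun he i
  simp only [id, Equiv.symm_apply_eq] at this
  rw [this]

theorem perm_le_antisymm {σ τ : Equiv.Perm (Fin n)} (h₁ : σ ≤ τ) (h₂ : τ ≤ σ) : σ = τ := by
  rw [perm_le_iff] at h₁ h₂
  refine perm_eq_of_symm_lt fun u v huv => ?_
  have hne : u ≠ v := by rintro rfl; exact lt_irrefl _ huv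
  rcases lt_or_gt_of_ne hne with h | h
  · by_contra hc
    have := h₂ u v h (lt_of_le_of_ne (not_lt.1 hc) (by simpa using hne.symm))
    exact lt_asymm huv this
  · exact h₁ v u h huv

/-- Place each value at the position given by its number of predecessors; this rank is strictly
monotone for `lt`, hence injective. -/
theorem exists_perm_of_order (lt : Fin n → Fin n → Prop) (irr : ∀ u, ¬ lt u u)
    (tr : ∀ u v w, lt u v → lt v w → lt u w) (tot : ∀ u v, u ≠ v → lt u v ∨ lt v u) :
    ∃ ρ : Equiv.Perm (Fin n), ∀ u v, ρ.symm u < ρ.symm v ↔ lt u v := by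
  classical
  let c : Fin n → ℕ := fun v => (Finset.univ.filter fun u => lt u v).card
  have hc : ∀ u v, lt u v → c u < c v := fun u v huv => by
    refine Finset.card_lt_card ⟨fun w hw => ?_, fun hs => ?_⟩
    · simp only [Finset.mem_filter, Finset.mem_univ, true_and] at hw ⊢
      exact tr _ _ _ hw huv
    · have := hs (show u ∈ _ by simpa using huv)
      simp only [Finset.mem_filter, Finset.mem_univ, true_and] at this
      exact irr _ this
  have hn : ∀ v, c v < n := fun v => by
    have : c v < (Finset.univ : Finset (Fin n)).card :=
      Finset.card_lt_card ⟨Finset.filter_subset _ _, fun hs => by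
        have := hs (Finset.mem_univ v)
        simp only [Finset.mem_filter, Finset.mem_univ, true_and] at this
        exact irr _ this⟩
    simpa using this
  have hinj : Function.Injective fun v => (⟨c v, hn v⟩ : Fin n) := fun u v huv => by
    by_contra hne
    simp only [Fin.mk.injEq] at huv
    rcases tot u v hne with h | h
    · exact absurd huv (hc _ _ h).ne
    · exact absurd huv (hc _ _ h).ne'
  refine ⟨(Equiv.ofBijective _ (Finite.injective_iff_bijective.1 hinj)).symm, fun u v => ?_⟩
  simp only [Equiv.symm_symm, Equiv.ofBijective_apply, Fin.mk_lt_mk]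
  refine ⟨fun h => ?_, hc u v⟩
  by_contra hl
  by_cases huv : u = v
  · subst huv; exact lt_irrefl _ h
  · exact lt_asymm h (hc _ _ ((tot u v huv).resolve_left hl))

/-- Reversing the natural order exactly on the pairs of `T` gives a strict total order: `tr` and
`co` say that `T` and its complement are both transitive. -/
theorem exists_perm_of_inversions (T : Fin n → Fin n → Prop)
    (tr : ∀ x y z, x < y → y < z → T z y → T y x → T z x)
    (co : ∀ x y z, x < y → y < z → T z x → T z y ∨ T y x) :
    ∃ ρ : Equiv.Perm (Fin n), ∀ x y, x < y → (ρ.symm y < ρ.symm x ↔ T y x) := by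
  obtain ⟨ρ, hρ⟩ := exists_perm_of_order (fun u v => (u < v ∧ ¬ T v u) ∨ (v < u ∧ T u v))
    (fun u h => by simp at h) (fun u v w huv hvw => by
      rcases huv with ⟨h1, h2⟩ | ⟨h1, h2⟩ <;> rcases hvw with ⟨h3, h4⟩ | ⟨h3, h4⟩
      · exact Or.inl ⟨h1.trans h3, fun h => (co _ _ _ h1 h3 h).elim h4 h2⟩
      · rcases lt_trichotomy u w with h | rfl | h
        · exact Or.inl ⟨h, fun h' => h2 (tr _ _ _ h h3 h4 h')⟩
        · exact absurd h4 h2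
        · exact Or.inr ⟨h, (co _ _ _ h h1 h4).resolve_left h2⟩
      · rcases lt_trichotomy u w with h | rfl | h
        · exact Or.inl ⟨h, fun h' => h4 (tr _ _ _ h1 h h' h2)⟩
        · exact absurd h2 h4
        · exact Or.inr ⟨h, (co _ _ _ h3 h h2).resolve_right h4⟩
      · exact Or.inr ⟨h3.trans h1, tr _ _ _ h3 h1 h2 h4⟩)
    (fun u v huv => by
      rcases lt_or_gt_of_ne huv with h | h
      · by_cases h' : T v u
        · exact Or.inr (Or.inr ⟨h, h'⟩)
        · exact Or.inl (Or.inl ⟨h, h'⟩)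
      · by_cases h' : T u v
        · exact Or.inl (Or.inr ⟨h, h'⟩)
        · exact Or.inr (Or.inl ⟨h, h'⟩))
  refine ⟨ρ, fun x y hxy => ?_⟩
  rw [hρ]
  simp [hxy, hxy.not_gt]

/-- Meets exist in the weak order. -/
theorem exists_isGLB_pair (σ τ : Equiv.Perm (Fin n)) : ∃ ρ, IsGLB {σ, τ} ρ := by
  -- The non-inversions of the meet are the transitive closure of the pairs that `σ` or `τ` leaves
  -- in order. `hsplit` makes the complement of this closure transitive, so it is an inversion set.
  let N : Fin n → Fin n → Prop := fun x y =>
    x < y ∧ (σ.symm x < σ.symm y ∨ τ.symm x < τ.symm y)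
  have hlt : ∀ x y, Relation.TransGen N x y → x < y := fun x y h => by
    induction h with
    | single h => exact h.1
    | tail _ h ih => exact ih.trans h.1
  have hsplit : ∀ x z, Relation.TransGen N x z → ∀ y, x < y → y < z →
      Relation.TransGen N x y ∨ Relation.TransGen N y z := by
    have hstep : ∀ x z, N x z → ∀ y, x < y → y < z → N x y ∨ N y z := by
      rintro x z ⟨-, h⟩ y hxy hyz
      rcases h with h | h
      · rcases lt_or_ge (σ.symm x) (σ.symm y) with h' | h'
        · exact Or.inl ⟨hxy, Or.inl h'⟩
        · exact Or.inr ⟨hyz, Or.inl (h'.trans_lt h)⟩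
      · rcases lt_or_ge (τ.symm x) (τ.symm y) with h' | h'
        · exact Or.inl ⟨hxy, Or.inr h'⟩
        · exact Or.inr ⟨hyz, Or.inr (h'.trans_lt h)⟩
    intro x z h
    induction h with
    | single h => exact fun y hxy hyz => (hstep _ _ h y hxy hyz).imp .single .single
    | @tail b c h₁ h₂ ih =>
      intro y hxy hyz
      rcases lt_trichotomy y b with h | rfl | h
      · exact (ih y hxy h).imp id fun h' => h'.tail h₂
      · exact Or.inl h₁
      · exact (hstep _ _ h₂ y h hyz).imp (fun h' => h₁.tail h') .single
  obtain ⟨ρ, hρ⟩ := exists_perm_of_inversions (fun y x => ¬ Relation.TransGen N x y)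
    (fun x y z hxy hyz h1 h2 h => (hsplit _ _ h y hxy hyz).elim h2 h1)
    (fun x y z _ _ h => by
      by_contra! hc
      exact h (hc.2.trans hc.1))
  refine ⟨ρ, ?_, fun π hπ => ?_⟩
  · rintro π (rfl | rfl) <;> rw [perm_le_iff] <;> intro x y hxy h <;>
      rw [hρ x y hxy] at h <;> by_contra hc <;> refine h (.single ⟨hxy, ?_⟩)
    · exact Or.inl (lt_of_le_of_ne (not_lt.1 hc) (by simpa using hxy.ne))
    · exact Or.inr (lt_of_le_of_ne (not_lt.1 hc) (by simpa using hxy.ne))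
  · have h1 := perm_le_iff.1 (hπ (Set.mem_insert _ _))
    have h2 := perm_le_iff.1 (hπ (Set.mem_insert_of_mem _ rfl))
    rw [perm_le_iff]
    intro x y hxy h
    rw [hρ x y hxy]
    intro hN
    -- A common lower bound keeps the pairs of `N` in order, hence also the pairs of their closure.
    have : ∀ x y, Relation.TransGen N x y → π.symm x < π.symm y := fun x y h => by
      have hs : ∀ x y, N x y → π.symm x < π.symm y := by
        rintro x y ⟨hxy, h⟩
        by_contra hc
        have hlt : π.symm y < π.symm x :=
          lt_of_le_of_ne (not_lt.1 hc) (by simpa using hxy.ne')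
        exact h.elim (lt_asymm (h1 _ _ hxy hlt)) (lt_asymm (h2 _ _ hxy hlt))
      induction h with
      | single h => exact hs _ _ h
      | tail _ h ih => exact ih.trans (hs _ _ h)
    exact lt_asymm h (this _ _ hN)

theorem isGLB_pair_self (σ : Equiv.Perm (Fin n)) : IsGLB {σ, σ} σ := by
  rw [Set.pair_eq_singleton]
  exact isGLB_singleton

theorem isGLB_pair_of_le {σ τ : Equiv.Perm (Fin n)} (h : σ ≤ τ) : IsGLB {σ, τ} σ :=
  ⟨by rintro _ (rfl | rfl); exacts [le_rfl, h], fun _ hx => hx (Set.mem_insert _ _)⟩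

theorem isLUB_pair_of_le {σ τ : Equiv.Perm (Fin n)} (h : σ ≤ τ) : IsLUB {σ, τ} τ :=
  ⟨by rintro _ (rfl | rfl); exacts [h, le_rfl],
    fun _ hx => hx (Set.mem_insert_of_mem _ rfl)⟩

theorem isLUB_pair_of_ge {σ τ : Equiv.Perm (Fin n)} (h : τ ≤ σ) : IsLUB {σ, τ} σ := by
  rw [Set.pair_comm]
  exact isLUB_pair_of_le h

end WeakOrder

/-! ## Arcs and irreducible permutations -/

namespace Arc

variable {n : ℕ}

/-- For an arc `(a, b, n, S)` the word is the identity outside `[a, b]`; inside, it lists `S`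
increasingly, then `b a`, then the rest increasingly. Its only descent is `b a`. -/
theorem exists_jirr (α : Arc n) : ∃ ρ : Equiv.Perm (Fin n), ∀ x y, x < y →
    (ρ.symm y < ρ.symm x ↔ (y ∈ α.pts ∨ y = α.right) ∧ (α.left ≤ x ∧ x < α.right ∧ x ∉ α.pts)) :=
  exists_perm_of_inversions
    (fun y x => (y ∈ α.pts ∨ y = α.right) ∧ (α.left ≤ x ∧ x < α.right ∧ x ∉ α.pts))
    (fun x y z _ _ h1 h2 => ⟨h1.1, h2.2⟩)
    (fun x y z hxy hyz h => by
      by_cases hy : y ∈ α.pts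
      · exact Or.inr ⟨Or.inl hy, h.2⟩
      · refine Or.inl ⟨h.1, h.2.1.trans hxy.le, hyz.trans_le ?_, hy⟩
        rcases h.1 with h | rfl
        · exact (Finset.mem_Ioo.1 (α.sub h)).2.le
        · exact le_rfl)

/-- Dually, every block is listed decreasingly: the values above `b`, then `S`, then `a b`, then the
rest of `]a, b[`, then the values below `a`. The only ascent is `a b`. -/
theorem exists_mirr (α : Arc n) : ∃ ρ : Equiv.Perm (Fin n), ∀ x y, x < y →
    (ρ.symm y < ρ.symm x ↔
      ¬ ((x ∈ α.pts ∨ x = α.left) ∧ (α.left < y ∧ y ≤ α.right ∧ y ∉ α.pts))) :=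
  exists_perm_of_inversions
    (fun y x => ¬ ((x ∈ α.pts ∨ x = α.left) ∧ (α.left < y ∧ y ≤ α.right ∧ y ∉ α.pts)))
    (fun x y z hxy hyz h1 h2 h => by
      have hax : α.left ≤ x := by
        rcases h.1 with h | rfl
        · exact (Finset.mem_Ioo.1 (α.sub h)).1.le
        · exact le_rfl
      by_cases hy : y ∈ α.pts
      · exact h1 ⟨Or.inl hy, h.2⟩
      · exact h2 ⟨h.1, hax.trans_lt hxy, hyz.le.trans h.2.2.1, hy⟩)
    (fun x y z _ _ h => by
      by_contra! hc
      exact h ⟨hc.2.1, hc.1.2⟩)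

/-- The join-irreducible permutation with a given arc. -/
noncomputable def jirr (α : Arc n) : Equiv.Perm (Fin n) := α.exists_jirr.choose

/-- The meet-irreducible permutation with a given arc. -/
noncomputable def mirr (α : Arc n) : Equiv.Perm (Fin n) := α.exists_mirr.choose

theorem jirr_inv (α : Arc n) {x y : Fin n} (h : x < y) : α.jirr.symm y < α.jirr.symm x ↔
    (y ∈ α.pts ∨ y = α.right) ∧ (α.left ≤ x ∧ x < α.right ∧ x ∉ α.pts) :=
  α.exists_jirr.choose_spec x y h

theorem jirr_le_iff {α : Arc n} {σ : Equiv.Perm (Fin n)} : α.jirr ≤ σ ↔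
    ∀ x y, x < y → (y ∈ α.pts ∨ y = α.right) → α.left ≤ x → x < α.right → x ∉ α.pts →
      σ.symm y < σ.symm x := by
  rw [perm_le_iff]
  refine forall₃_congr fun x y h => ?_
  rw [jirr_inv α h]
  tauto

theorem le_mirr_iff {α : Arc n} {σ : Equiv.Perm (Fin n)} : σ ≤ α.mirr ↔
    ∀ x y, x < y → (x ∈ α.pts ∨ x = α.left) → α.left < y → y ≤ α.right → y ∉ α.pts →
      σ.symm x < σ.symm y := by
  rw [perm_le_iff]
  refine forall₃_congr fun x y h => ?_
  have hne : σ.symm x ≠ σ.symm y := by simpa using h.ne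
  rw [show α.mirr.symm y < α.mirr.symm x ↔ _ from α.exists_mirr.choose_spec x y h]
  rcases lt_or_gt_of_ne hne with h' | h'
  · simp [h', h'.not_gt]
  · simp only [h', h'.not_gt]
    tauto

/-- `α` is the arc of a pair of adjacent letters of `σ`. -/
def At (α : Arc n) (σ : Equiv.Perm (Fin n)) : Prop :=
  ((σ.symm α.left).1 + 1 = σ.symm α.right ∨ (σ.symm α.right).1 + 1 = σ.symm α.left) ∧
    ∀ v, α.left < v → v < α.right → (v ∈ α.pts ↔ σ.symm v < σ.symm α.left)

/-- Exchange the endpoints of `α` in `σ`. -/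
def flip (α : Arc n) (σ : Equiv.Perm (Fin n)) : Equiv.Perm (Fin n) :=
  Equiv.swap α.left α.right * σ

theorem flip_symm (α : Arc n) (σ : Equiv.Perm (Fin n)) (v : Fin n) :
    (α.flip σ).symm v =
      if v = α.left then σ.symm α.right else if v = α.right then σ.symm α.left else σ.symm v := by
  change σ.symm ((Equiv.swap α.left α.right).symm v) = _
  rw [Equiv.symm_swap, Equiv.swap_apply_def]
  split_ifs <;> rfl

@[simp]
theorem flip_flip (α : Arc n) (σ : Equiv.Perm (Fin n)) : α.flip (α.flip σ) = σ := by
  simp [flip]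

theorem flip_symm_left (α : Arc n) (σ : Equiv.Perm (Fin n)) :
    (α.flip σ).symm α.left = σ.symm α.right := by simp [flip_symm]

theorem flip_symm_right (α : Arc n) (σ : Equiv.Perm (Fin n)) :
    (α.flip σ).symm α.right = σ.symm α.left := by simp [flip_symm, α.lt.ne']

theorem flip_symm_of_ne (α : Arc n) (σ : Equiv.Perm (Fin n)) {v : Fin n} (h₁ : v ≠ α.left)
    (h₂ : v ≠ α.right) : (α.flip σ).symm v = σ.symm v := by simp [flip_symm, h₁, h₂]

theorem At.flip {α : Arc n} {σ : Equiv.Perm (Fin n)} (h : α.At σ) : α.At (α.flip σ) := by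
  refine ⟨?_, fun v h1 h2 => ?_⟩
  · rw [flip_symm_left, flip_symm_right]
    exact h.1.symm
  · rw [flip_symm_left, flip_symm_of_ne α σ h1.ne' h2.ne, h.2 v h1 h2]
    have e1 : (σ.symm v).1 ≠ σ.symm α.left := by
      simpa [Fin.val_inj] using h1.ne'
    have e2 : (σ.symm v).1 ≠ σ.symm α.right := by
      simpa [Fin.val_inj] using h2.ne
    have := h.1
    rw [Fin.lt_def, Fin.lt_def]
    omega

/-- The definition asks for the points before `right`, while `At` asks for those before `left`.
These agree because the endpoints are adjacent in the word. -/
theorem mem_descentDiagram {α : Arc n} {σ : Equiv.Perm (Fin n)} :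
    α ∈ descentDiagram σ ↔ α.At σ ∧ σ.symm α.right < σ.symm α.left := by
  constructor
  · rintro ⟨i, j, hij, hl, hr, hp⟩
    have hl' : σ.symm α.left = j := by simp [hl]
    have hr' : σ.symm α.right = i := by simp [hr]
    refine ⟨⟨Or.inr (by rw [hl', hr', hij]), fun v h1 h2 => ?_⟩, ?_⟩
    · rw [hp, hl']
      have e2 : (σ.symm v).1 ≠ σ.symm α.right := by
        simpa [Fin.val_inj] using h2.ne
      rw [hr'] at e2
      constructor
      · rintro ⟨l, hl, rfl, -⟩
        rw [Fin.lt_def] at *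
        simp
        omega
      · intro h
        refine ⟨σ.symm v, ?_, by simp, by simpa [← hl] using h1, by simpa [← hr] using h2⟩
        rw [Fin.lt_def] at *
        omega
    · rw [hl', hr', Fin.lt_def]
      omega
  · rintro ⟨⟨h1, h2⟩, h3⟩
    rw [Fin.lt_def] at h3
    refine ⟨σ.symm α.right, σ.symm α.left, by omega, by simp, by simp, fun v => ?_⟩
    constructor
    · intro hv
      have hv' := Finset.mem_Ioo.1 (α.sub hv)
      have := (h2 v hv'.1 hv'.2).1 hv
      have e2 : (σ.symm v).1 ≠ σ.symm α.right := by
        simpa [Fin.val_inj] using hv'.2.ne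
      refine ⟨σ.symm v, ?_, by simp, by simpa using hv'.1, by simpa using hv'.2⟩
      rw [Fin.lt_def] at *
      omega
    · rintro ⟨l, hl, rfl, h4, h5⟩
      rw [Equiv.apply_symm_apply] at h4 h5
      rw [h2 _ h4 h5]
      simp only [Equiv.symm_apply_apply]
      exact hl.trans h3

/-- No letter sits between two adjacent ones, so exchanging them changes only their own relative
order. -/
theorem flip_inv {α : Arc n} {σ : Equiv.Perm (Fin n)} (h : α ∈ descentDiagram σ) {x y : Fin n}
    (hxy : x < y) : (α.flip σ).symm y < (α.flip σ).symm x ↔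
      σ.symm y < σ.symm x ∧ ¬ (x = α.left ∧ y = α.right) := by
  rw [mem_descentDiagram] at h
  obtain ⟨⟨h1, -⟩, h3⟩ := h
  have hlt := α.lt
  have e : ∀ u v, u ≠ v → (σ.symm u).1 ≠ σ.symm v := fun u v h => by simpa [Fin.val_inj] using h
  have e1 := e x α.left
  have e2 := e x α.right
  have e3 := e y α.left
  have e4 := e y α.right
  rw [flip_symm, flip_symm]
  simp only [Fin.lt_def] at *
  by_cases a1 : x = α.left <;> by_cases a2 : x = α.right <;> by_cases a3 : y = α.left <;>
    by_cases a4 : y = α.right <;> grind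

theorem flip_le {α : Arc n} {σ : Equiv.Perm (Fin n)} (h : α ∈ descentDiagram σ) :
    α.flip σ ≤ σ :=
  perm_le_iff.2 fun _ _ hxy h' => ((flip_inv h hxy).1 h').1

theorem not_le_flip {α : Arc n} {σ : Equiv.Perm (Fin n)} (h : α ∈ descentDiagram σ) :
    ¬ σ ≤ α.flip σ := fun hle =>
  ((flip_inv h α.lt).1 (perm_le_iff.1 hle _ _ α.lt (mem_descentDiagram.1 h).2)).2 ⟨rfl, rfl⟩

theorem le_flip {α : Arc n} {σ τ : Equiv.Perm (Fin n)} (h : α ∈ descentDiagram σ)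
    (hτ : τ ≤ σ) (hn : ¬ τ.symm α.right < τ.symm α.left) : τ ≤ α.flip σ :=
  perm_le_iff.2 fun _ _ hxy h' => (flip_inv h hxy).2
    ⟨perm_le_iff.1 hτ _ _ hxy h', by rintro ⟨rfl, rfl⟩; exact hn h'⟩

theorem le_of_flip_le {α : Arc n} {σ τ : Equiv.Perm (Fin n)} (h : α ∈ descentDiagram σ)
    (hτ : α.flip σ ≤ τ) (hn : τ.symm α.right < τ.symm α.left) : σ ≤ τ :=
  perm_le_iff.2 fun x y hxy h' => by
    by_cases hc : x = α.left ∧ y = α.right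
    · obtain ⟨rfl, rfl⟩ := hc
      exact hn
    · exact perm_le_iff.1 hτ _ _ hxy ((flip_inv h hxy).2 ⟨h', hc⟩)

theorem flip_covBy {α : Arc n} {σ : Equiv.Perm (Fin n)} (h : α ∈ descentDiagram σ) :
    α.flip σ ⋖ σ := by
  refine ⟨lt_of_le_not_ge (flip_le h) (not_le_flip h), fun τ h1 h2 => ?_⟩
  by_cases hn : τ.symm α.right < τ.symm α.left
  · exact h2.not_ge (le_of_flip_le h h1.le hn)
  · exact h1.not_ge (le_flip h h2.le hn)

/-- In `σ` the letters of `pts` and `right` come weakly before `right`, and the other letters of the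
interval come weakly after `left`. Every inversion of `α.jirr` goes across this gap. -/
theorem jirr_le_of_mem {α : Arc n} {σ : Equiv.Perm (Fin n)} (h : α ∈ descentDiagram σ) :
    α.jirr ≤ σ := by
  rw [mem_descentDiagram] at h
  obtain ⟨⟨h1, h2⟩, h3⟩ := h
  rw [jirr_le_iff]
  intro x y hxy hy hx1 hx2 hx3
  have hy' : σ.symm y ≤ σ.symm α.right := by
    rcases hy with hy | rfl
    · have hv := Finset.mem_Ioo.1 (α.sub hy)
      have := (h2 y hv.1 hv.2).1 hy
      rw [Fin.lt_def] at *
      rw [Fin.le_def]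
      omega
    · exact le_rfl
  have hx' : σ.symm α.left ≤ σ.symm x := by
    rcases hx1.eq_or_lt with rfl | hx1
    · exact le_rfl
    · exact not_lt.1 fun h => hx3 ((h2 x hx1 hx2).2 h)
  exact hy'.trans_lt (h3.trans_le hx')

theorem jirr_left_right {α : Arc n} {σ : Equiv.Perm (Fin n)} (h : α.jirr ≤ σ) :
    σ.symm α.right < σ.symm α.left :=
  jirr_le_iff.1 h _ _ α.lt (Or.inr rfl) le_rfl α.lt
    fun h => (Finset.mem_Ioo.1 (α.sub h)).1.false

theorem mem_descentDiagram_jirr (α : Arc n) : α ∈ descentDiagram α.jirr := by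
  have h3 := jirr_left_right (le_refl α.jirr)
  have hS : ∀ v ∈ α.pts, α.jirr.symm v < α.jirr.symm α.left := fun v hv =>
    (jirr_inv α (Finset.mem_Ioo.1 (α.sub hv)).1).2
      ⟨Or.inl hv, le_rfl, α.lt, fun h => (Finset.mem_Ioo.1 (α.sub h)).1.false⟩
  refine mem_descentDiagram.2 ⟨⟨Or.inr ?_, fun v h1 h2 => ⟨hS v, fun h => ?_⟩⟩, h3⟩
  · by_contra hc
    have hlt : (α.jirr.symm α.right).1 + 1 < α.jirr.symm α.left := by
      rw [Fin.lt_def] at h3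
      omega
    -- If the endpoints were not adjacent, some letter would follow `right` and precede `left`. No
    -- value can do both, by the list of inversions.
    let p : Fin n := ⟨(α.jirr.symm α.right).1 + 1, hlt.trans (Fin.isLt _)⟩
    have hv1 : α.jirr.symm α.right < α.jirr.symm (α.jirr p) := by
      simp [p, Fin.lt_def]
    have hv2 : α.jirr.symm (α.jirr p) < α.jirr.symm α.left := by
      simpa [p, Fin.lt_def] using hlt
    generalize α.jirr p = v at hv1 hv2
    rcases lt_trichotomy v α.left with h | rfl | h
    · have := (jirr_inv α (h.trans α.lt)).1 hv1
      exact h.not_ge this.2.1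
    · exact lt_irrefl _ hv2
    · have h4 := ((jirr_inv α h).1 hv2).1
      rcases h4 with h4 | rfl
      · have h5 := (jirr_inv α (Finset.mem_Ioo.1 (α.sub h4)).2).1 hv1
        exact h5.2.2.2 h4
      · exact lt_irrefl _ hv1
  · exact ((jirr_inv α h1).1 h).1.resolve_right h2.ne

/-- Below `α.jirr`, the points of `pts` cannot move past `right`, nor the other points before
`left`. Inverting the endpoints therefore inverts everything, which makes `α.flip α.jirr` the unique
lower cover. -/
theorem jirr_le_of_le_jirr {α : Arc n} {τ : Equiv.Perm (Fin n)} (hτ : τ ≤ α.jirr)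
    (h : τ.symm α.right < τ.symm α.left) : α.jirr ≤ τ := by
  have hle := perm_le_iff.1 hτ
  rw [jirr_le_iff]
  intro x y hxy hy hx1 hx2 hx3
  have hy' : τ.symm y ≤ τ.symm α.right := by
    rcases hy with hy | rfl
    · have hv := Finset.mem_Ioo.1 (α.sub hy)
      by_contra hc
      exact ((jirr_inv α hv.2).1 (hle _ _ hv.2 (not_le.1 hc))).2.2.2 hy
    · exact le_rfl
  have hx' : τ.symm α.left ≤ τ.symm x := by
    rcases hx1.eq_or_lt with rfl | hx1
    · exact le_rfl
    · by_contra hc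
      rcases ((jirr_inv α hx1).1 (hle _ _ hx1 (not_le.1 hc))).1 with h | h
      · exact hx3 h
      · exact hx2.ne h
  exact hy'.trans_lt (h.trans_le hx')

theorem le_flip_jirr {α : Arc n} {τ : Equiv.Perm (Fin n)} (hτ : τ ≤ α.jirr)
    (h : ¬ α.jirr ≤ τ) : τ ≤ α.flip α.jirr :=
  le_flip α.mem_descentDiagram_jirr hτ fun h' => h (jirr_le_of_le_jirr hτ h')

theorem isJoinIrreduciblePerm_jirr (α : Arc n) : IsJoinIrreduciblePerm α.jirr := by
  refine ⟨α.flip α.jirr, flip_covBy α.mem_descentDiagram_jirr, fun τ hτ => ?_⟩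
  have h1 := le_flip_jirr hτ.1.le hτ.1.not_ge
  refine perm_le_antisymm h1 ?_
  by_contra h2
  exact hτ.2 (lt_of_le_not_ge h1 h2) (flip_covBy α.mem_descentDiagram_jirr).1

theorem eq_of_mem_descentDiagram {α β : Arc n} {σ : Equiv.Perm (Fin n)}
    (hα : α ∈ descentDiagram σ) (hβ : β ∈ descentDiagram σ)
    (h : α.left = β.left ∨ α.right = β.right) : α = β := by
  rw [mem_descentDiagram] at hα hβ
  obtain ⟨⟨h1, h2⟩, h3⟩ := hα
  obtain ⟨⟨h4, h5⟩, h6⟩ := hβ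
  simp only [Fin.lt_def] at h3 h6
  have hl : α.left = β.left := by
    rcases h with h | h
    · exact h
    · rw [h] at h1 h3
      exact σ.symm.injective (Fin.ext (by omega))
  have hr : α.right = β.right := by
    rw [hl] at h1 h3
    exact σ.symm.injective (Fin.ext (by omega))
  have hp : α.pts = β.pts := by
    ext v
    constructor <;> intro hv
    · have := Finset.mem_Ioo.1 (α.sub hv)
      rw [h5 v (hl ▸ this.1) (hr ▸ this.2), ← hl]
      exact (h2 v this.1 this.2).1 hv
    · have := Finset.mem_Ioo.1 (β.sub hv)
      rw [h2 v (hl ▸ this.1) (hr ▸ this.2), hl]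
      exact (h5 v this.1 this.2).1 hv
  exact Arc.ext hl hr hp

/-- A permutation is the join of the join-irreducible permutations of its descents. -/
theorem le_of_forall_jirr_le {σ τ : Equiv.Perm (Fin n)}
    (h : ∀ α ∈ descentDiagram σ, α.jirr ≤ τ) : σ ≤ τ := by
  -- Induction on the distance between the positions of an inverted pair; a letter between the two,
  -- both in position and in value, splits the pair.
  suffices H : ∀ d : ℕ, ∀ x y, x < y → (σ.symm y).1 < σ.symm x →
      (σ.symm x).1 = (σ.symm y).1 + d → τ.symm y < τ.symm x from
    perm_le_iff.2 fun x y hxy hlt => H _ x y hxy hlt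
      (Nat.add_sub_cancel' (le_of_lt (Fin.lt_def.1 hlt))).symm
  intro d
  induction d using Nat.strong_induction_on with
  | _ d ih =>
  intro x y hxy hlt hd
  by_cases hm : ∃ w, x < w ∧ w < y ∧ σ.symm y < σ.symm w ∧ σ.symm w < σ.symm x
  · obtain ⟨w, h1, h2, h3, h4⟩ := hm
    rw [Fin.lt_def] at h3 h4
    exact (ih ((σ.symm w).1 - (σ.symm y).1) (by omega) w y h2 h3 (by omega)).trans
      (ih ((σ.symm x).1 - (σ.symm w).1) (by omega) x w h1 h4 (by omega))
  · push Not at hm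
    -- With no such letter, the word from `y` to `x` avoids the values of `]x, y[`. It must then
    -- jump at some step from at least `y` to at most `x`, and the join-irreducible of this descent
    -- inverts the pair.
    have hex : ∃ i : ℕ, ∃ hi : i + 1 < n, (σ.symm y).1 ≤ i ∧ i + 1 ≤ (σ.symm x).1 ∧
        y ≤ σ ⟨i, by omega⟩ ∧ σ ⟨i + 1, hi⟩ ≤ x := by
      by_contra! hc
      have : ∀ e : ℕ, ∀ he : (σ.symm y).1 + e ≤ (σ.symm x).1,
          y ≤ σ ⟨(σ.symm y).1 + e, he.trans_lt (Fin.isLt _)⟩ := by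
        intro e
        induction e with
        | zero => intro he; simp
        | succ e ihe =>
          intro he
          have h1 := ihe (by omega)
          have hb := (σ.symm x).isLt
          have h2 := hc _ (by omega) (by omega) (by omega) h1
          by_contra h3
          push Not at h3
          have h4 := hm _ h2 h3 (by simp [Fin.lt_def])
          rw [Equiv.symm_apply_apply, Fin.le_def] at h4
          have h5 : σ.symm x = ⟨(σ.symm y).1 + e + 1, by omega⟩ :=
            Fin.ext (le_antisymm h4 (by simpa [add_assoc] using he))
          rw [← h5] at h2
          simp at h2
      have h1 := this d hd.ge
      have h2 : (⟨(σ.symm y).1 + d, hd.ge.trans_lt (Fin.isLt _)⟩ : Fin n) = σ.symm x :=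
        Fin.ext hd.symm
      rw [h2, Equiv.apply_symm_apply] at h1
      exact hxy.not_ge h1
    obtain ⟨i, hi, h1, h2, h3, h4⟩ := hex
    have hlt' : σ ⟨i + 1, hi⟩ < σ ⟨i, by omega⟩ := h4.trans_lt (hxy.trans_le h3)
    let α : Arc n := ⟨σ ⟨i + 1, hi⟩, σ ⟨i, by omega⟩, hlt',
      (Finset.Ioo _ _).filter fun v => (σ.symm v).1 < i + 1, Finset.filter_subset _ _⟩
    have hα : α ∈ descentDiagram σ := by
      refine mem_descentDiagram.2 ⟨⟨Or.inr (by simp [α]), fun v hv1 hv2 => ?_⟩,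
        by simp [α, Fin.lt_def]⟩
      have : v ∈ α.pts ↔ v ∈ Finset.Ioo α.left α.right ∧ (σ.symm v).1 < i + 1 :=
        Finset.mem_filter
      rw [this, Fin.lt_def]
      simp [α] at hv1 hv2 ⊢
      tauto
    have hle := jirr_le_iff.1 (h α hα)
    refine hle x y hxy ?_ h4 (hxy.trans_le h3) fun hx => ?_
    · rcases h3.eq_or_lt with h3 | h3
      · exact Or.inr h3
      · exact Or.inl (Finset.mem_filter.2 ⟨Finset.mem_Ioo.2 ⟨h4.trans_lt hxy, h3⟩, by omega⟩)
    · have := (Finset.mem_filter.1 hx).2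
      omega

end Arc

/-! ## The lattice congruence of an arc ideal -/

namespace Arc

variable {n : ℕ}

/-- Start from a pair inverted by `σ` but not by `α.mirr`. A point of `pts` placed after `y`, or a
point outside `pts` placed before `x`, gives a shorter pair of the same kind. When no such point is
left, `σ` is above the join-irreducible of the restriction of `α` to `[x, y]`. The conditions on the
ends of `β` record that `α.mirr` does not invert them. -/
theorem exists_jirr_le_of_not_le_mirr {α : Arc n} {σ : Equiv.Perm (Fin n)} (h : ¬ σ ≤ α.mirr) :
    ∃ β : Arc n, α.IsForcedBy β ∧ β.jirr ≤ σ ∧ (β.left ∈ α.pts ∨ β.left = α.left) ∧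
      β.right ∉ α.pts := by
  rw [le_mirr_iff] at h
  push Not at h
  obtain ⟨x, y, hxy, hx, hy1, hy2, hy3, hpos⟩ := h
  have hpos : σ.symm y < σ.symm x := lt_of_le_of_ne hpos (by simpa using hxy.ne')
  generalize hd : y.1 - x.1 = d
  induction d using Nat.strong_induction_on generalizing x y with
  | _ d ih =>
  have hax : α.left ≤ x := by
    rcases hx with hx | rfl
    · exact (Finset.mem_Ioo.1 (α.sub hx)).1.le
    · exact le_rfl
  let β : Arc n := ⟨x, y, hxy, α.pts ∩ Finset.Ioo x y, Finset.inter_subset_right⟩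
  by_cases hβ : β.jirr ≤ σ
  · exact ⟨β, ⟨hax, hy2, rfl⟩, hβ, hx, hy3⟩
  by_cases hs : ∃ v, x < v ∧ v < y ∧ v ∈ α.pts ∧ σ.symm y < σ.symm v
  · obtain ⟨v, h1, h2, h3, h4⟩ := hs
    rw [Fin.lt_def] at h1 h2
    exact ih _ (by omega) v y h2 (Or.inl h3) hy1 hy2 hy3 h4.le h4 rfl
  by_cases ht : ∃ v, x < v ∧ v < y ∧ v ∉ α.pts ∧ σ.symm v < σ.symm x
  · obtain ⟨v, h1, h2, h3, h4⟩ := ht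
    have h5 := hax.trans_lt h1
    have h6 := h2.le.trans hy2
    rw [Fin.lt_def] at h1 h2
    exact ih _ (by omega) x v h1 hx h5 h6 h3 h4.le h4 rfl
  push Not at hs ht
  refine absurd (jirr_le_iff.2 fun a b hab hb ha1 ha2 ha3 => ?_) hβ
  have hb' : σ.symm b ≤ σ.symm y := by
    rcases hb with hb | rfl
    · have := Finset.mem_inter.1 hb
      exact hs b (Finset.mem_Ioo.1 this.2).1 (Finset.mem_Ioo.1 this.2).2 this.1
    · exact le_rfl
  have ha' : σ.symm x ≤ σ.symm a := by
    rcases ha1.eq_or_lt with rfl | ha1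
    · exact le_rfl
    · exact ht a ha1 ha2 fun h => ha3 (Finset.mem_inter.2 ⟨h, Finset.mem_Ioo.2 ⟨ha1, ha2⟩⟩)
  exact hb'.trans_lt (hpos.trans_le ha')

/-- The same shrinking argument with the two orders of positions interchanged. -/
theorem exists_le_mirr_of_not_jirr_le {α : Arc n} {σ : Equiv.Perm (Fin n)} (h : ¬ α.jirr ≤ σ) :
    ∃ β : Arc n, α.IsForcedBy β ∧ σ ≤ β.mirr ∧ (β.right ∈ α.pts ∨ β.right = α.right) ∧
      β.left ∉ α.pts := by
  rw [jirr_le_iff] at h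
  push Not at h
  obtain ⟨x, y, hxy, hy, hx1, hx2, hx3, hpos⟩ := h
  have hpos : σ.symm x < σ.symm y := lt_of_le_of_ne hpos (by simpa using hxy.ne)
  generalize hd : y.1 - x.1 = d
  induction d using Nat.strong_induction_on generalizing x y with
  | _ d ih =>
  have hyb : y ≤ α.right := by
    rcases hy with hy | rfl
    · exact (Finset.mem_Ioo.1 (α.sub hy)).2.le
    · exact le_rfl
  let β : Arc n := ⟨x, y, hxy, α.pts ∩ Finset.Ioo x y, Finset.inter_subset_right⟩
  by_cases hβ : σ ≤ β.mirr
  · exact ⟨β, ⟨hx1, hyb, rfl⟩, hβ, hy, hx3⟩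
  by_cases hs : ∃ v, x < v ∧ v < y ∧ v ∈ α.pts ∧ σ.symm x < σ.symm v
  · obtain ⟨v, h1, h2, h3, h4⟩ := hs
    rw [Fin.lt_def] at h1 h2
    exact ih _ (by omega) x v h1 (Or.inl h3) hx1 hx2 hx3 h4.le h4 rfl
  by_cases ht : ∃ v, x < v ∧ v < y ∧ v ∉ α.pts ∧ σ.symm v < σ.symm y
  · obtain ⟨v, h1, h2, h3, h4⟩ := ht
    have h5 := hx1.trans h1.le
    have h6 := h2.trans_le hyb
    rw [Fin.lt_def] at h1 h2
    exact ih _ (by omega) v y h2 hy h5 h6 h3 h4.le h4 rfl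
  push Not at hs ht
  refine absurd (le_mirr_iff.2 fun a b hab ha hb1 hb2 hb3 => ?_) hβ
  have ha' : σ.symm a ≤ σ.symm x := by
    rcases ha with ha | rfl
    · have := Finset.mem_inter.1 ha
      exact hs a (Finset.mem_Ioo.1 this.2).1 (Finset.mem_Ioo.1 this.2).2 this.1
    · exact le_rfl
  have hb' : σ.symm y ≤ σ.symm b := by
    rcases hb2.eq_or_lt with rfl | hb2
    · exact le_rfl
    · exact ht b hb1 hb2 fun h => hb3 (Finset.mem_inter.2 ⟨h, Finset.mem_Ioo.2 ⟨hb1, hb2⟩⟩)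
  exact ha'.trans_lt (hpos.trans_le hb')

/-- The exchange loses a single inversion. If `β.jirr` has it, then `β.jirr ≤ σ` fixes on which side
of the descent each point of the interval lies, so `α` is a restriction of `β`. -/
theorem jirr_le_flip {α β : Arc n} {σ : Equiv.Perm (Fin n)} (hα : α ∈ descentDiagram σ)
    (hβ : β.jirr ≤ σ) (hf : ¬ β.IsForcedBy α) : β.jirr ≤ α.flip σ := by
  refine le_flip hα hβ fun hn => hf ?_
  obtain ⟨⟨h1, h2⟩, h3⟩ := mem_descentDiagram.1 hα
  obtain ⟨h4, h5, h6, h7⟩ := (jirr_inv β α.lt).1 hn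
  have hr : α.right ≤ β.right := by
    rcases h4 with h4 | h4
    · exact (Finset.mem_Ioo.1 (β.sub h4)).2.le
    · exact h4.le
  refine ⟨h5, hr, ?_⟩
  rw [jirr_le_iff] at hβ
  ext v
  rw [Finset.mem_inter, Finset.mem_Ioo]
  constructor
  · intro hv
    have hv' := Finset.mem_Ioo.1 (α.sub hv)
    refine ⟨?_, hv'⟩
    by_contra hc
    have h8 := hβ v α.right hv'.2 h4 (h5.trans hv'.1.le) (hv'.2.trans_le hr) hc
    have h9 := (h2 v hv'.1 hv'.2).1 hv
    rw [Fin.lt_def] at *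
    omega
  · rintro ⟨hv, hv'⟩
    exact (h2 v hv'.1 hv'.2).2 (hβ α.left v hv'.1 (Or.inl hv) h5 h6 h7)

theorem At.mem_or_mem {α : Arc n} {σ : Equiv.Perm (Fin n)} (h : α.At σ) :
    α ∈ descentDiagram σ ∨ α ∈ descentDiagram (α.flip σ) := by
  rw [mem_descentDiagram, mem_descentDiagram, flip_symm_left, flip_symm_right]
  have hne : σ.symm α.right ≠ σ.symm α.left := by simpa using α.lt.ne'
  rcases lt_or_gt_of_ne hne with h' | h'
  · exact Or.inl ⟨h, h'⟩
  · exact Or.inr ⟨h.flip, h'⟩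

end Arc

/-- Let the descent of `α` come first in the word. Its points and endpoints sit before the descent
of `β`, up to one shared letter, so those lying in `]β.left, β.right[` belong to `β.pts`. The first
condition of a crossing thus fails. -/
theorem isNoncrossing_descentDiagram {n : ℕ} (σ : Equiv.Perm (Fin n)) :
    IsNoncrossing (descentDiagram σ) := by
  have key : ∀ α ∈ descentDiagram σ, ∀ β ∈ descentDiagram σ,
      σ.symm α.right < σ.symm β.right → ∀ r,
      r ∈ Finset.Icc β.left β.right →
      r ∉ ({α.left, α.right} : Finset (Fin n)) ∩ {β.left, β.right} →
      r ∈ α.pts ∪ {α.left, α.right} → r ∉ β.pts → False := by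
    intro α hα β hβ hlt r h1 h2 h3 h4
    obtain ⟨⟨ha1, ha2⟩, ha3⟩ := Arc.mem_descentDiagram.1 hα
    obtain ⟨⟨hb1, hb2⟩, hb3⟩ := Arc.mem_descentDiagram.1 hβ
    simp only [Finset.mem_Icc, Finset.mem_inter, Finset.mem_union, Finset.mem_insert,
      Finset.mem_singleton, not_and_or, not_or] at h1 h2 h3
    have hr : σ.symm r ≤ σ.symm α.left := by
      rcases h3 with h3 | rfl | rfl
      · have := Finset.mem_Ioo.1 (α.sub h3)
        exact ((ha2 r this.1 this.2).1 h3).le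
      · exact le_rfl
      · exact ha3.le
    have hr' : r = α.left ∨ σ.symm r < σ.symm α.left := by
      rcases hr.eq_or_lt with h | h
      · exact Or.inl (σ.symm.injective h)
      · exact Or.inr h
    rcases h1.1.eq_or_lt with rfl | h5
    · rw [Fin.lt_def] at *
      rw [Fin.le_def] at *
      omega
    -- Two consecutive descents share a letter, the left end of one and the right end of the other;
    -- a crossing excludes common endpoints.
    rcases h1.2.eq_or_lt with h6 | h6
    · have : r = α.left := by
        rw [Fin.lt_def] at *
        rw [Fin.le_def] at *
        exact σ.symm.injective (Fin.ext (by rw [h6] at hr ⊢; omega))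
      exact h2.elim (fun h => h.1 this) (fun h => h.2 h6)
    · have h7 := mt (hb2 r h5 h6).2 h4
      have h8 : σ.symm r ≠ σ.symm β.left := by simpa using h5.ne'
      rw [Ne, Fin.ext_iff] at h8
      rw [Fin.lt_def] at *
      rw [Fin.le_def] at *
      omega
  intro α hα β hβ hne
  refine ⟨fun hc => ?_, fun h => hne (Arc.eq_of_mem_descentDiagram hα hβ (Or.inl h)),
    fun h => hne (Arc.eq_of_mem_descentDiagram hα hβ (Or.inr h))⟩
  obtain ⟨r, s, ⟨hr1, hr2⟩, ⟨hs1, hs2⟩, ⟨hr3, hr4⟩, ⟨hs3, hs4⟩⟩ := hc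
  have hne' : σ.symm α.right ≠ σ.symm β.right := fun h =>
    hne (Arc.eq_of_mem_descentDiagram hα hβ (Or.inr (σ.symm.injective h)))
  rcases lt_or_gt_of_ne hne' with h | h
  · exact key α hα β hβ h r (Finset.mem_inter.1 hr1).2 hr2 hr3 hr4
  · exact key β hβ α hα h s (Finset.mem_inter.1 hs1).1 (by rwa [Finset.inter_comm]) hs3 hs4

namespace ArcIdeal

variable {n : ℕ} (I : ArcIdeal n)

/-- Two permutations are congruent when they are above the same join-irreducible permutations with
arc in `I`. -/
def congruence : Setoid (Equiv.Perm (Fin n)) where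
  r σ τ := ∀ α ∈ I.carrier, α.jirr ≤ σ ↔ α.jirr ≤ τ
  iseqv := ⟨fun _ _ _ => Iff.rfl, fun h α hα => (h α hα).symm,
    fun h₁ h₂ α hα => (h₁ α hα).trans (h₂ α hα)⟩

variable {I}

theorem congruence_iff {σ τ : Equiv.Perm (Fin n)} :
    I.congruence σ τ ↔ ∀ α ∈ I.carrier, α.jirr ≤ σ ↔ α.jirr ≤ τ := Iff.rfl

/-- A failed test at `α` against a meet-irreducible produces a passed test at a restriction `β` of
`α` against a join-irreducible, and conversely. As `I` is closed under restriction, `β` is again in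
`I`, where the hypothesis applies. -/
theorem congruence_iff_le_mirr {σ τ : Equiv.Perm (Fin n)} :
    I.congruence σ τ ↔ ∀ α ∈ I.carrier, σ ≤ α.mirr ↔ τ ≤ α.mirr := by
  have contra : ∀ {ρ : Equiv.Perm (Fin n)} {x y : Fin n}, ρ.symm x < ρ.symm y →
      ρ.symm y < ρ.symm x → False := fun h h' => lt_asymm h h'
  have one : ∀ {σ τ : Equiv.Perm (Fin n)}, (∀ α ∈ I.carrier, α.jirr ≤ σ → α.jirr ≤ τ) →
      ∀ α ∈ I.carrier, τ ≤ α.mirr → σ ≤ α.mirr := by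
    intro σ τ h α hα hτ
    by_contra hσ
    obtain ⟨β, hf, h1, h2, h3⟩ := Arc.exists_jirr_le_of_not_le_mirr hσ
    exact contra (Arc.le_mirr_iff.1 hτ _ _ β.lt h2 (hf.1.trans_lt β.lt) hf.2.1 h3)
      (Arc.jirr_left_right (h β (I.closed α hα β hf) h1))
  have two : ∀ {σ τ : Equiv.Perm (Fin n)}, (∀ α ∈ I.carrier, τ ≤ α.mirr → σ ≤ α.mirr) →
      ∀ α ∈ I.carrier, α.jirr ≤ σ → α.jirr ≤ τ := by
    intro σ τ h α hα hσ
    by_contra hτ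
    obtain ⟨β, hf, h1, h2, h3⟩ := Arc.exists_le_mirr_of_not_jirr_le hτ
    exact contra (Arc.le_mirr_iff.1 (h β (I.closed α hα β hf) h1) _ _ β.lt (Or.inr rfl) β.lt
      le_rfl fun h => (Finset.mem_Ioo.1 (β.sub h)).2.false)
      (Arc.jirr_le_iff.1 hσ _ _ β.lt h2 hf.1 (β.lt.trans_le hf.2.1) h3)
  rw [congruence_iff]
  exact ⟨fun h α hα => ⟨one (fun β hβ => (h β hβ).2) α hα, one (fun β hβ => (h β hβ).1) α hα⟩,
    fun h α hα => ⟨two (fun β hβ => (h β hβ).2) α hα, two (fun β hβ => (h β hβ).1) α hα⟩⟩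

/-- Tests of the form `· ≤ α.mirr` are compatible with joins, and tests `α.jirr ≤ ·` with meets; the
two families define the same relation. -/
theorem isLatticeCongruence_congruence : IsLatticeCongruence I.congruence where
  join x x' y y' z z' hx hy hz hz' := by
    rw [congruence_iff_le_mirr] at *
    intro α hα
    rw [isLUB_le_iff hz, isLUB_le_iff hz']
    simp only [mem_upperBounds, Set.mem_insert_iff, Set.mem_singleton_iff, forall_eq_or_imp,
      forall_eq, hx α hα, hy α hα]
  meet x x' y y' z z' hx hy hz hz' := by
    rw [congruence_iff] at *
    intro α hα
    rw [le_isGLB_iff hz, le_isGLB_iff hz']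
    simp only [mem_lowerBounds, Set.mem_insert_iff, Set.mem_singleton_iff, forall_eq_or_imp,
      forall_eq, hx α hα, hy α hα]

/-- A join-irreducible lost in the exchange has an arc that restricts to `α`; were that arc in `I`,
so would be `α`. -/
theorem congruence_flip_of_mem {α : Arc n} {σ : Equiv.Perm (Fin n)} (hα : α ∉ I.carrier)
    (h : α ∈ descentDiagram σ) : I.congruence σ (α.flip σ) := fun β hβ =>
  ⟨fun h' => Arc.jirr_le_flip h h' fun hf => hα (I.closed β hβ α hf),
    fun h' => h'.trans (Arc.flip_le h)⟩

theorem congruence_flip {α : Arc n} {σ : Equiv.Perm (Fin n)} (hα : α ∉ I.carrier)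
    (h : α.At σ) : I.congruence σ (α.flip σ) := by
  rcases h.mem_or_mem with h | h
  · exact congruence_flip_of_mem hα h
  · have := congruence_flip_of_mem hα h
    rw [Arc.flip_flip] at this
    exact I.congruence.symm this

variable (I) in
/-- Permutations related by exchanging the adjacent endpoints of an arc not in `I`. -/
def Adj (σ τ : Equiv.Perm (Fin n)) : Prop :=
  ∃ α ∉ I.carrier, α ∈ descentDiagram σ ∧ τ = α.flip σ

variable (I) in
-- Exchanging a descent whose arc is outside `I` goes strictly down, so the process stops.
theorem exists_reduced (σ : Equiv.Perm (Fin n)) :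
    ∃ τ, Relation.ReflTransGen I.Adj σ τ ∧ descentDiagram τ ⊆ I.carrier := by
  induction σ using WellFoundedLT.induction with
  | _ σ ih =>
  by_cases h : descentDiagram σ ⊆ I.carrier
  · exact ⟨σ, .refl, h⟩
  · obtain ⟨α, h1, h2⟩ := Set.not_subset.1 h
    obtain ⟨τ, h3, h4⟩ := ih (α.flip σ) (Arc.flip_covBy h1).1
    exact ⟨τ, h3.head ⟨α, h2, h1, rfl⟩, h4⟩

theorem congruence_of_reflTransGen {σ τ : Equiv.Perm (Fin n)}
    (h : Relation.ReflTransGen I.Adj σ τ) : I.congruence σ τ := by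
  induction h with
  | refl => exact I.congruence.refl _
  | tail _ h ih =>
    obtain ⟨α, hα, h, rfl⟩ := h
    exact I.congruence.trans ih (congruence_flip_of_mem hα h)

/-- `τ` is the join of the join-irreducibles of its descents. Their arcs are in `I`, so every
congruent permutation is above all of them. -/
theorem isProjDown_of_reduced {σ τ : Equiv.Perm (Fin n)} (h : I.congruence σ τ)
    (hτ : descentDiagram τ ⊆ I.carrier) : IsProjDown I.congruence σ τ :=
  ⟨h, fun _ hρ => Arc.le_of_forall_jirr_le fun α hα =>
    (hρ α (hτ hα)).1 ((h α (hτ hα)).2 (Arc.jirr_le_of_mem hα))⟩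

theorem uncontractedArcs_congruence : uncontractedArcs I.congruence = I.carrier := by
  ext α
  constructor
  · rintro ⟨σ, -, h, hα⟩
    by_contra hc
    exact Arc.not_le_flip hα (h.2 (congruence_flip_of_mem hc hα))
  · intro hα
    exact ⟨α.jirr, α.isJoinIrreduciblePerm_jirr,
      ⟨I.congruence.refl _, fun _ hρ => (hρ α hα).1 le_rfl⟩, α.mem_descentDiagram_jirr⟩

/-- Each descent gives a lower cover, and distinct descents give distinct ones; so there is a single
descent, which determines the permutation. -/
theorem eq_jirr_of_isJoinIrreduciblePerm {α : Arc n} {σ : Equiv.Perm (Fin n)}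
    (h : IsJoinIrreduciblePerm σ) (hα : α ∈ descentDiagram σ) : σ = α.jirr := by
  refine perm_le_antisymm (Arc.le_of_forall_jirr_le fun β hβ => ?_) (Arc.jirr_le_of_mem hα)
  have he := h.unique (Arc.flip_covBy hα) (Arc.flip_covBy hβ)
  have h1 := Arc.flip_inv hα β.lt
  rw [he, Arc.flip_inv hβ β.lt] at h1
  simp only [(Arc.mem_descentDiagram.1 hβ).2, true_and, and_self, not_true, false_iff,
    not_not] at h1
  rw [Arc.eq_of_mem_descentDiagram hβ hα (Or.inl h1.1)]

/-- A lattice congruence is determined by its uncontracted arcs. -/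
theorem eq_congruence {r : Setoid (Equiv.Perm (Fin n))} (hr : IsLatticeCongruence r)
    (h : uncontractedArcs r = I.carrier) : r = I.congruence := by
  -- A contracted join-irreducible is related to some element not above it. Their meet lies strictly
  -- below `α.jirr`, hence below its lower cover, and joining with this cover relates the cover to
  -- `α.jirr`.
  have hj : ∀ α ∉ I.carrier, r α.jirr (α.flip α.jirr) := by
    intro α hα
    have h1 : ¬ IsProjDown r α.jirr α.jirr := fun hp => hα <| by
      rw [← h]
      exact ⟨_, α.isJoinIrreduciblePerm_jirr, hp, α.mem_descentDiagram_jirr⟩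
    have h2 : ∃ ρ, r α.jirr ρ ∧ ¬ α.jirr ≤ ρ := by
      by_contra! hc
      exact h1 ⟨r.refl _, fun _ hρ => hc _ hρ⟩
    obtain ⟨ρ, h3, h4⟩ := h2
    obtain ⟨z, hz⟩ := exists_isGLB_pair α.jirr ρ
    have h5 : r α.jirr z := hr.meet _ _ _ _ _ _ (r.refl _) h3 (isGLB_pair_self _) hz
    have h6 : z ≤ α.jirr := hz.1 (Set.mem_insert _ _)
    have h7 : z ≤ ρ := hz.1 (Set.mem_insert_of_mem _ rfl)
    exact hr.join _ _ _ _ _ _ h5 (r.refl (α.flip α.jirr))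
      (isLUB_pair_of_ge (Arc.flip_le α.mem_descentDiagram_jirr))
      (isLUB_pair_of_le (Arc.le_flip_jirr h6 fun h8 => h4 (h8.trans h7)))
  -- Join the previous relation with `α.flip σ`: one side becomes `σ`, the other stays `α.flip σ`.
  have hcov : ∀ α ∉ I.carrier, ∀ σ, α ∈ descentDiagram σ → r σ (α.flip σ) := by
    intro α hα σ hσ
    have hle : α.flip α.jirr ≤ α.flip σ :=
      Arc.le_flip hσ ((Arc.flip_le α.mem_descentDiagram_jirr).trans (Arc.jirr_le_of_mem hσ)) <| by
        rw [Arc.flip_symm_left, Arc.flip_symm_right]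
        exact (Arc.jirr_left_right le_rfl).not_gt
    refine hr.join _ _ _ _ _ _ (hj α hα) (r.refl (α.flip σ)) ⟨?_, fun τ hτ => ?_⟩
      (isLUB_pair_of_le hle)
    · rintro _ (rfl | rfl)
      exacts [Arc.jirr_le_of_mem hσ, Arc.flip_le hσ]
    · exact Arc.le_of_flip_le hσ (hτ (Set.mem_insert_of_mem _ rfl))
        (Arc.jirr_left_right (hτ (Set.mem_insert _ _)))
  have hgen : ∀ {σ τ}, Relation.ReflTransGen I.Adj σ τ → r σ τ := by
    intro σ τ h
    induction h with
    | refl => exact r.refl _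
    | tail _ h ih =>
      obtain ⟨α, hα, h, rfl⟩ := h
      exact r.trans ih (hcov α hα _ h)
  -- Here `α.jirr` is the bottom of its `r`-class. Meeting `σ` and `τ` with it puts `α.jirr ⊓ τ` in
  -- this class, hence `α.jirr ≤ τ`.
  have hone : ∀ {σ τ}, r σ τ → ∀ α ∈ I.carrier, α.jirr ≤ σ → α.jirr ≤ τ := by
    intro σ τ hστ α hα hσ
    rw [← h] at hα
    obtain ⟨π, h1, h2, h3⟩ := hα
    obtain rfl := eq_jirr_of_isJoinIrreduciblePerm h1 h3
    obtain ⟨z, hz⟩ := exists_isGLB_pair α.jirr τ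
    exact (h2.2 (hr.meet _ _ _ _ _ _ (r.refl _) hστ (isGLB_pair_of_le hσ) hz)).trans
      (hz.1 (Set.mem_insert_of_mem _ rfl))
  ext σ τ
  refine ⟨fun h α hα => ⟨hone h α hα, hone (r.symm h) α hα⟩, fun h => ?_⟩
  obtain ⟨σ', h1, h2⟩ := I.exists_reduced σ
  obtain ⟨τ', h3, h4⟩ := I.exists_reduced τ
  have h5 := isProjDown_of_reduced (congruence_of_reflTransGen h1) h2
  have h6 := isProjDown_of_reduced (congruence_of_reflTransGen h3) h4
  have h7 : σ' = τ' := perm_le_antisymm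
    (h5.2 (I.congruence.trans h h6.1)) (h6.2 (I.congruence.trans (I.congruence.symm h) h5.1))
  subst h7
  exact r.trans (hgen h1) (r.symm (hgen h3))

/-- `eta` collects arcs over all congruences with the given uncontracted arcs; existence and
uniqueness reduce this to one congruence and one bottom element. -/
theorem eta_eq {σ τ : Equiv.Perm (Fin n)} (h : IsProjDown I.congruence σ τ) :
    eta I σ = descentDiagram τ := by
  ext α
  constructor
  · rintro ⟨r, h1, h2, τ', h3, h4⟩
    rw [eq_congruence h1 h2] at h3
    rwa [perm_le_antisymm (h.2 h3.1) (h3.2 h.1)]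
  · exact fun hα => ⟨_, isLatticeCongruence_congruence, uncontractedArcs_congruence, τ, h, hα⟩

theorem exists_eta_eq (I : ArcIdeal n) (σ : Equiv.Perm (Fin n)) :
    ∃ τ, Relation.ReflTransGen I.Adj σ τ ∧ descentDiagram τ ⊆ I.carrier ∧
      eta I σ = descentDiagram τ := by
  obtain ⟨τ, h1, h2⟩ := I.exists_reduced σ
  exact ⟨τ, h1, h2, eta_eq (isProjDown_of_reduced (congruence_of_reflTransGen h1) h2)⟩

theorem eta_subset (I : ArcIdeal n) (σ : Equiv.Perm (Fin n)) : eta I σ ⊆ I.carrier := by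
  obtain ⟨τ, -, h, he⟩ := I.exists_eta_eq σ
  exact he ▸ h

theorem isNoncrossing_eta (I : ArcIdeal n) (σ : Equiv.Perm (Fin n)) :
    IsNoncrossing (eta I σ) := by
  obtain ⟨τ, -, h, he⟩ := I.exists_eta_eq σ
  exact he ▸ isNoncrossing_descentDiagram τ

theorem eta_flip {α : Arc n} {σ : Equiv.Perm (Fin n)} (hα : α ∉ I.carrier) (h : α.At σ) :
    eta I (α.flip σ) = eta I σ := by
  obtain ⟨τ, h1, h2⟩ := I.exists_reduced σ
  have h3 := congruence_of_reflTransGen h1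
  rw [eta_eq (isProjDown_of_reduced h3 h2), eta_eq (isProjDown_of_reduced
    (I.congruence.trans (I.congruence.symm (congruence_flip hα h)) h3) h2)]

/-- Invariance under exchanges of the endpoints of arcs not in `I`. -/
def Stable (I : ArcIdeal n) (P : Equiv.Perm (Fin n) → Prop) : Prop :=
  ∀ α ∉ I.carrier, ∀ σ, α.At σ → P σ → P (α.flip σ)

/-- Both permutations reduce, by exchanges preserving `P`, to permutations with the same descent
diagram. The diagram determines the permutation, so the two reductions coincide. -/
theorem Stable.iff_of_eta_eq {P : Equiv.Perm (Fin n) → Prop} (hP : I.Stable P)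
    {σ τ : Equiv.Perm (Fin n)} (h : eta I σ = eta I τ) : P σ ↔ P τ := by
  have hgen : ∀ {σ τ}, Relation.ReflTransGen I.Adj σ τ → (P σ ↔ P τ) := by
    intro σ τ h
    induction h with
    | refl => rfl
    | tail _ h ih =>
      obtain ⟨α, hα, h, rfl⟩ := h
      have h' := (Arc.mem_descentDiagram.1 h).1
      refine ih.trans ⟨hP α hα _ h', fun h2 => ?_⟩
      have := hP α hα _ h'.flip h2
      rwa [Arc.flip_flip] at this
  obtain ⟨σ', h1, -, h2⟩ := I.exists_eta_eq σ
  obtain ⟨τ', h3, -, h4⟩ := I.exists_eta_eq τ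
  have h5 : descentDiagram σ' = descentDiagram τ' := by rw [← h2, h, h4]
  have h6 : σ' = τ' := perm_le_antisymm
    (Arc.le_of_forall_jirr_le fun α hα => Arc.jirr_le_of_mem (h5 ▸ hα))
    (Arc.le_of_forall_jirr_le fun α hα => Arc.jirr_le_of_mem (h5 ▸ hα))
  subst h6
  exact (hgen h1).trans (hgen h3).symm

end ArcIdeal

/-! ## Standardization -/

section Standardization

variable {p q r s : ℕ}

theorem perm_eq_of_lt {σ τ : Equiv.Perm (Fin p)} (h : ∀ i j, σ i < σ j → τ i < τ j) : σ = τ :=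
  Equiv.symm_bijective.injective (perm_eq_of_symm_lt h)

theorem orderEmb_eq_of_range {R S : Fin q ↪o Fin p} (h : Set.range R = Set.range S) : R = S :=
  DFunLike.coe_injective ((StrictMono.range_inj R.strictMono S.strictMono).1 h)

theorem stdWord_lt {w : Fin q → Fin p} (hw : Function.Injective w) {i j : Fin q} :
    stdWord w i < stdWord w j ↔ w i < w j := by
  have hm : StrictMono (w ∘ Tuple.sort w) :=
    (Tuple.monotone_sort w).strictMono_of_injective (hw.comp (Tuple.sort w).injective)
  have := hm.lt_iff_lt (a := stdWord w i) (b := stdWord w j)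
  rw [← this]
  simp [stdWord]

theorem stdPos_lt (ρ : Equiv.Perm (Fin p)) (Q : Fin q ↪o Fin p) {i j : Fin q} :
    stdPos ρ Q i < stdPos ρ Q j ↔ ρ (Q i) < ρ (Q j) :=
  stdWord_lt (w := fun i => ρ (Q i)) (ρ.injective.comp Q.injective)

theorem range_imageEmb (ρ : Equiv.Perm (Fin p)) (Q : Fin q ↪o Fin p) :
    Set.range (imageEmb ρ Q) = ρ '' Set.range Q := by
  rw [imageEmb, Finset.range_orderEmbOfFin]
  ext
  simp

theorem mem_range_imageEmb {ρ : Equiv.Perm (Fin p)} {Q : Fin q ↪o Fin p} {v : Fin p} :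
    v ∈ Set.range (imageEmb ρ Q) ↔ ρ.symm v ∈ Set.range Q := by
  rw [range_imageEmb, Equiv.image_eq_preimage_symm, Set.mem_preimage]

theorem imageEmb_stdPos (ρ : Equiv.Perm (Fin p)) (Q : Fin q ↪o Fin p) (i : Fin q) :
    imageEmb ρ Q (stdPos ρ Q i) = ρ (Q i) := by
  have hm : StrictMono fun u => ρ (Q ((stdPos ρ Q).symm u)) := fun u v huv => by
    rw [← stdPos_lt]
    simpa using huv
  have := (StrictMono.range_inj (imageEmb ρ Q).strictMono hm).1 (by
    rw [range_imageEmb]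
    ext v
    constructor
    · rintro ⟨_, ⟨j, rfl⟩, rfl⟩
      exact ⟨stdPos ρ Q j, by simp⟩
    · rintro ⟨u, rfl⟩
      exact ⟨_, ⟨_, rfl⟩, rfl⟩)
  simpa using congrFun this (stdPos ρ Q i)

theorem symm_imageEmb (ρ : Equiv.Perm (Fin p)) (Q : Fin q ↪o Fin p) (u : Fin q) :
    ρ.symm (imageEmb ρ Q u) = Q ((stdPos ρ Q).symm u) := by
  rw [Equiv.symm_apply_eq, ← imageEmb_stdPos, Equiv.apply_symm_apply]

theorem stdPos_symm_lt (ρ : Equiv.Perm (Fin p)) (Q : Fin q ↪o Fin p) {u v : Fin q} :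
    (stdPos ρ Q).symm u < (stdPos ρ Q).symm v ↔
      ρ.symm (imageEmb ρ Q u) < ρ.symm (imageEmb ρ Q v) := by
  rw [symm_imageEmb, symm_imageEmb, Q.lt_iff_lt]

theorem eq_stdPos {ρ : Equiv.Perm (Fin p)} {Q : Fin q ↪o Fin p} {σ : Equiv.Perm (Fin q)}
    (h : ∀ i j, σ i < σ j → ρ (Q i) < ρ (Q j)) : σ = stdPos ρ Q :=
  perm_eq_of_lt fun i j hij => (stdPos_lt ρ Q).2 (h i j hij)

theorem stdVal_symm_lt (ρ : Equiv.Perm (Fin p)) (R : Fin q ↪o Fin p) {u v : Fin q} :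
    (stdVal ρ R).symm u < (stdVal ρ R).symm v ↔ ρ.symm (R u) < ρ.symm (R v) := by
  have h : imageEmb ρ (imageEmb ρ⁻¹ R) = R := by
    refine orderEmb_eq_of_range ?_
    rw [range_imageEmb, range_imageEmb, ← Set.image_comp]
    simp
  rw [stdVal, stdPos_symm_lt, h]

theorem eq_stdVal {ρ : Equiv.Perm (Fin p)} {R : Fin q ↪o Fin p} {σ : Equiv.Perm (Fin q)}
    (h : ∀ u v, σ.symm u < σ.symm v → ρ.symm (R u) < ρ.symm (R v)) : σ = stdVal ρ R :=
  perm_eq_of_symm_lt fun u v huv => (stdVal_symm_lt ρ R).2 (h u v huv)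

theorem stdVal_stdVal (ρ : Equiv.Perm (Fin p)) (R : Fin q ↪o Fin p) (S : Fin r ↪o Fin q) :
    stdVal (stdVal ρ R) S = stdVal ρ (S.trans R) :=
  eq_stdVal fun u v huv => by
    rwa [stdVal_symm_lt, stdVal_symm_lt] at huv

theorem stdPos_stdPos (ρ : Equiv.Perm (Fin p)) (Q : Fin q ↪o Fin p) (S : Fin r ↪o Fin q) :
    stdPos (stdPos ρ Q) S = stdPos ρ (S.trans Q) :=
  eq_stdPos fun i j hij => by
    rwa [stdPos_lt, stdPos_lt] at hij

theorem imageEmb_trans (ρ : Equiv.Perm (Fin p)) (Q : Fin q ↪o Fin p) (S : Fin r ↪o Fin q) :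
    (imageEmb (stdPos ρ Q) S).trans (imageEmb ρ Q) = imageEmb ρ (S.trans Q) := by
  refine orderEmb_eq_of_range ?_
  simp only [RelEmbedding.coe_trans, Set.range_comp, range_imageEmb, Set.image_image,
    imageEmb_stdPos]

/-- Standardizing positions and standardizing values commute. -/
theorem stdVal_stdPos {ρ : Equiv.Perm (Fin p)} {Q : Fin q ↪o Fin p} {R : Fin r ↪o Fin p}
    {R' : Fin s ↪o Fin q} {Q' : Fin s ↪o Fin r}
    (h : ∀ c, imageEmb ρ Q (R' c) = R (imageEmb (stdVal ρ R) Q' c)) :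
    stdVal (stdPos ρ Q) R' = stdPos (stdVal ρ R) Q' :=
  perm_eq_of_symm_lt fun u v huv => by
    rwa [stdVal_symm_lt, stdPos_symm_lt, h, h, ← stdVal_symm_lt, ← stdPos_symm_lt] at huv

/-- Letters in the same half are compared by `e₁` or `e₂`; letters in different halves are ordered
by their halves on both sides. -/
theorem stdVal_eq_of_split {m a a' : ℕ} {ρ : Equiv.Perm (Fin p)} {Q₁ : Fin q ↪o Fin p}
    {Q₂ : Fin r ↪o Fin p} {σ : Equiv.Perm (Fin m)} {q₁ : Fin a ↪o Fin m} {q₂ : Fin a' ↪o Fin m}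
    {R : Fin m ↪o Fin p} {R₁ : Fin a ↪o Fin q} {R₂ : Fin a' ↪o Fin r}
    (hQ : ∀ i j, Q₁ i < Q₂ j) (hq : ∀ i j, q₁ i < q₂ j)
    (hc : ∀ i, i ∈ Set.range q₁ ∨ i ∈ Set.range q₂)
    (h₁ : ∀ c, imageEmb ρ Q₁ (R₁ c) = R (imageEmb σ q₁ c))
    (h₂ : ∀ c, imageEmb ρ Q₂ (R₂ c) = R (imageEmb σ q₂ c))
    (e₁ : stdVal (stdPos ρ Q₁) R₁ = stdPos σ q₁) (e₂ : stdVal (stdPos ρ Q₂) R₂ = stdPos σ q₂) :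
    stdVal ρ R = σ := by
  symm
  refine eq_stdVal fun u v huv => ?_
  have hc' : ∀ u, u ∈ Set.range (imageEmb σ q₁) ∨ u ∈ Set.range (imageEmb σ q₂) := fun u => by
    rw [mem_range_imageEmb, mem_range_imageEmb]
    exact hc _
  rcases hc' u with ⟨c, rfl⟩ | ⟨c, rfl⟩ <;> rcases hc' v with ⟨d, rfl⟩ | ⟨d, rfl⟩
  · rwa [← h₁, ← h₁, ← stdPos_symm_lt, ← stdVal_symm_lt, e₁, stdPos_symm_lt]
  · rw [← h₁, ← h₂, symm_imageEmb, symm_imageEmb]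
    exact hQ _ _
  · rw [symm_imageEmb, symm_imageEmb] at huv
    exact absurd huv (hq _ _).not_gt
  · rwa [← h₂, ← h₂, ← stdPos_symm_lt, ← stdVal_symm_lt, e₂, stdPos_symm_lt]

theorem perm_eq_of_stdPos {ρ π : Equiv.Perm (Fin p)} {Q₁ : Fin q ↪o Fin p} {Q₂ : Fin r ↪o Fin p}
    (hc : ∀ i, i ∈ Set.range Q₁ ∨ i ∈ Set.range Q₂)
    (h₁ : imageEmb ρ Q₁ = imageEmb π Q₁) (h₂ : imageEmb ρ Q₂ = imageEmb π Q₂)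
    (e₁ : stdPos ρ Q₁ = stdPos π Q₁) (e₂ : stdPos ρ Q₂ = stdPos π Q₂) : ρ = π := by
  ext i
  rcases hc i with ⟨j, rfl⟩ | ⟨j, rfl⟩
  · rw [← imageEmb_stdPos, h₁, e₁, imageEmb_stdPos]
  · rw [← imageEmb_stdPos, h₂, e₂, imageEmb_stdPos]

/-- Glue two permutations, of given positions and values. -/
theorem exists_perm_glue {Q₁ A : Fin q ↪o Fin p} {Q₂ B : Fin r ↪o Fin p}
    (hQ : IsCompl (Set.range Q₁) (Set.range Q₂)) (hA : IsCompl (Set.range A) (Set.range B))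
    (α : Equiv.Perm (Fin q)) (β : Equiv.Perm (Fin r)) : ∃ ρ : Equiv.Perm (Fin p),
      imageEmb ρ Q₁ = A ∧ imageEmb ρ Q₂ = B ∧ stdPos ρ Q₁ = α ∧ stdPos ρ Q₂ = β := by
  have hb : ∀ {Q : Fin q ↪o Fin p} {Q' : Fin r ↪o Fin p},
      IsCompl (Set.range Q) (Set.range Q') → Function.Bijective (Sum.elim Q Q') := by
    intro Q Q' h
    refine ⟨Q.injective.sumElim Q'.injective fun i j hij => ?_, fun v => ?_⟩
    · exact Set.disjoint_left.1 h.disjoint ⟨i, rfl⟩ ⟨j, hij.symm⟩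
    · rcases (h.sup_eq_top.ge (Set.mem_univ v) :
        v ∈ Set.range Q ∪ Set.range Q') with ⟨i, rfl⟩ | ⟨i, rfl⟩
      exacts [⟨Sum.inl i, rfl⟩, ⟨Sum.inr i, rfl⟩]
  let e := Equiv.ofBijective _ (hb hQ)
  let f := Equiv.ofBijective _ (hb hA)
  let ρ : Equiv.Perm (Fin p) := (e.symm.trans (Equiv.sumCongr α β)).trans f
  have h₁ : ∀ i, ρ (Q₁ i) = A (α i) := fun i => by
    have : e.symm (Q₁ i) = Sum.inl i := (Equiv.symm_apply_eq e).2 rfl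
    simp only [ρ, Equiv.trans_apply, this]
    rfl
  have h₂ : ∀ i, ρ (Q₂ i) = B (β i) := fun i => by
    have : e.symm (Q₂ i) = Sum.inr i := (Equiv.symm_apply_eq e).2 rfl
    simp only [ρ, Equiv.trans_apply, this]
    rfl
  refine ⟨ρ, orderEmb_eq_of_range ?_, orderEmb_eq_of_range ?_,
    (eq_stdPos fun i j h => ?_).symm, (eq_stdPos fun i j h => ?_).symm⟩
  · rw [range_imageEmb, ← Set.range_comp, Function.comp_def]
    simp only [h₁]
    exact α.surjective.range_comp A
  · rw [range_imageEmb, ← Set.range_comp, Function.comp_def]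
    simp only [h₂]
    exact β.surjective.range_comp B
  · rwa [h₁, h₁, A.lt_iff_lt]
  · rwa [h₂, h₂, B.lt_iff_lt]

theorem mem_range_castLEOrderEmb {k : ℕ} (h : k ≤ p) {v : Fin p} :
    v ∈ Set.range (Fin.castLEOrderEmb h) ↔ v.1 < k :=
  ⟨by rintro ⟨i, rfl⟩; exact i.isLt, fun hv => ⟨⟨v.1, hv⟩, rfl⟩⟩

theorem mem_range_lastEmb {k : ℕ} (h : k ≤ p) {v : Fin p} :
    v ∈ Set.range (lastEmb h) ↔ k ≤ v.1 :=
  ⟨by rintro ⟨i, rfl⟩; exact Nat.le_add_right _ _,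
    fun hv => ⟨⟨v.1 - k, by omega⟩, Fin.ext (Nat.add_sub_cancel' hv)⟩⟩

theorem isCompl_range_first_last {k : ℕ} (h : k ≤ p) :
    IsCompl (Set.range (Fin.castLEOrderEmb h)) (Set.range (lastEmb h)) := by
  have : Set.range (lastEmb h) = (Set.range (Fin.castLEOrderEmb h))ᶜ := by
    ext v
    rw [mem_range_lastEmb, Set.mem_compl_iff, mem_range_castLEOrderEmb, not_lt]
  rw [this]
  exact isCompl_compl

variable {k l m n : ℕ}

theorem sumEmb_castAdd (R : Fin k ↪o Fin m) (S : Fin l ↪o Fin n) (i : Fin k) :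
    sumEmb R S (Fin.castAdd l i) = Fin.castAdd n (R i) :=
  Fin.append_left (fun i => Fin.castAdd n (R i)) (fun j => Fin.natAdd m (S j)) i

theorem sumEmb_natAdd (R : Fin k ↪o Fin m) (S : Fin l ↪o Fin n) (i : Fin l) :
    sumEmb R S (Fin.natAdd k i) = Fin.natAdd m (S i) :=
  Fin.append_right (fun i => Fin.castAdd n (R i)) (fun j => Fin.natAdd m (S j)) i

theorem castAdd_mem_range_sumEmb {R : Fin k ↪o Fin m} {S : Fin l ↪o Fin n} {v : Fin m} :
    Fin.castAdd n v ∈ Set.range (sumEmb R S) ↔ v ∈ Set.range R := by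
  constructor
  · rintro ⟨i, hi⟩
    induction i using Fin.addCases with
    | left i =>
      rw [sumEmb_castAdd] at hi
      exact ⟨i, Fin.castAdd_injective _ _ hi⟩
    | right i =>
      rw [sumEmb_natAdd, Fin.ext_iff, Fin.val_natAdd, Fin.val_castAdd] at hi
      omega
  · rintro ⟨i, rfl⟩
    exact ⟨_, sumEmb_castAdd R S i⟩

theorem natAdd_mem_range_sumEmb {R : Fin k ↪o Fin m} {S : Fin l ↪o Fin n} {v : Fin n} :
    Fin.natAdd m v ∈ Set.range (sumEmb R S) ↔ v ∈ Set.range S := by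
  constructor
  · rintro ⟨i, hi⟩
    induction i using Fin.addCases with
    | left i =>
      rw [sumEmb_castAdd, Fin.ext_iff, Fin.val_natAdd, Fin.val_castAdd] at hi
      omega
    | right i =>
      rw [sumEmb_natAdd] at hi
      exact ⟨i, Fin.natAdd_injective _ _ hi⟩
  · rintro ⟨i, rfl⟩
    exact ⟨_, sumEmb_natAdd R S i⟩

end Standardization

namespace DecPerm

variable {X : DecorationSet.{u}}

theorem std_std (d : DecPerm X) {q r : ℕ} (R : Fin q ↪o Fin d.1) (S : Fin r ↪o Fin q) :
    DecPerm.std (d.std R) S = d.std (S.trans R) := by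
  simp only [DecPerm.std, stdPos_stdPos, X.select_select, imageEmb_trans]

theorem std_congr (d : DecPerm X) {q r : ℕ} {R : Fin q ↪o Fin d.1} {S : Fin r ↪o Fin d.1}
    (h : Set.range R = Set.range S) : d.std R = d.std S := by
  have hqr : q = r := by
    have h1 := Set.card_range_of_injective R.injective
    have h2 := Set.card_range_of_injective S.injective
    simp only [Fintype.card_fin] at h1 h2
    rw [← h1, ← h2]
    simp only [h]
  subst hqr
  rw [orderEmb_eq_of_range h]

/-- Absorbs the cast in the associativity of concatenation, where the sizes agree only
propositionally. -/
theorem mk_eq_cast {m n : ℕ} (h : m = n) (ρ : Equiv.Perm (Fin m)) (x : X.Deco m) :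
    (⟨m, ρ, x⟩ : DecPerm X) = ⟨n, (finCongr h).permCongr ρ, cast (congrArg X.Deco h) x⟩ := by
  subst h
  rfl

end DecPerm

theorem stdVal_permCongr {m n q : ℕ} (h : m = n) (ρ : Equiv.Perm (Fin m)) (R : Fin q ↪o Fin n) :
    stdVal ((finCongr h).permCongr ρ) R =
      stdVal ρ (R.trans (Fin.castOrderIso h.symm).toOrderEmbedding) := by
  subst h
  rfl

/-! ## The Hopf algebra of decorated permutations -/

section Shuffle

variable {m n p : ℕ} {M : Type*} [AddCommMonoid M]

theorem mem_shiftedShuffle {σ : Equiv.Perm (Fin m)} {τ : Equiv.Perm (Fin n)}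
    {ρ : Equiv.Perm (Fin (m + n))} : ρ ∈ shiftedShuffle σ τ ↔
      stdVal ρ (Fin.castAddOrderEmb n) = σ ∧ stdVal ρ (Fin.natAddOrderEmb m) = τ := by
  simp [shiftedShuffle]

/-- The intermediate shuffle is recovered from `π` as the standardization of its first `m + n`
values, so the double sum has no repetition. -/
theorem sum_shiftedShuffle_left (σ : Equiv.Perm (Fin m)) (τ : Equiv.Perm (Fin n))
    (υ : Equiv.Perm (Fin p)) (f : Equiv.Perm (Fin (m + n + p)) → M) :
    ∑ ρ ∈ shiftedShuffle σ τ, ∑ π ∈ shiftedShuffle ρ υ, f π =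
      ∑ π ∈ Finset.univ.filter (fun π : Equiv.Perm (Fin (m + n + p)) =>
        stdVal π ((Fin.castAddOrderEmb n).trans (Fin.castAddOrderEmb p)) = σ ∧
        stdVal π ((Fin.natAddOrderEmb m).trans (Fin.castAddOrderEmb p)) = τ ∧
        stdVal π (Fin.natAddOrderEmb (m + n)) = υ), f π := by
  rw [Finset.sum_comm' (t' := Finset.univ.filter fun π : Equiv.Perm (Fin (m + n + p)) =>
        stdVal π ((Fin.castAddOrderEmb n).trans (Fin.castAddOrderEmb p)) = σ ∧
        stdVal π ((Fin.natAddOrderEmb m).trans (Fin.castAddOrderEmb p)) = τ ∧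
        stdVal π (Fin.natAddOrderEmb (m + n)) = υ)
      (s' := fun π => {stdVal π (Fin.castAddOrderEmb p)})]
  · simp
  · intro ρ π
    simp only [mem_shiftedShuffle, Finset.mem_singleton, Finset.mem_filter, Finset.mem_univ,
      true_and, ← stdVal_stdVal]
    constructor
    · rintro ⟨⟨h1, h2⟩, rfl, h3⟩
      exact ⟨rfl, h1, h2, h3⟩
    · rintro ⟨rfl, h1, h2, h3⟩
      exact ⟨⟨h1, h2⟩, rfl, h3⟩

theorem sum_shiftedShuffle_right (σ : Equiv.Perm (Fin m)) (τ : Equiv.Perm (Fin n))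
    (υ : Equiv.Perm (Fin p)) (f : Equiv.Perm (Fin (m + (n + p))) → M) :
    ∑ ρ ∈ shiftedShuffle τ υ, ∑ π ∈ shiftedShuffle σ ρ, f π =
      ∑ π ∈ Finset.univ.filter (fun π : Equiv.Perm (Fin (m + (n + p))) =>
        stdVal π (Fin.castAddOrderEmb (n + p)) = σ ∧
        stdVal π ((Fin.castAddOrderEmb p).trans (Fin.natAddOrderEmb m)) = τ ∧
        stdVal π ((Fin.natAddOrderEmb n).trans (Fin.natAddOrderEmb m)) = υ), f π := by
  rw [Finset.sum_comm' (t' := Finset.univ.filter fun π : Equiv.Perm (Fin (m + (n + p))) =>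
        stdVal π (Fin.castAddOrderEmb (n + p)) = σ ∧
        stdVal π ((Fin.castAddOrderEmb p).trans (Fin.natAddOrderEmb m)) = τ ∧
        stdVal π ((Fin.natAddOrderEmb n).trans (Fin.natAddOrderEmb m)) = υ)
      (s' := fun π => {stdVal π (Fin.natAddOrderEmb m)})]
  · simp
  · intro ρ π
    simp only [mem_shiftedShuffle, Finset.mem_singleton, Finset.mem_filter, Finset.mem_univ,
      true_and, ← stdVal_stdVal]
    constructor
    · rintro ⟨⟨h1, h2⟩, h3, rfl⟩
      exact ⟨rfl, h3, h1, h2⟩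
    · rintro ⟨rfl, h1, h2, h3⟩
      exact ⟨⟨h2, h3⟩, h1, rfl⟩

/-- The positions before `a + b` in `ρ` carry the letters at the positions before `a` in `σ` and
the shifted letters at the positions before `b` in `τ`. -/
def IsCut (σ : Equiv.Perm (Fin m)) (τ : Equiv.Perm (Fin n)) (ρ : Equiv.Perm (Fin (m + n)))
    (a b : ℕ) : Prop :=
  (∀ v, (ρ.symm (Fin.castAdd n v)).1 < a + b ↔ (σ.symm v).1 < a) ∧
    ∀ v, (ρ.symm (Fin.natAdd m v)).1 < a + b ↔ (τ.symm v).1 < b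

theorem exists_prefix (σ : Equiv.Perm (Fin m)) (P : Fin m → Prop)
    (hP : ∀ u v, σ.symm u < σ.symm v → P v → P u) :
    ∃ a ≤ m, ∀ v, P v ↔ (σ.symm v).1 < a := by
  classical
  by_cases h : ∀ v, P v
  · exact ⟨m, le_rfl, fun v => ⟨fun _ => (σ.symm v).isLt, fun _ => h v⟩⟩
  · push Not at h
    obtain ⟨v, hv⟩ := h
    obtain ⟨w, hw, hmin⟩ := Finset.exists_min_image (Finset.univ.filter fun v => ¬ P v)
      (fun v => σ.symm v) ⟨v, by simpa using hv⟩
    simp only [Finset.mem_filter, Finset.mem_univ, true_and] at hw hmin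
    refine ⟨σ.symm w, (σ.symm w).isLt.le, fun u => ⟨fun hu => ?_, fun hu => ?_⟩⟩
    · by_contra hc
      have hc' : σ.symm w ≤ σ.symm u := not_lt.1 hc
      rcases hc'.eq_or_lt with h | h
      · exact hw (σ.symm.injective h ▸ hu)
      · exact hw (hP _ _ h hu)
    · by_contra hc
      exact (hmin u hc).not_gt hu

/-- Counting letters recovers `a` from the prefix it cuts. This gives both `a + b = i` and the
uniqueness of cuts. -/
theorem sum_prefix (σ : Equiv.Perm (Fin m)) {a : ℕ} (ha : a ≤ m) :
    ∑ v, (if (σ.symm v).1 < a then 1 else 0) = a := by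
  rw [Equiv.sum_comp σ.symm fun v : Fin m => if v.1 < a then 1 else 0,
    Fin.sum_univ_eq_sum_range (fun v => if v < a then 1 else 0), ← Finset.sum_filter,
    Finset.sum_const, smul_eq_mul, mul_one]
  rw [show (Finset.range m).filter (· < a) = Finset.range a by ext; simp; omega]
  simp

theorem exists_isCut {σ : Equiv.Perm (Fin m)} {τ : Equiv.Perm (Fin n)}
    {ρ : Equiv.Perm (Fin (m + n))} (h : ρ ∈ shiftedShuffle σ τ) {i : ℕ} (hi : i ≤ m + n) :
    ∃ a b, a ≤ m ∧ b ≤ n ∧ a + b = i ∧ IsCut σ τ ρ a b := by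
  obtain ⟨rfl, rfl⟩ := mem_shiftedShuffle.1 h
  obtain ⟨a, ha, ha'⟩ := exists_prefix (stdVal ρ (Fin.castAddOrderEmb n))
    (fun v => (ρ.symm (Fin.castAdd n v)).1 < i)
    (fun u v huv hv => lt_trans ((stdVal_symm_lt _ _).1 huv) hv)
  obtain ⟨b, hb, hb'⟩ := exists_prefix (stdVal ρ (Fin.natAddOrderEmb m))
    (fun v => (ρ.symm (Fin.natAdd m v)).1 < i)
    (fun u v huv hv => lt_trans ((stdVal_symm_lt _ _).1 huv) hv)
  have hab : a + b = i := by
    rw [← sum_prefix ρ hi, Fin.sum_univ_add]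
    simp only [ha', hb']
    rw [sum_prefix _ ha, sum_prefix _ hb]
  subst hab
  exact ⟨a, b, ha, hb, rfl, ha', hb'⟩

theorem IsCut.eq {σ : Equiv.Perm (Fin m)} {τ : Equiv.Perm (Fin n)}
    {ρ : Equiv.Perm (Fin (m + n))} {a b a' b' : ℕ} (h : IsCut σ τ ρ a b) (h' : IsCut σ τ ρ a' b')
    (ha : a ≤ m) (ha' : a' ≤ m) (hab : a + b = a' + b') : a = a' ∧ b = b' := by
  have : a = a' := by
    rw [← sum_prefix σ ha, ← sum_prefix σ ha']
    simp only [← h.1, ← h'.1, hab]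
  exact ⟨this, by omega⟩

/-- The last positions, after a cut. -/
def lastSumEmb {a b : ℕ} (ha : a ≤ m) (hb : b ≤ n) : Fin ((m - a) + (n - b)) ↪o Fin (m + n) :=
  (Fin.castOrderIso (show (m - a) + (n - b) = (m + n) - (a + b) by omega)).toOrderEmbedding.trans
    (lastEmb (Nat.add_le_add ha hb))

theorem range_lastSumEmb {a b : ℕ} (ha : a ≤ m) (hb : b ≤ n) :
    Set.range (lastSumEmb ha hb) = Set.range (lastEmb (Nat.add_le_add ha hb)) :=
  (Fin.castOrderIso (show (m - a) + (n - b) = (m + n) - (a + b) by omega)).surjective.range_comp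
    (lastEmb (Nat.add_le_add ha hb))

theorem isCut_iff {σ : Equiv.Perm (Fin m)} {τ : Equiv.Perm (Fin n)}
    {ρ : Equiv.Perm (Fin (m + n))} {a b : ℕ} (ha : a ≤ m) (hb : b ≤ n) : IsCut σ τ ρ a b ↔
      imageEmb ρ (Fin.castLEOrderEmb (Nat.add_le_add ha hb)) =
        sumEmb (imageEmb σ (Fin.castLEOrderEmb ha)) (imageEmb τ (Fin.castLEOrderEmb hb)) := by
  constructor
  · intro h
    refine orderEmb_eq_of_range (Set.ext fun v => ?_)
    rw [mem_range_imageEmb, mem_range_castLEOrderEmb]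
    induction v using Fin.addCases with
    | left v =>
      rw [castAdd_mem_range_sumEmb, mem_range_imageEmb, mem_range_castLEOrderEmb, h.1]
    | right v =>
      rw [natAdd_mem_range_sumEmb, mem_range_imageEmb, mem_range_castLEOrderEmb, h.2]
  · intro h
    constructor <;> intro v
    · rw [← mem_range_castLEOrderEmb (Nat.add_le_add ha hb), ← mem_range_imageEmb, h,
        castAdd_mem_range_sumEmb, mem_range_imageEmb, mem_range_castLEOrderEmb]
    · rw [← mem_range_castLEOrderEmb (Nat.add_le_add ha hb), ← mem_range_imageEmb, h,
        natAdd_mem_range_sumEmb, mem_range_imageEmb, mem_range_castLEOrderEmb]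

theorem IsCut.imageEmb_last {σ : Equiv.Perm (Fin m)} {τ : Equiv.Perm (Fin n)}
    {ρ : Equiv.Perm (Fin (m + n))} {a b : ℕ} (h : IsCut σ τ ρ a b) (ha : a ≤ m) (hb : b ≤ n) :
    imageEmb ρ (lastSumEmb ha hb) =
      sumEmb (imageEmb σ (lastEmb ha)) (imageEmb τ (lastEmb hb)) := by
  refine orderEmb_eq_of_range (Set.ext fun v => ?_)
  rw [mem_range_imageEmb, range_lastSumEmb, mem_range_lastEmb]
  induction v using Fin.addCases with
  | left v =>
    rw [castAdd_mem_range_sumEmb, mem_range_imageEmb, mem_range_lastEmb, ← not_lt, h.1, not_lt]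
  | right v =>
    rw [natAdd_mem_range_sumEmb, mem_range_imageEmb, mem_range_lastEmb, ← not_lt, h.2, not_lt]

theorem isCompl_range_castLE_lastSumEmb {a b : ℕ} (ha : a ≤ m) (hb : b ≤ n) :
    IsCompl (Set.range (Fin.castLEOrderEmb (Nat.add_le_add ha hb)))
      (Set.range (lastSumEmb ha hb)) := by
  rw [range_lastSumEmb]
  exact isCompl_range_first_last _

theorem stdPos_mem_shiftedShuffle {σ : Equiv.Perm (Fin m)} {τ : Equiv.Perm (Fin n)}
    {ρ : Equiv.Perm (Fin (m + n))} {q₁ q₂ : ℕ} {Q : Fin (q₁ + q₂) ↪o Fin (m + n)}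
    {Q₁ : Fin q₁ ↪o Fin m} {Q₂ : Fin q₂ ↪o Fin n} (hρ : ρ ∈ shiftedShuffle σ τ)
    (h : imageEmb ρ Q = sumEmb (imageEmb σ Q₁) (imageEmb τ Q₂)) :
    stdPos ρ Q ∈ shiftedShuffle (stdPos σ Q₁) (stdPos τ Q₂) := by
  obtain ⟨rfl, rfl⟩ := mem_shiftedShuffle.1 hρ
  refine mem_shiftedShuffle.2 ⟨stdVal_stdPos fun c => ?_, stdVal_stdPos fun c => ?_⟩
  · rw [h]
    exact sumEmb_castAdd _ _ _
  · rw [h]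
    exact sumEmb_natAdd _ _ _

/-- Cutting a shuffle of two permutations gives two shuffles. -/
theorem sum_isCut (σ : Equiv.Perm (Fin m)) (τ : Equiv.Perm (Fin n)) {a b : ℕ} (ha : a ≤ m)
    (hb : b ≤ n) [DecidablePred fun ρ => IsCut σ τ ρ a b]
    (f : Equiv.Perm (Fin (a + b)) → Equiv.Perm (Fin ((m - a) + (n - b))) → M) :
    ∑ ρ ∈ (shiftedShuffle σ τ).filter (fun ρ => IsCut σ τ ρ a b),
        f (stdPos ρ (Fin.castLEOrderEmb (Nat.add_le_add ha hb))) (stdPos ρ (lastSumEmb ha hb)) =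
      ∑ α ∈ shiftedShuffle (stdPos σ (Fin.castLEOrderEmb ha)) (stdPos τ (Fin.castLEOrderEmb hb)),
        ∑ β ∈ shiftedShuffle (stdPos σ (lastEmb ha)) (stdPos τ (lastEmb hb)), f α β := by
  have hcompl := isCompl_range_castLE_lastSumEmb ha hb
  have hcov : ∀ i, i ∈ Set.range (Fin.castLEOrderEmb (Nat.add_le_add ha hb)) ∨
      i ∈ Set.range (lastSumEmb ha hb) := fun i => hcompl.sup_eq_top.ge (Set.mem_univ i)
  -- The cut fixes the set of values on each side, so a shuffle is determined by its two
  -- standardized halves.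
  rw [← Finset.sum_product']
  refine Finset.sum_bij
    (fun ρ _ => (stdPos ρ (Fin.castLEOrderEmb (Nat.add_le_add ha hb)),
      stdPos ρ (lastSumEmb ha hb))) ?_ ?_ ?_ ?_
  · intro ρ hρ
    obtain ⟨h1, h2⟩ := Finset.mem_filter.1 hρ
    exact Finset.mem_product.2 ⟨stdPos_mem_shiftedShuffle h1 ((isCut_iff ha hb).1 h2),
      stdPos_mem_shiftedShuffle h1 (h2.imageEmb_last ha hb)⟩
  · intro ρ hρ π hπ h
    obtain ⟨-, h2⟩ := Finset.mem_filter.1 hρ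
    obtain ⟨-, h4⟩ := Finset.mem_filter.1 hπ
    rw [Prod.mk.injEq] at h
    exact perm_eq_of_stdPos hcov
      (((isCut_iff ha hb).1 h2).trans ((isCut_iff ha hb).1 h4).symm)
      ((h2.imageEmb_last ha hb).trans (h4.imageEmb_last ha hb).symm) h.1 h.2
  · rintro ⟨α, β⟩ hαβ
    obtain ⟨hα, hβ⟩ := Finset.mem_product.1 hαβ
    obtain ⟨hα₁, hα₂⟩ := mem_shiftedShuffle.1 hα
    obtain ⟨hβ₁, hβ₂⟩ := mem_shiftedShuffle.1 hβ
    have hA : IsCompl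
        (Set.range (sumEmb (imageEmb σ (Fin.castLEOrderEmb ha))
          (imageEmb τ (Fin.castLEOrderEmb hb))))
        (Set.range (sumEmb (imageEmb σ (lastEmb ha)) (imageEmb τ (lastEmb hb)))) := by
      rw [← compl_eq_iff_isCompl]
      ext v
      rw [Set.mem_compl_iff]
      induction v using Fin.addCases with
      | left v =>
        rw [castAdd_mem_range_sumEmb, castAdd_mem_range_sumEmb, mem_range_imageEmb,
          mem_range_imageEmb, mem_range_castLEOrderEmb, mem_range_lastEmb, not_lt]
      | right v =>
        rw [natAdd_mem_range_sumEmb, natAdd_mem_range_sumEmb, mem_range_imageEmb,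
          mem_range_imageEmb, mem_range_castLEOrderEmb, mem_range_lastEmb, not_lt]
    -- Surjectivity: glue the two halves along the value sets prescribed by the cut, then recognize
    -- `σ` and `τ` half by half.
    obtain ⟨ρ, h1, h2, rfl, rfl⟩ := exists_perm_glue hcompl hA α β
    have hQ : ∀ i j, Fin.castLEOrderEmb (Nat.add_le_add ha hb) i < lastSumEmb ha hb j :=
      fun i j => by
        have h := range_lastSumEmb ha hb ▸ Set.mem_range_self j
        exact Fin.lt_def.2 (i.isLt.trans_le ((mem_range_lastEmb (Nat.add_le_add ha hb)).1 h))
    refine ⟨ρ, Finset.mem_filter.2 ⟨mem_shiftedShuffle.2 ⟨?_, ?_⟩, (isCut_iff ha hb).2 h1⟩, rfl⟩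
    · refine stdVal_eq_of_split hQ
        (fun i j => Fin.lt_def.2 (i.isLt.trans_le ((mem_range_lastEmb ha).1 ⟨j, rfl⟩)))
        (fun i => (isCompl_range_first_last ha).sup_eq_top.ge (Set.mem_univ i))
        (fun c => ?_) (fun c => ?_) hα₁ hβ₁
      · rw [h1]
        exact sumEmb_castAdd _ _ _
      · rw [h2]
        exact sumEmb_castAdd _ _ _
    · refine stdVal_eq_of_split hQ
        (fun i j => Fin.lt_def.2 (i.isLt.trans_le ((mem_range_lastEmb hb).1 ⟨j, rfl⟩)))
        (fun i => (isCompl_range_first_last hb).sup_eq_top.ge (Set.mem_univ i))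
        (fun c => ?_) (fun c => ?_) hα₂ hβ₂
      · rw [h1]
        exact sumEmb_natAdd _ _ _
      · rw [h2]
        exact sumEmb_natAdd _ _ _
  · intro ρ _
    rfl

end Shuffle

/-! ### Hopf axioms on the basis of decorated permutations -/

section PermHopf

variable {k : Type v} [Field k] {X : DecorationSet.{u}}

theorem permSpace_induction {P : PermSpace k X → Prop} (h0 : P 0)
    (hadd : ∀ a b, P a → P b → P (a + b)) (hsmul : ∀ (c : k) (a), P a → P (c • a))
    (hF : ∀ d, P (basisF k d)) (a : PermSpace k X) : P a :=
  Finsupp.induction_linear a h0 hadd fun d c => by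
    have := hsmul c _ (hF d)
    rwa [basisF, Finsupp.smul_single, smul_eq_mul, mul_one] at this

theorem permOps_mul_basisF (d e : DecPerm X) : (permOps k X).mul (basisF k d) (basisF k e) =
    ∑ ρ ∈ shiftedShuffle d.2.1 e.2.1,
      basisF k (⟨d.1 + e.1, ρ, X.concat d.2.2 e.2.2⟩ : DecPerm X) := by
  simp only [permOps, basisF, Finsupp.linearCombination_single, one_smul]

theorem permOps_comul_basisF (d : DecPerm X) : (permOps k X).comul (basisF k d) =
    ∑ i : Fin (d.1 + 1),
      basisF k (d.std (Fin.castLEOrderEmb (Nat.le_of_lt_succ i.isLt))) ⊗ₜ[k]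
        basisF k (d.std (lastEmb (Nat.le_of_lt_succ i.isLt))) := by
  simp only [permOps, basisF, Finsupp.linearCombination_single, one_smul]

theorem permOps_assoc (a b c : PermSpace k X) : (permOps k X).mul ((permOps k X).mul a b) c =
    (permOps k X).mul a ((permOps k X).mul b c) := by
  induction a using permSpace_induction with
  | h0 => simp
  | hadd _ _ h₁ h₂ => simp only [map_add, LinearMap.add_apply, h₁, h₂]
  | hsmul _ _ h => simp only [map_smul, LinearMap.smul_apply, h]
  | hF d =>
  induction b using permSpace_induction with
  | h0 => simp
  | hadd _ _ h₁ h₂ => simp only [map_add, LinearMap.add_apply, h₁, h₂]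
  | hsmul _ _ h => simp only [map_smul, LinearMap.smul_apply, h]
  | hF e =>
  induction c using permSpace_induction with
  | h0 => simp
  | hadd _ _ h₁ h₂ => simp only [map_add, h₁, h₂]
  | hsmul _ _ h => simp only [map_smul, h]
  | hF f =>
  obtain ⟨m, σ, x⟩ := d
  obtain ⟨n, τ, y⟩ := e
  obtain ⟨p, υ, z⟩ := f
  simp only [permOps_mul_basisF, map_sum, LinearMap.sum_apply]
  rw [sum_shiftedShuffle_left σ τ υ fun π =>
      basisF k (⟨m + n + p, π, X.concat (X.concat x y) z⟩ : DecPerm X),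
    sum_shiftedShuffle_right σ τ υ fun π =>
      basisF k (⟨m + (n + p), π, X.concat x (X.concat y z)⟩ : DecPerm X)]
  refine Finset.sum_equiv (finCongr (Nat.add_assoc m n p)).permCongr (fun π => ?_) fun π _ => ?_
  · simp only [Finset.mem_filter, Finset.mem_univ, true_and, stdVal_permCongr]
    refine and_congr (Eq.congr_left (congrArg _ ?_)) (and_congr (Eq.congr_left (congrArg _ ?_))
      (Eq.congr_left (congrArg _ ?_))) <;> ext i <;> simp [Nat.add_assoc]
  · rw [DecPerm.mk_eq_cast (Nat.add_assoc m n p), X.concat_assoc]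

theorem permOps_comul_std (d : DecPerm X) {q : ℕ} (R : Fin q ↪o Fin d.1) :
    (permOps k X).comul (basisF k (d.std R)) =
      ∑ i : Fin (q + 1),
        basisF k (d.std ((Fin.castLEOrderEmb (Nat.le_of_lt_succ i.isLt)).trans R)) ⊗ₜ[k]
          basisF k (d.std ((lastEmb (Nat.le_of_lt_succ i.isLt)).trans R)) := by
  rw [permOps_comul_basisF]
  exact Finset.sum_congr rfl fun i _ => congrArg₂ _
    (congrArg _ (d.std_std R (Fin.castLEOrderEmb (Nat.le_of_lt_succ i.isLt))))
    (congrArg _ (d.std_std R (lastEmb (Nat.le_of_lt_succ i.isLt))))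

theorem permOps_coassoc (a : PermSpace k X) : TensorProduct.assoc k _ _ _
    ((permOps k X).comul.rTensor _ ((permOps k X).comul a)) =
      (permOps k X).comul.lTensor _ ((permOps k X).comul a) := by
  induction a using permSpace_induction with
  | h0 => simp
  | hadd _ _ h₁ h₂ => simp only [map_add, h₁, h₂]
  | hsmul _ _ h => simp only [map_smul, h]
  | hF d =>
  rw [permOps_comul_basisF]
  simp only [map_sum, LinearMap.rTensor_tmul, LinearMap.lTensor_tmul, permOps_comul_std,
    TensorProduct.sum_tmul, TensorProduct.tmul_sum, TensorProduct.assoc_tmul]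
  rw [Finset.sum_sigma', Finset.sum_sigma']
  -- Both sides sum over two cuts `j ≤ i`: one cuts at `i` and then the prefix at `j`, the other
  -- cuts at `j` and then the suffix at `i - j`.
  refine Finset.sum_bij'
    (fun x _ => ⟨⟨x.2.1, by omega⟩, ⟨x.1.1 - x.2.1, by simp only; omega⟩⟩)
    (fun x _ => ⟨⟨x.1.1 + x.2.1, by omega⟩, ⟨x.1.1, Nat.lt_succ_of_le (Nat.le_add_right _ _)⟩⟩)
    ?_ ?_ ?_ ?_ ?_
  · simp
  · simp
  · rintro ⟨⟨i, hi⟩, ⟨j, hj⟩⟩ -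
    simp only at hj
    refine Sigma.ext (Fin.ext ?_) ((Fin.heq_ext_iff ?_).2 rfl) <;> simp only <;> omega
  · rintro ⟨⟨i, hi⟩, ⟨j, hj⟩⟩ -
    simp only at hj
    refine Sigma.ext (Fin.ext rfl) ((Fin.heq_ext_iff rfl).2 ?_)
    simp only
    omega
  · rintro ⟨⟨i, hi⟩, ⟨j, hj⟩⟩ -
    simp only at hj
    refine congrArg₂ _ (congrArg _ (DecPerm.std_congr d (Set.ext fun v => ?_)))
      (congrArg₂ _ (congrArg _ (DecPerm.std_congr d (Set.ext fun v => ?_)))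
        (congrArg _ (DecPerm.std_congr d (Set.ext fun v => ?_))))
    · rw [mem_range_castLEOrderEmb]
      constructor
      · rintro ⟨w, rfl⟩
        exact w.isLt
      · exact fun hv => ⟨⟨v.1, hv⟩, rfl⟩
    · constructor
      · rintro ⟨w, rfl⟩
        exact ⟨⟨w.1, by have := w.isLt; omega⟩, rfl⟩
      · rintro ⟨w, rfl⟩
        exact ⟨⟨w.1, by have := w.isLt; simp only at this; omega⟩, rfl⟩
    · rw [mem_range_lastEmb]
      constructor
      · intro hv
        simp only at hv
        exact ⟨⟨v.1 - i, by simp only; omega⟩,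
          Fin.ext (show j + (i - j + (v.1 - i)) = v.1 by omega)⟩
      · rintro ⟨w, rfl⟩
        change i ≤ j + (i - j + w.1)
        omega

-- Each cut of a shuffle at position `i` comes from exactly one pair of cuts of the factors, with `a
-- + b = i`.
open Classical in
theorem sum_comul_shuffle {m n : ℕ} {M : Type*} [AddCommMonoid M] (σ : Equiv.Perm (Fin m))
    (τ : Equiv.Perm (Fin n)) (f : Equiv.Perm (Fin (m + n)) → ℕ → M) :
    ∑ ρ ∈ shiftedShuffle σ τ, ∑ i : Fin (m + n + 1), f ρ i =
      ∑ a : Fin (m + 1), ∑ b : Fin (n + 1),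
        ∑ ρ ∈ (shiftedShuffle σ τ).filter (fun ρ => IsCut σ τ ρ a b), f ρ (a + b) := by
  simp only [Finset.sum_filter]
  rw [← Fintype.sum_prod_type' (f := fun (a : Fin (m + 1)) (b : Fin (n + 1)) =>
    ∑ ρ ∈ shiftedShuffle σ τ, if IsCut σ τ ρ a b then f ρ (a + b) else 0)]
  refine Eq.trans ?_ Finset.sum_comm
  refine Finset.sum_congr rfl fun ρ hρ => ?_
  rw [← Finset.sum_filter]
  symm
  refine Finset.sum_bij (fun x _ => ⟨x.1.1 + x.2.1, by omega⟩) (fun _ _ => Finset.mem_univ _)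
    ?_ ?_ (fun _ _ => rfl)
  · rintro ⟨a, b⟩ h ⟨a', b'⟩ h' he
    have := (Finset.mem_filter.1 h).2.eq (Finset.mem_filter.1 h').2 (by omega) (by omega)
      (Fin.ext_iff.1 he)
    exact Prod.ext (Fin.ext this.1) (Fin.ext this.2)
  · rintro i -
    obtain ⟨a, b, ha, hb, hab, h⟩ := exists_isCut hρ (Nat.le_of_lt_succ i.isLt)
    exact ⟨(⟨a, by omega⟩, ⟨b, by omega⟩), Finset.mem_filter.2 ⟨Finset.mem_univ _, h⟩,
      Fin.ext hab⟩

theorem permOps_compat (a b : PermSpace k X) :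
    (permOps k X).comul ((permOps k X).mul a b) =
      TensorProduct.map (TensorProduct.lift (permOps k X).mul)
        (TensorProduct.lift (permOps k X).mul)
        (TensorProduct.tensorTensorTensorComm k _ _ _ _
          ((permOps k X).comul a ⊗ₜ[k] (permOps k X).comul b)) := by
  induction a using permSpace_induction with
  | h0 => simp
  | hadd _ _ h₁ h₂ =>
    simp only [map_add, LinearMap.add_apply, TensorProduct.add_tmul, h₁, h₂]
  | hsmul _ _ h =>
    simp only [map_smul, LinearMap.smul_apply, ← TensorProduct.smul_tmul', h]
  | hF d =>
  induction b using permSpace_induction with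
  | h0 => simp
  | hadd _ _ h₁ h₂ => simp only [map_add, TensorProduct.tmul_add, h₁, h₂]
  | hsmul _ _ h => simp only [map_smul, TensorProduct.tmul_smul, h]
  | hF e =>
  classical
  obtain ⟨m, σ, x⟩ := d
  obtain ⟨n, τ, y⟩ := e
  -- A natural number as index lets `a + b` be substituted without carrying bounds; the value `0`
  -- for `i > m + n` is never reached.
  let g : Equiv.Perm (Fin (m + n)) → ℕ → PermSpace k X ⊗[k] PermSpace k X := fun ρ i =>
    if hi : i ≤ m + n then
      basisF k (DecPerm.std (⟨m + n, ρ, X.concat x y⟩ : DecPerm X) (Fin.castLEOrderEmb hi)) ⊗ₜ[k]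
        basisF k (DecPerm.std (⟨m + n, ρ, X.concat x y⟩ : DecPerm X) (lastEmb hi))
    else 0
  have hg : ∀ ρ i (hi : i ≤ m + n), g ρ i =
      basisF k (DecPerm.std (⟨m + n, ρ, X.concat x y⟩ : DecPerm X) (Fin.castLEOrderEmb hi)) ⊗ₜ[k]
        basisF k (DecPerm.std (⟨m + n, ρ, X.concat x y⟩ : DecPerm X) (lastEmb hi)) :=
    fun ρ i hi => dif_pos hi
  have hL : (permOps k X).comul ((permOps k X).mul (basisF k ⟨m, σ, x⟩) (basisF k ⟨n, τ, y⟩)) =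
      ∑ ρ ∈ shiftedShuffle σ τ, ∑ i : Fin (m + n + 1), g ρ i := by
    rw [permOps_mul_basisF, map_sum]
    refine Finset.sum_congr rfl fun ρ _ => ?_
    rw [permOps_comul_basisF]
    exact Finset.sum_congr rfl fun i _ => (hg ρ i _).symm
  rw [hL, sum_comul_shuffle, permOps_comul_basisF, permOps_comul_basisF]
  simp only [TensorProduct.sum_tmul, TensorProduct.tmul_sum, map_sum,
    TensorProduct.tensorTensorTensorComm_tmul, TensorProduct.map_tmul, TensorProduct.lift.tmul]
  refine Eq.trans ?_ Finset.sum_comm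
  refine Finset.sum_congr rfl fun a _ => ?_
  refine Finset.sum_congr rfl fun b _ => ?_
  have ha := Nat.le_of_lt_succ a.isLt
  have hb := Nat.le_of_lt_succ b.isLt
  rw [permOps_mul_basisF, permOps_mul_basisF]
  simp only [TensorProduct.sum_tmul, TensorProduct.tmul_sum]
  refine Eq.trans ?_ Finset.sum_comm
  refine Eq.trans ?_ (sum_isCut (M := PermSpace k X ⊗[k] PermSpace k X) σ τ ha hb fun α β =>
    basisF k (⟨_, α, X.concat (X.select x (imageEmb σ (Fin.castLEOrderEmb ha)))
      (X.select y (imageEmb τ (Fin.castLEOrderEmb hb)))⟩ : DecPerm X) ⊗ₜ[k]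
    basisF k (⟨_, β, X.concat (X.select x (imageEmb σ (lastEmb ha)))
      (X.select y (imageEmb τ (lastEmb hb)))⟩ : DecPerm X))
  refine Finset.sum_congr rfl fun ρ hρ => ?_
  have hcut := (Finset.mem_filter.1 hρ).2
  -- The compatibility of selection with concatenation identifies the decorations on both sides.
  rw [hg ρ _ (Nat.add_le_add ha hb), X.concat_select, X.concat_select,
    ← (isCut_iff ha hb).1 hcut, ← hcut.imageEmb_last ha hb,
    ← DecPerm.std_congr (⟨m + n, ρ, X.concat x y⟩ : DecPerm X) (range_lastSumEmb ha hb)]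
  rfl

end PermHopf

/-! ## Standardization and flips -/

section Flip

variable {p q r : ℕ}

/-- Lets the results on exchanges, proved for subwords chosen by values, serve for subwords chosen
by positions. -/
theorem stdPos_eq_stdVal (ρ : Equiv.Perm (Fin p)) (Q : Fin q ↪o Fin p) :
    stdPos ρ Q = stdVal ρ (imageEmb ρ Q) :=
  eq_stdVal fun _ _ h => (stdPos_symm_lt ρ Q).1 h

namespace Arc

/-- Adjacency as the absence of a letter in between, a form inherited by subwords. -/
theorem adjacent_iff (α : Arc p) (ρ : Equiv.Perm (Fin p)) :
    ((ρ.symm α.left).1 + 1 = ρ.symm α.right ∨ (ρ.symm α.right).1 + 1 = ρ.symm α.left) ↔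
      ∀ w, ¬ (ρ.symm α.left < ρ.symm w ∧ ρ.symm w < ρ.symm α.right) ∧
        ¬ (ρ.symm α.right < ρ.symm w ∧ ρ.symm w < ρ.symm α.left) := by
  simp only [Fin.lt_def]
  constructor
  · intro h w
    omega
  · intro h
    have hne : (ρ.symm α.left).1 ≠ ρ.symm α.right := by simpa [Fin.val_inj] using α.lt.ne
    by_contra hc
    rcases lt_or_gt_of_ne hne with hlt | hlt
    · have := (h (ρ ⟨(ρ.symm α.left).1 + 1, by omega⟩)).1
      simp only [Equiv.symm_apply_apply] at this
      omega
    · have := (h (ρ ⟨(ρ.symm α.right).1 + 1, by omega⟩)).2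
      simp only [Equiv.symm_apply_apply] at this
      omega

theorem flip_symm_lt_iff {α : Arc p} {ρ : Equiv.Perm (Fin p)} (h : α.At ρ) {v w : Fin p}
    (h₁ : ¬ (v = α.left ∧ w = α.right)) (h₂ : ¬ (v = α.right ∧ w = α.left)) :
    (α.flip ρ).symm v < (α.flip ρ).symm w ↔ ρ.symm v < ρ.symm w := by
  obtain ⟨h, -⟩ := h
  have hlt := α.lt
  have e : ∀ u v, u ≠ v → (ρ.symm u).1 ≠ ρ.symm v := fun u v h => by simpa [Fin.val_inj] using h
  have e1 := e v α.left
  have e2 := e v α.right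
  have e3 := e w α.left
  have e4 := e w α.right
  rw [flip_symm, flip_symm]
  simp only [Fin.lt_def] at *
  by_cases a1 : v = α.left <;> by_cases a2 : v = α.right <;> by_cases a3 : w = α.left <;>
    by_cases a4 : w = α.right <;> grind

theorem stdVal_flip_of_notMem {α : Arc p} {ρ : Equiv.Perm (Fin p)} (h : α.At ρ)
    {R : Fin q ↪o Fin p} (hR : ¬ (α.left ∈ Set.range R ∧ α.right ∈ Set.range R)) :
    stdVal (α.flip ρ) R = stdVal ρ R :=
  eq_stdVal fun u v huv => by
    rw [stdVal_symm_lt] at huv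
    refine (flip_symm_lt_iff h ?_ ?_).1 huv
    · rintro ⟨h1, h2⟩
      exact hR ⟨⟨u, h1⟩, ⟨v, h2⟩⟩
    · rintro ⟨h1, h2⟩
      exact hR ⟨⟨v, h2⟩, ⟨u, h1⟩⟩

theorem stdVal_flip {α : Arc p} {β : Arc q} {ρ : Equiv.Perm (Fin p)} (h : α.At ρ)
    {R : Fin q ↪o Fin p} (hβ : β.At (stdVal ρ R)) (hl : R β.left = α.left)
    (hr : R β.right = α.right) : stdVal (α.flip ρ) R = β.flip (stdVal ρ R) := by
  symm
  refine eq_stdVal fun u v huv => ?_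
  by_cases h1 : u = β.left ∧ v = β.right
  · obtain ⟨rfl, rfl⟩ := h1
    rw [flip_symm_left, flip_symm_right, stdVal_symm_lt] at huv
    rw [hl, hr, flip_symm_left, flip_symm_right]
    rwa [hl, hr] at huv
  by_cases h2 : u = β.right ∧ v = β.left
  · obtain ⟨rfl, rfl⟩ := h2
    rw [flip_symm_left, flip_symm_right, stdVal_symm_lt] at huv
    rw [hl, hr, flip_symm_left, flip_symm_right]
    rwa [hl, hr] at huv
  rw [flip_symm_lt_iff hβ h1 h2, stdVal_symm_lt] at huv
  refine (flip_symm_lt_iff h ?_ ?_).2 huv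
  · rwa [← hl, ← hr, R.eq_iff_eq, R.eq_iff_eq]
  · rwa [← hl, ← hr, R.eq_iff_eq, R.eq_iff_eq]

theorem At.stdVal {α : Arc p} {β : Arc q} {ρ : Equiv.Perm (Fin p)} (h : α.At ρ)
    {R : Fin q ↪o Fin p} (hl : R β.left = α.left) (hr : R β.right = α.right)
    (hp : ∀ v, v ∈ β.pts ↔ R v ∈ α.pts) : β.At (stdVal ρ R) := by
  refine ⟨(adjacent_iff β _).2 fun w => ?_, fun v h1 h2 => ?_⟩
  · simp only [stdVal_symm_lt, hl, hr]
    exact (adjacent_iff α ρ).1 h.1 (R w)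
  · rw [hp, stdVal_symm_lt, hl]
    exact h.2 _ (hl ▸ R.lt_iff_lt.2 h1) (hr ▸ R.lt_iff_lt.2 h2)

theorem imageEmb_flip {α : Arc p} {ρ : Equiv.Perm (Fin p)} {Q : Fin q ↪o Fin p}
    (h : ρ.symm α.left ∈ Set.range Q ↔ ρ.symm α.right ∈ Set.range Q) :
    imageEmb (α.flip ρ) Q = imageEmb ρ Q := by
  refine orderEmb_eq_of_range (Set.ext fun v => ?_)
  rw [mem_range_imageEmb, mem_range_imageEmb, flip_symm]
  split_ifs with h1 h2
  · rw [h1, h]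
  · rw [h2, h]
  · rfl

/-- The arc of `ρ` corresponding to an arc `β` of the standardization of a subword. -/
def lift (ρ : Equiv.Perm (Fin p)) (Q : Fin q ↪o Fin p) (β : Arc q) : Arc p where
  left := imageEmb ρ Q β.left
  right := imageEmb ρ Q β.right
  lt := (imageEmb ρ Q).lt_iff_lt.2 β.lt
  pts := (Finset.Ioo (imageEmb ρ Q β.left) (imageEmb ρ Q β.right)).filter fun v =>
    ρ.symm v < ρ.symm (imageEmb ρ Q β.left)
  sub := Finset.filter_subset _ _

/-- `hQ` says that consecutive indices give consecutive positions, so adjacent letters of the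
subword are adjacent in `ρ`. -/
theorem At.lift {ρ : Equiv.Perm (Fin p)} {Q : Fin q ↪o Fin p} {β : Arc q}
    (h : β.At (stdPos ρ Q)) (hQ : ∀ i j : Fin q, i.1 + 1 = j → (Q i).1 + 1 = Q j) :
    (lift ρ Q β).At ρ := by
  refine ⟨?_, fun v h1 h2 => ?_⟩
  · change (ρ.symm (imageEmb ρ Q β.left)).1 + 1 = ρ.symm (imageEmb ρ Q β.right) ∨
      (ρ.symm (imageEmb ρ Q β.right)).1 + 1 = ρ.symm (imageEmb ρ Q β.left)
    rw [symm_imageEmb, symm_imageEmb]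
    exact h.1.imp (hQ _ _) (hQ _ _)
  · exact Finset.mem_filter.trans (and_iff_right (Finset.mem_Ioo.2 ⟨h1, h2⟩))

/-- Puts `β` in the form of the selection condition of conservativity, as the arc selected from its
lift. -/
theorem select_lift {ρ : Equiv.Perm (Fin p)} {Q : Fin q ↪o Fin p} {β : Arc q}
    (h : β.At (stdPos ρ Q)) : Arc.select (imageEmb ρ Q) β.left β.right β.lt (lift ρ Q β).pts
      (lift ρ Q β).sub = β := by
  refine Arc.ext rfl rfl (Finset.ext fun c => ?_)
  change c ∈ Finset.univ.filter (fun c => imageEmb ρ Q c ∈ (Finset.Ioo _ _).filter _) ↔ _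
  rw [Finset.mem_filter, Finset.mem_filter, Finset.mem_Ioo, (imageEmb ρ Q).lt_iff_lt,
    (imageEmb ρ Q).lt_iff_lt, ← stdPos_symm_lt]
  simp only [Finset.mem_univ, true_and]
  constructor
  · rintro ⟨⟨h1, h2⟩, h3⟩
    exact (h.2 c h1 h2).2 h3
  · intro hc
    have hc' := Finset.mem_Ioo.1 (β.sub hc)
    exact ⟨hc', (h.2 c hc'.1 hc'.2).1 hc⟩

theorem imageEmb_flip_lift (ρ : Equiv.Perm (Fin p)) (Q : Fin q ↪o Fin p) (β : Arc q) :
    imageEmb ((lift ρ Q β).flip ρ) Q = imageEmb ρ Q :=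
  imageEmb_flip ⟨fun _ => mem_range_imageEmb.1 ⟨_, rfl⟩, fun _ => mem_range_imageEmb.1 ⟨_, rfl⟩⟩

theorem stdPos_flip_lift {ρ : Equiv.Perm (Fin p)} {Q : Fin q ↪o Fin p} {β : Arc q}
    (h : β.At (stdPos ρ Q)) (hQ : ∀ i j : Fin q, i.1 + 1 = j → (Q i).1 + 1 = Q j) :
    stdPos ((lift ρ Q β).flip ρ) Q = β.flip (stdPos ρ Q) := by
  rw [stdPos_eq_stdVal, imageEmb_flip_lift, stdPos_eq_stdVal ρ]
  exact stdVal_flip (h.lift hQ) (stdPos_eq_stdVal ρ Q ▸ h) rfl rfl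

theorem notMem_range_of_lift {ρ : Equiv.Perm (Fin p)} {Q : Fin q ↪o Fin p} (β : Arc q)
    {Q' : Fin r ↪o Fin p} (hd : Disjoint (Set.range Q) (Set.range Q')) :
    ρ.symm (lift ρ Q β).left ∉ Set.range Q' ∧ ρ.symm (lift ρ Q β).right ∉ Set.range Q' :=
  ⟨Set.disjoint_left.1 hd (mem_range_imageEmb.1 ⟨_, rfl⟩),
    Set.disjoint_left.1 hd (mem_range_imageEmb.1 ⟨_, rfl⟩)⟩

theorem imageEmb_flip_lift_of_disjoint {ρ : Equiv.Perm (Fin p)} {Q : Fin q ↪o Fin p} (β : Arc q)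
    {Q' : Fin r ↪o Fin p} (hd : Disjoint (Set.range Q) (Set.range Q')) :
    imageEmb ((lift ρ Q β).flip ρ) Q' = imageEmb ρ Q' :=
  have h := notMem_range_of_lift (ρ := ρ) β hd
  imageEmb_flip ⟨fun h' => absurd h' h.1, fun h' => absurd h' h.2⟩

theorem stdPos_flip_lift_of_disjoint {ρ : Equiv.Perm (Fin p)} {Q : Fin q ↪o Fin p} {β : Arc q}
    (h : β.At (stdPos ρ Q)) (hQ : ∀ i j : Fin q, i.1 + 1 = j → (Q i).1 + 1 = Q j)
    {Q' : Fin r ↪o Fin p} (hd : Disjoint (Set.range Q) (Set.range Q')) :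
    stdPos ((lift ρ Q β).flip ρ) Q' = stdPos ρ Q' := by
  rw [stdPos_eq_stdVal, imageEmb_flip_lift_of_disjoint β hd, stdPos_eq_stdVal ρ]
  refine stdVal_flip_of_notMem (h.lift hQ) fun h' => ?_
  exact (notMem_range_of_lift β hd).1 (mem_range_imageEmb.1 h'.1)

end Arc

end Flip

/-! ## The space of decorated noncrossing arc diagrams -/

section DiagramSpace

variable {k : Type v} [Field k] {X : DecorationSet.{u}} {Ψ : ArcMap X}

theorem diagramSum_eta_mem {n : ℕ} (x : X.Deco n) (σ : Equiv.Perm (Fin n)) :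
    diagramSum k Ψ (eta (Ψ n x) σ) x ∈ diagramSpaceDeg k Ψ n :=
  Submodule.subset_span ⟨x, _, ArcIdeal.isNoncrossing_eta _ σ, ArcIdeal.eta_subset _ σ, rfl⟩

/-- Stability makes `T` a union of fibers of `eta`; group the sum accordingly. -/
theorem sum_basisF_mem {n : ℕ} {x : X.Deco n} {T : Finset (Equiv.Perm (Fin n))}
    (hT : (Ψ n x).Stable (· ∈ T)) :
    ∑ σ ∈ T, basisF k (⟨n, σ, x⟩ : DecPerm X) ∈ diagramSpaceDeg k Ψ n := by
  classical
  rw [← Finset.sum_fiberwise_of_maps_to (t := T.image (eta (Ψ n x))) (g := eta (Ψ n x))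
    fun σ hσ => Finset.mem_image_of_mem _ hσ]
  refine Submodule.sum_mem _ fun D hD => ?_
  obtain ⟨σ, hσ, rfl⟩ := Finset.mem_image.1 hD
  convert diagramSum_eta_mem (k := k) (Ψ := Ψ) x σ using 1
  refine Finset.sum_congr (Finset.ext fun τ => ?_) fun _ _ => rfl
  simp only [Finset.mem_filter, Finset.mem_univ, true_and]
  exact ⟨fun h => h.2, fun h => ⟨(hT.iff_of_eta_eq h).2 hσ, h⟩⟩

/-- Stability in each coordinate makes `T` a union of products of fibers, each contributing a pure
tensor of diagram sums. -/
theorem sum_basisF_tmul_basisF_mem {m n : ℕ} {x : X.Deco m} {y : X.Deco n}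
    {T : Finset (Equiv.Perm (Fin m) × Equiv.Perm (Fin n))}
    (h₁ : ∀ τ, (Ψ m x).Stable fun σ => (σ, τ) ∈ T)
    (h₂ : ∀ σ, (Ψ n y).Stable fun τ => (σ, τ) ∈ T) :
    ∑ z ∈ T, basisF k (⟨m, z.1, x⟩ : DecPerm X) ⊗ₜ[k] basisF k (⟨n, z.2, y⟩ : DecPerm X) ∈
      LinearMap.range
        (TensorProduct.mapIncl (diagramSpaceDeg k Ψ m) (diagramSpaceDeg k Ψ n)) := by
  classical
  let g : Equiv.Perm (Fin m) × Equiv.Perm (Fin n) → Set (Arc m) × Set (Arc n) := fun z =>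
    (eta (Ψ m x) z.1, eta (Ψ n y) z.2)
  rw [← Finset.sum_fiberwise_of_maps_to (t := T.image g) (g := g)
    fun z hz => Finset.mem_image_of_mem _ hz]
  refine Submodule.sum_mem _ fun D hD => ?_
  obtain ⟨⟨σ, τ⟩, hz, rfl⟩ := Finset.mem_image.1 hD
  refine ⟨⟨_, diagramSum_eta_mem x σ⟩ ⊗ₜ[k] ⟨_, diagramSum_eta_mem y τ⟩, ?_⟩
  rw [TensorProduct.mapIncl, TensorProduct.map_tmul]
  simp only [Submodule.subtype_apply, diagramSum, TensorProduct.sum_tmul,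
    TensorProduct.tmul_sum]
  rw [Finset.sum_comm, ← Finset.sum_product']
  refine Finset.sum_congr (Finset.ext fun z => ?_) fun _ _ => rfl
  simp only [Finset.mem_product, Finset.mem_filter, Finset.mem_univ, true_and, g, Prod.mk.injEq]
  refine ⟨fun h => ⟨?_, h⟩, fun h => h.2⟩
  have := ((h₁ τ).iff_of_eta_eq h.1).2 hz
  exact ((h₂ z.1).iff_of_eta_eq h.2).2 this

/-- If both endpoints are among the first `m` values, the exchange induces that of an arc `β` with
augmentation `α`; as `α` is outside the ideal of `xy`, so is `β` outside that of `x`. Otherwise the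
subword keeps its relative order. -/
theorem eta_stdVal_flip_castAdd (hΨ : IsConservative X Ψ) {m n : ℕ} (x : X.Deco m) (y : X.Deco n)
    {α : Arc (m + n)} (hα : α ∉ (Ψ (m + n) (X.concat x y)).carrier)
    {ρ : Equiv.Perm (Fin (m + n))} (h : α.At ρ) :
    eta (Ψ m x) (stdVal (α.flip ρ) (Fin.castAddOrderEmb n)) =
      eta (Ψ m x) (stdVal ρ (Fin.castAddOrderEmb n)) := by
  by_cases hR : α.left ∈ Set.range (Fin.castAddOrderEmb n) ∧
      α.right ∈ Set.range (Fin.castAddOrderEmb (n := m) n)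
  · obtain ⟨⟨a, ha⟩, ⟨b, hb⟩⟩ := hR
    let β : Arc m := Arc.select (Fin.castAddOrderEmb n) a b
      ((Fin.castAddOrderEmb n).lt_iff_lt.1 (ha ▸ hb ▸ α.lt)) α.pts (by rw [ha, hb]; exact α.sub)
    have hp : ∀ v, v ∈ β.pts ↔ Fin.castAddOrderEmb n v ∈ α.pts := fun v => by
      simp [β, Arc.select]
    have hβ : β.At (stdVal ρ (Fin.castAddOrderEmb n)) := h.stdVal ha hb hp
    rw [Arc.stdVal_flip h hβ ha hb]
    refine ArcIdeal.eta_flip (fun hc => hα ?_) hβ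
    convert hΨ.augment_mem x y β hc
    refine Arc.ext ha.symm hb.symm (Finset.ext fun v => ?_)
    rw [Arc.augment, Finset.mem_map]
    constructor
    · intro hv
      -- The points of `α` lie below its right end, hence among the first `m` values; none is lost
      -- by selection.
      have hvb : v.1 < m := lt_trans (Finset.mem_Ioo.1 (α.sub hv)).2 (hb ▸ b.isLt)
      exact ⟨⟨v.1, hvb⟩, (hp _).2 hv, rfl⟩
    · rintro ⟨w, hw, rfl⟩
      exact (hp w).1 hw
  · rw [Arc.stdVal_flip_of_notMem h hR]

theorem eta_stdVal_flip_natAdd (hΨ : IsConservative X Ψ) {m n : ℕ} (x : X.Deco m) (y : X.Deco n)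
    {α : Arc (m + n)} (hα : α ∉ (Ψ (m + n) (X.concat x y)).carrier)
    {ρ : Equiv.Perm (Fin (m + n))} (h : α.At ρ) :
    eta (Ψ n y) (stdVal (α.flip ρ) (Fin.natAddOrderEmb m)) =
      eta (Ψ n y) (stdVal ρ (Fin.natAddOrderEmb m)) := by
  by_cases hR : α.left ∈ Set.range (Fin.natAddOrderEmb m) ∧
      α.right ∈ Set.range (Fin.natAddOrderEmb (m := n) m)
  · obtain ⟨⟨a, ha⟩, ⟨b, hb⟩⟩ := hR
    let β : Arc n := Arc.select (Fin.natAddOrderEmb m) a b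
      ((Fin.natAddOrderEmb m).lt_iff_lt.1 (ha ▸ hb ▸ α.lt)) α.pts (by rw [ha, hb]; exact α.sub)
    have hp : ∀ v, v ∈ β.pts ↔ Fin.natAddOrderEmb m v ∈ α.pts := fun v => by
      simp [β, Arc.select]
    have hβ : β.At (stdVal ρ (Fin.natAddOrderEmb m)) := h.stdVal ha hb hp
    rw [Arc.stdVal_flip h hβ ha hb]
    refine ArcIdeal.eta_flip (fun hc => hα ?_) hβ
    convert hΨ.shift_mem x y β hc
    refine Arc.ext ha.symm hb.symm (Finset.ext fun v => ?_)
    rw [Arc.shift, Finset.mem_map]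
    constructor
    · intro hv
      have hvb : m + a.1 < v.1 := by
        have := (Finset.mem_Ioo.1 (α.sub hv)).1
        rwa [← ha] at this
      have hw : Fin.natAddOrderEmb m ⟨v.1 - m, by omega⟩ = v :=
        Fin.ext (show m + (v.1 - m) = v.1 by omega)
      exact ⟨⟨v.1 - m, by omega⟩, (hp _).2 (hw ▸ hv), hw⟩
    · rintro ⟨w, hw, rfl⟩
      exact (hp w).1 hw
  · rw [Arc.stdVal_flip_of_notMem h hR]

theorem mul_mem_diagramSpaceDeg (hΨ : IsConservative X Ψ) {m n : ℕ} {a b : PermSpace k X}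
    (ha : a ∈ diagramSpaceDeg k Ψ m) (hb : b ∈ diagramSpaceDeg k Ψ n) :
    (permOps k X).mul a b ∈ diagramSpaceDeg k Ψ (m + n) := by
  classical
  refine LinearMap.BilinMap.apply_apply_mem_of_mem_span _ _ _ _ ?_ _ _ ha hb
  rintro _ ⟨x, D, -, -, rfl⟩ _ ⟨y, E, -, -, rfl⟩
  have : (permOps k X).mul (diagramSum k Ψ D x) (diagramSum k Ψ E y) =
      ∑ ρ ∈ Finset.univ.filter (fun ρ : Equiv.Perm (Fin (m + n)) =>
        eta (Ψ m x) (stdVal ρ (Fin.castAddOrderEmb n)) = D ∧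
        eta (Ψ n y) (stdVal ρ (Fin.natAddOrderEmb m)) = E),
        basisF k (⟨m + n, ρ, X.concat x y⟩ : DecPerm X) := by
    simp only [diagramSum, map_sum, LinearMap.sum_apply, permOps_mul_basisF]
    -- Each `ρ` occurs in the shifted shuffle of a single pair, namely its two standardized value
    -- subwords.
    rw [Finset.sum_comm, ← Finset.sum_product', Finset.sum_comm'
      (t' := Finset.univ.filter fun ρ : Equiv.Perm (Fin (m + n)) =>
        eta (Ψ m x) (stdVal ρ (Fin.castAddOrderEmb n)) = D ∧
        eta (Ψ n y) (stdVal ρ (Fin.natAddOrderEmb m)) = E)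
      (s' := fun ρ => {(stdVal ρ (Fin.castAddOrderEmb n), stdVal ρ (Fin.natAddOrderEmb m))})]
    · simp only [Finset.sum_singleton]
    · rintro ⟨σ, τ⟩ ρ
      simp only [Finset.mem_product, Finset.mem_filter, Finset.mem_univ, true_and,
        mem_shiftedShuffle, Finset.mem_singleton, Prod.mk.injEq]
      constructor
      · rintro ⟨⟨h1, h2⟩, rfl, rfl⟩
        exact ⟨⟨rfl, rfl⟩, h1, h2⟩
      · rintro ⟨⟨rfl, rfl⟩, h1, h2⟩
        exact ⟨⟨h1, h2⟩, rfl, rfl⟩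
  rw [this]
  refine sum_basisF_mem fun α hα ρ hρ h => ?_
  simp only [Finset.mem_filter, Finset.mem_univ, true_and] at h ⊢
  rwa [eta_stdVal_flip_castAdd hΨ x y hα hρ, eta_stdVal_flip_natAdd hΨ x y hα hρ]

theorem lift_notMem (hΨ : IsConservative X Ψ) {p q : ℕ} {z : X.Deco p} {Q : Fin q ↪o Fin p}
    {ρ : Equiv.Perm (Fin p)} {β : Arc q}
    (hβ : β ∉ (Ψ q (X.select z (imageEmb ρ Q))).carrier) (h : β.At (stdPos ρ Q)) :
    Arc.lift ρ Q β ∉ (Ψ p z).carrier := fun hc => hβ <| by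
  have := hΨ.select_mem z (imageEmb ρ Q) β.left β.right β.lt _ (Arc.lift ρ Q β).sub hc
  rwa [Arc.select_lift h] at this

/-- Once the value sets of the two parts are fixed, the decorations are constant and `ρ` is
determined by its two standardizations. An exchange in one part lifts to `ρ`, preserving its `eta`,
both value sets and the other part; so the pairs form a set stable in each coordinate. -/
theorem sum_std_tmul_std_mem (hΨ : IsConservative X Ψ) {p q r : ℕ} (z : X.Deco p)
    (D : Set (Arc p)) {Q : Fin q ↪o Fin p} {Q' : Fin r ↪o Fin p}
    (hc : IsCompl (Set.range Q) (Set.range Q'))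
    (hQ : ∀ i j : Fin q, i.1 + 1 = j → (Q i).1 + 1 = Q j)
    (hQ' : ∀ i j : Fin r, i.1 + 1 = j → (Q' i).1 + 1 = Q' j)
    [DecidablePred fun ρ => eta (Ψ p z) ρ = D] :
    ∑ ρ ∈ Finset.univ.filter (fun ρ => eta (Ψ p z) ρ = D),
      basisF k (DecPerm.std (⟨p, ρ, z⟩ : DecPerm X) Q) ⊗ₜ[k]
        basisF k (DecPerm.std (⟨p, ρ, z⟩ : DecPerm X) Q') ∈
      LinearMap.range
        (TensorProduct.mapIncl (diagramSpaceDeg k Ψ q) (diagramSpaceDeg k Ψ r)) := by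
  classical
  let U := Finset.univ.filter (fun ρ => eta (Ψ p z) ρ = D)
  let g : Equiv.Perm (Fin p) → (Fin q ↪o Fin p) × (Fin r ↪o Fin p) := fun ρ =>
    (imageEmb ρ Q, imageEmb ρ Q')
  let φ : Equiv.Perm (Fin p) → Equiv.Perm (Fin q) × Equiv.Perm (Fin r) := fun ρ =>
    (stdPos ρ Q, stdPos ρ Q')
  rw [← Finset.sum_fiberwise_of_maps_to (t := U.image g) (g := g)
    fun z hz => Finset.mem_image_of_mem _ hz]
  refine Submodule.sum_mem _ fun RR _ => ?_
  obtain ⟨R, R'⟩ := RR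
  have hmem : ∀ {ρ}, ρ ∈ U.filter (fun ρ => g ρ = (R, R')) ↔
      eta (Ψ p z) ρ = D ∧ imageEmb ρ Q = R ∧ imageEmb ρ Q' = R' := by
    intro ρ
    simp [U, g]
  have hinj : Set.InjOn φ (U.filter fun ρ => g ρ = (R, R') : Finset _) := by
    intro ρ hρ π hπ h
    obtain ⟨-, h1, h2⟩ := hmem.1 hρ
    obtain ⟨-, h3, h4⟩ := hmem.1 hπ
    simp only [φ, Prod.mk.injEq] at h
    exact perm_eq_of_stdPos (fun i => hc.sup_eq_top.ge (Set.mem_univ i)) (h1.trans h3.symm)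
      (h2.trans h4.symm) h.1 h.2
  have hsum : ∑ ρ ∈ U.filter (fun ρ => g ρ = (R, R')),
      basisF k (DecPerm.std (⟨p, ρ, z⟩ : DecPerm X) Q) ⊗ₜ[k]
        basisF k (DecPerm.std (⟨p, ρ, z⟩ : DecPerm X) Q') =
      ∑ w ∈ (U.filter (fun ρ => g ρ = (R, R'))).image φ,
        basisF k (⟨q, w.1, X.select z R⟩ : DecPerm X) ⊗ₜ[k]
          basisF k (⟨r, w.2, X.select z R'⟩ : DecPerm X) := by
    rw [Finset.sum_image hinj]
    refine Finset.sum_congr rfl fun ρ hρ => ?_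
    obtain ⟨-, rfl, rfl⟩ := hmem.1 hρ
    rfl
  rw [hsum]
  refine sum_basisF_tmul_basisF_mem (fun τ β hβ σ hσ h => ?_) fun σ β hβ τ hτ h => ?_
  · obtain ⟨ρ, hρ, he⟩ := Finset.mem_image.1 h
    simp only [φ, Prod.mk.injEq] at he
    obtain ⟨rfl, rfl⟩ := he
    obtain ⟨h1, rfl, rfl⟩ := hmem.1 hρ
    refine Finset.mem_image.2 ⟨(Arc.lift ρ Q β).flip ρ, hmem.2 ⟨?_, ?_, ?_⟩, ?_⟩
    · rw [ArcIdeal.eta_flip (lift_notMem hΨ hβ hσ) (hσ.lift hQ), h1]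
    · exact Arc.imageEmb_flip_lift ρ Q β
    · exact Arc.imageEmb_flip_lift_of_disjoint β hc.disjoint
    · exact Prod.ext (Arc.stdPos_flip_lift hσ hQ)
        (Arc.stdPos_flip_lift_of_disjoint hσ hQ hc.disjoint)
  · obtain ⟨ρ, hρ, he⟩ := Finset.mem_image.1 h
    simp only [φ, Prod.mk.injEq] at he
    obtain ⟨rfl, rfl⟩ := he
    obtain ⟨h1, rfl, rfl⟩ := hmem.1 hρ
    refine Finset.mem_image.2 ⟨(Arc.lift ρ Q' β).flip ρ, hmem.2 ⟨?_, ?_, ?_⟩, ?_⟩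
    · rw [ArcIdeal.eta_flip (lift_notMem hΨ hβ hτ) (hτ.lift hQ'), h1]
    · exact Arc.imageEmb_flip_lift_of_disjoint β hc.disjoint.symm
    · exact Arc.imageEmb_flip_lift ρ Q' β
    · exact Prod.ext (Arc.stdPos_flip_lift_of_disjoint hτ hQ' hc.disjoint.symm)
        (Arc.stdPos_flip_lift hτ hQ')

theorem comul_mem_diagramSpaceDeg (hΨ : IsConservative X Ψ) {p : ℕ} {a : PermSpace k X}
    (ha : a ∈ diagramSpaceDeg k Ψ p) : (permOps k X).comul a ∈
      ⨆ ij ∈ Finset.HasAntidiagonal.antidiagonal p, LinearMap.range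
        (TensorProduct.mapIncl (diagramSpaceDeg k Ψ ij.1) (diagramSpaceDeg k Ψ ij.2)) := by
  classical
  suffices h : diagramSpaceDeg k Ψ p ≤ Submodule.comap (permOps k X).comul
      (⨆ ij ∈ Finset.HasAntidiagonal.antidiagonal p, LinearMap.range
        (TensorProduct.mapIncl (diagramSpaceDeg k Ψ ij.1) (diagramSpaceDeg k Ψ ij.2))) from h ha
  refine Submodule.span_le.2 ?_
  rintro _ ⟨z, D, -, -, rfl⟩
  rw [SetLike.mem_coe, Submodule.mem_comap, diagramSum, map_sum]
  have hc : ∀ ρ : Equiv.Perm (Fin p), (permOps k X).comul (basisF k (⟨p, ρ, z⟩ : DecPerm X)) =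
      ∑ i : Fin (p + 1),
        basisF k (DecPerm.std (⟨p, ρ, z⟩ : DecPerm X)
          (Fin.castLEOrderEmb (Nat.le_of_lt_succ i.isLt))) ⊗ₜ[k]
        basisF k (DecPerm.std (⟨p, ρ, z⟩ : DecPerm X) (lastEmb (Nat.le_of_lt_succ i.isLt))) :=
    fun ρ => permOps_comul_basisF _
  simp only [hc]
  rw [Finset.sum_comm]
  refine Submodule.sum_mem _ fun i _ => ?_
  have hi := Nat.le_of_lt_succ i.isLt
  refine Submodule.mem_iSup_of_mem (i.1, p - i.1) (Submodule.mem_iSup_of_mem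
    (Finset.HasAntidiagonal.mem_antidiagonal.2 (Nat.add_sub_cancel' hi)) ?_)
  refine sum_std_tmul_std_mem hΨ z D (isCompl_range_first_last hi) (fun i j h => h)
    fun i j h => ?_
  change _ + i.1 + 1 = _ + j.1
  omega

end DiagramSpace

/-! ## Restriction of a Hopf algebra to a subspace -/

namespace HopfOps

variable {k : Type v} [Field k] {A B C : Type*} [AddCommGroup A] [Module k A]
  [AddCommGroup B] [Module k B] [AddCommGroup C] [Module k C]

theorem map_injective {f : A →ₗ[k] B} (hf : Function.Injective f) :
    Function.Injective (TensorProduct.map f f) :=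
  TensorProduct.map_injective_of_flat_flat f f hf hf

/-- Over a field `V ⊗ V` embeds in `A ⊗ A`, so the coproduct has a well-defined lift to `V ⊗ V`. -/
theorem IsHopfSubalgebra.exists_isHom {H : HopfOps k A} {V : Submodule k A}
    (hV : H.IsHopfSubalgebra V) : ∃ K : HopfOps k V, K.IsHom H V.subtype := by
  have hinj : Function.Injective (TensorProduct.mapIncl V V) :=
    Module.Flat.tensorProduct_mapIncl_injective_of_right V V
  let e := LinearEquiv.ofInjective (TensorProduct.mapIncl V V) hinj
  let c : V →ₗ[k] LinearMap.range (TensorProduct.mapIncl V V) :=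
    (H.comul ∘ₗ V.subtype).codRestrict _ fun v => hV.comul_mem v v.2
  refine ⟨⟨LinearMap.mk₂ k (fun a b => ⟨H.mul a b, hV.mul_mem a a.2 b b.2⟩)
    (fun _ _ _ => Subtype.ext (by simp)) (fun _ _ _ => Subtype.ext (by simp))
    (fun _ _ _ => Subtype.ext (by simp)) (fun _ _ _ => Subtype.ext (by simp)),
    e.symm.toLinearMap ∘ₗ c⟩, fun _ _ => rfl, fun a => ?_⟩
  exact congrArg Subtype.val (e.apply_symm_apply (c a))

theorem IsHom.comp {H : HopfOps k A} {K : HopfOps k B} {L : HopfOps k C} {f : A →ₗ[k] B}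
    {g : B →ₗ[k] C} (hg : K.IsHom L g) (hf : H.IsHom K f) : H.IsHom L (g ∘ₗ f) where
  map_mul a b := by simp [hf.map_mul, hg.map_mul]
  map_comul a := by
    rw [TensorProduct.map_comp, LinearMap.comp_apply, hf.map_comul, hg.map_comul]
    rfl

theorem IsHom.of_comp {H : HopfOps k A} {K : HopfOps k B} {L : HopfOps k C} {f : A →ₗ[k] B}
    {g : B →ₗ[k] C} (hg : K.IsHom L g) (hi : Function.Injective g) (hf : H.IsHom L (g ∘ₗ f)) :
    H.IsHom K f where
  map_mul a b := hi (by
    rw [hg.map_mul]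
    exact hf.map_mul a b)
  map_comul a := map_injective hi (by
    have := hf.map_comul a
    rwa [TensorProduct.map_comp, LinearMap.comp_apply, LinearMap.comp_apply,
      ← hg.map_comul] at this)

theorem IsHom.isHopfSubalgebra_range {H : HopfOps k A} {K : HopfOps k B} {f : A →ₗ[k] B}
    (hf : H.IsHom K f) : K.IsHopfSubalgebra (LinearMap.range f) where
  mul_mem := by
    rintro _ ⟨a, rfl⟩ _ ⟨b, rfl⟩
    exact ⟨_, hf.map_mul a b⟩
  comul_mem := by
    rintro _ ⟨a, rfl⟩
    refine ⟨TensorProduct.map f.rangeRestrict f.rangeRestrict (H.comul a), ?_⟩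
    rw [← hf.map_comul, TensorProduct.mapIncl, ← LinearMap.comp_apply, ← TensorProduct.map_comp]
    rfl

section Transfer

variable {H : HopfOps k A} {K : HopfOps k B} {f : A →ₗ[k] B}

theorem IsHom.assoc_of_injective (hf : H.IsHom K f) (hi : Function.Injective f)
    (h : ∀ a b c : B, K.mul (K.mul a b) c = K.mul a (K.mul b c)) (a b c : A) :
    H.mul (H.mul a b) c = H.mul a (H.mul b c) :=
  hi (by simp only [hf.map_mul, h])

/-- The triple tensor power of an injective map over a field is injective, so the identity may be
checked in the target. -/
theorem IsHom.coassoc_of_injective (hf : H.IsHom K f) (hi : Function.Injective f)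
    (h : ∀ a : B, TensorProduct.assoc k B B B (K.comul.rTensor B (K.comul a)) =
      K.comul.lTensor B (K.comul a)) (a : A) :
    TensorProduct.assoc k A A A (H.comul.rTensor A (H.comul a)) =
      H.comul.lTensor A (H.comul a) := by
  have hi₂ := map_injective hi
  have hi₃ := TensorProduct.map_injective_of_flat_flat f (TensorProduct.map f f) hi hi₂
  have h1 : ∀ t : (A ⊗[k] A) ⊗[k] A, TensorProduct.map f (TensorProduct.map f f)
      (TensorProduct.assoc k A A A t) = TensorProduct.assoc k B B B
        (TensorProduct.map (TensorProduct.map f f) f t) := fun t =>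
    LinearMap.congr_fun (f := TensorProduct.map f (TensorProduct.map f f) ∘ₗ
      (TensorProduct.assoc k A A A).toLinearMap) (g := (TensorProduct.assoc k B B B).toLinearMap ∘ₗ
        TensorProduct.map (TensorProduct.map f f) f)
      (TensorProduct.ext_threefold fun _ _ _ => rfl) t
  have h2 : ∀ t : A ⊗[k] A, TensorProduct.map (TensorProduct.map f f) f (H.comul.rTensor A t) =
      K.comul.rTensor B (TensorProduct.map f f t) := fun t => by
    induction t with
    | zero => simp
    | add _ _ h₁ h₂ => simp only [map_add, h₁, h₂]
    | tmul a b => simp [hf.map_comul]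
  have h3 : ∀ t : A ⊗[k] A, TensorProduct.map f (TensorProduct.map f f) (H.comul.lTensor A t) =
      K.comul.lTensor B (TensorProduct.map f f t) := fun t => by
    induction t with
    | zero => simp
    | add _ _ h₁ h₂ => simp only [map_add, h₁, h₂]
    | tmul a b => simp [hf.map_comul]
  apply hi₃
  rw [h1, h2, h3, hf.map_comul, h]

theorem IsHom.compat_of_injective (hf : H.IsHom K f) (hi : Function.Injective f)
    (h : ∀ a b : B, K.comul (K.mul a b) =
      TensorProduct.map (TensorProduct.lift K.mul) (TensorProduct.lift K.mul)
        (TensorProduct.tensorTensorTensorComm k B B B B (K.comul a ⊗ₜ[k] K.comul b))) (a b : A) :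
    H.comul (H.mul a b) =
      TensorProduct.map (TensorProduct.lift H.mul) (TensorProduct.lift H.mul)
        (TensorProduct.tensorTensorTensorComm k A A A A (H.comul a ⊗ₜ[k] H.comul b)) := by
  have key : ∀ s t : A ⊗[k] A, TensorProduct.map f f
      (TensorProduct.map (TensorProduct.lift H.mul) (TensorProduct.lift H.mul)
        (TensorProduct.tensorTensorTensorComm k A A A A (s ⊗ₜ[k] t))) =
      TensorProduct.map (TensorProduct.lift K.mul) (TensorProduct.lift K.mul)
        (TensorProduct.tensorTensorTensorComm k B B B B
          (TensorProduct.map f f s ⊗ₜ[k] TensorProduct.map f f t)) := fun s t => by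
    induction s with
    | zero => simp
    | add _ _ h₁ h₂ => simp only [map_add, TensorProduct.add_tmul, h₁, h₂]
    | tmul a b =>
      induction t with
      | zero => simp
      | add _ _ h₁ h₂ => simp only [map_add, TensorProduct.tmul_add, h₁, h₂]
      | tmul c d => simp [hf.map_mul]
  apply map_injective hi
  rw [key, hf.map_comul, hf.map_comul, hf.map_comul, hf.map_mul, h]

end Transfer

end HopfOps

theorem isInternal_comap_iSup {ι k A : Type*} [DecidableEq ι] [Field k] [AddCommGroup A]
    [Module k A] {gr : ι → Submodule k A} (h : iSupIndep gr) :
    DirectSum.IsInternal fun i => (gr i).comap (⨆ i, gr i).subtype := by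
  have hmap : ∀ i, ((gr i).comap (⨆ i, gr i).subtype).map (⨆ i, gr i).subtype = gr i := fun i => by
    rw [Submodule.map_comap_subtype]
    exact inf_eq_right.2 (le_iSup gr i)
  refine DirectSum.isInternal_submodule_of_iSupIndep_of_iSup_eq_top (fun i => ?_) ?_
  · rw [Submodule.disjoint_def]
    intro v hv hv'
    have hle : ⨆ j, ⨆ (_ : j ≠ i), (gr j).comap (⨆ i, gr i).subtype ≤
        (⨆ j, ⨆ (_ : j ≠ i), gr j).comap (⨆ i, gr i).subtype :=
      iSup₂_le fun j hj => Submodule.comap_mono (le_iSup₂ (f := fun j (_ : j ≠ i) => gr j) j hj)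
    exact Subtype.ext (Submodule.disjoint_def.1 (h i) v hv (hle hv'))
  · apply Submodule.map_injective_of_injective (⨆ i, gr i).injective_subtype
    rw [Submodule.map_iSup, Submodule.map_top, Submodule.range_subtype]
    simp only [hmap]

/-! ## The Hopf algebra of decorated noncrossing arc diagrams -/

section DiagramHopf

variable {k : Type v} [Field k] {X : DecorationSet.{u}} {Ψ : ArcMap X}

theorem diagramSpaceDeg_le (n : ℕ) : diagramSpaceDeg k Ψ n ≤ diagramSpace k Ψ :=
  le_iSup (diagramSpaceDeg k Ψ) n

theorem isHopfSubalgebra_diagramSpace (hΨ : IsConservative X Ψ) :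
    (permOps k X).IsHopfSubalgebra (diagramSpace k Ψ) where
  mul_mem a ha b hb := by
    induction ha using Submodule.iSup_induction' with
    | zero => simp
    | add _ _ _ _ h₁ h₂ =>
      rw [map_add, LinearMap.add_apply]
      exact Submodule.add_mem _ h₁ h₂
    | mem m a ha =>
    induction hb using Submodule.iSup_induction' with
    | zero => simp
    | add _ _ _ _ h₁ h₂ =>
      rw [map_add]
      exact Submodule.add_mem _ h₁ h₂
    | mem n b hb => exact diagramSpaceDeg_le _ (mul_mem_diagramSpaceDeg hΨ ha hb)
  comul_mem a ha := by
    induction ha using Submodule.iSup_induction' with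
    | zero => simp
    | add _ _ _ _ h₁ h₂ =>
      rw [map_add]
      exact Submodule.add_mem _ h₁ h₂
    | mem n a ha =>
      exact (iSup₂_le fun ij _ => TensorProduct.range_mapIncl_mono (diagramSpaceDeg_le _)
        (diagramSpaceDeg_le _)) (comul_mem_diagramSpaceDeg hΨ ha)

theorem diagramSpaceDeg_le_supported (n : ℕ) :
    diagramSpaceDeg k Ψ n ≤ Finsupp.supported k k {d : DecPerm X | d.1 = n} := by
  refine Submodule.span_le.2 ?_
  rintro _ ⟨x, D, -, -, rfl⟩
  rw [SetLike.mem_coe, diagramSum]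
  refine Submodule.sum_mem _ fun σ _ => ?_
  rw [basisF]
  exact Finsupp.single_mem_supported (s := {d : DecPerm X | d.1 = n}) k 1
    (show (⟨n, σ, x⟩ : DecPerm X).1 = n from rfl)

/-- Different degrees are supported on disjoint sets of basis elements. -/
theorem iSupIndep_diagramSpaceDeg : iSupIndep (diagramSpaceDeg k Ψ) := by
  intro n
  have hle : ⨆ m, ⨆ (_ : m ≠ n), diagramSpaceDeg k Ψ m ≤
      Finsupp.supported k k {d : DecPerm X | d.1 ≠ n} :=
    iSup₂_le fun m hm => (diagramSpaceDeg_le_supported m).trans <|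
      Finsupp.supported_mono fun d (hd : d.1 = m) => show d.1 ≠ n from hd ▸ hm
  have hd : Disjoint (Finsupp.supported k k {d : DecPerm X | d.1 = n})
      (Finsupp.supported k k {d : DecPerm X | d.1 ≠ n}) :=
    Finsupp.disjoint_supported_supported (Set.disjoint_left.2 fun d h h' => h' h)
  exact hd.mono (diagramSpaceDeg_le_supported n) hle

theorem isInternal_diagramGrading : DirectSum.IsInternal (diagramGrading k Ψ) :=
  isInternal_comap_iSup iSupIndep_diagramSpaceDeg

theorem isGradedHopf_diagramSpace (hΨ : IsConservative X Ψ) {H : HopfOps k (diagramSpace k Ψ)}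
    (hH : H.IsHom (permOps k X) (diagramSpace k Ψ).subtype) :
    H.IsGradedHopf (diagramGrading k Ψ) where
  assoc := hH.assoc_of_injective (Submodule.injective_subtype _) permOps_assoc
  coassoc := hH.coassoc_of_injective (Submodule.injective_subtype _) permOps_coassoc
  compat := hH.compat_of_injective (Submodule.injective_subtype _) permOps_compat
  internal := isInternal_diagramGrading
  mul_mem m n a ha b hb := by
    change (diagramSpace k Ψ).subtype (H.mul a b) ∈ diagramSpaceDeg k Ψ (m + n)
    rw [hH.map_mul]
    exact mul_mem_diagramSpaceDeg hΨ ha hb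
  comul_mem n a ha := by
    have hinj := HopfOps.map_injective
      (A := diagramSpace k Ψ) (f := (diagramSpace k Ψ).subtype)
      (Submodule.injective_subtype (diagramSpace k Ψ))
    have h := comul_mem_diagramSpaceDeg hΨ
      (show (diagramSpace k Ψ).subtype a ∈ diagramSpaceDeg k Ψ n from ha)
    rw [← hH.map_comul] at h
    -- The degree of the coproduct is known in the ambient tensor square. Every ambient homogeneous
    -- tensor of diagram elements comes from the tensor square of the subspace, and injectivity
    -- identifies the preimage.
    have hle : ⨆ ij ∈ Finset.HasAntidiagonal.antidiagonal n, LinearMap.range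
        (TensorProduct.mapIncl (diagramSpaceDeg k Ψ ij.1) (diagramSpaceDeg k Ψ ij.2)) ≤
        (⨆ ij ∈ Finset.HasAntidiagonal.antidiagonal n, LinearMap.range
          (TensorProduct.mapIncl (diagramGrading k Ψ ij.1) (diagramGrading k Ψ ij.2))).map
          (TensorProduct.map (diagramSpace k Ψ).subtype (diagramSpace k Ψ).subtype) := by
      refine iSup₂_le fun ij hij => ?_
      refine le_trans ?_ (Submodule.map_mono (le_iSup₂ ij hij))
      rw [TensorProduct.range_mapIncl, Submodule.map₂_le]
      intro x hx y hy
      exact ⟨(⟨x, diagramSpaceDeg_le _ hx⟩ : diagramSpace k Ψ) ⊗ₜ ⟨y, diagramSpaceDeg_le _ hy⟩,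
        ⟨(⟨⟨x, diagramSpaceDeg_le _ hx⟩, hx⟩ : diagramGrading k Ψ ij.1) ⊗ₜ
          ⟨⟨y, diagramSpaceDeg_le _ hy⟩, hy⟩, rfl⟩, rfl⟩
    obtain ⟨t, ht, he⟩ := hle h
    rwa [← hinj he]

end DiagramHopf

/-! ## Decoration subsets -/

namespace DecorationSubset

variable {k : Type v} [Field k] {X : DecorationSet.{u}} (Y : DecorationSubset X)

theorem isConservative_restrict {Ψ : ArcMap X} (hΨ : IsConservative X Ψ) :
    IsConservative Y.toDecorationSet (Y.restrict Ψ) where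
  augment_mem x y := hΨ.augment_mem x.1 y.1
  shift_mem x y := hΨ.shift_mem x.1 y.1
  select_mem z := hΨ.select_mem z.1

theorem permInclusion_basisF (d : DecPerm Y.toDecorationSet) :
    permInclusion k Y (basisF k d) = basisF k (⟨d.1, d.2.1, d.2.2.1⟩ : DecPerm X) := by
  simp [permInclusion, basisF, Finsupp.mapDomain_single]

theorem permInclusion_injective : Function.Injective (permInclusion k Y) := by
  refine Finsupp.mapDomain_injective ?_
  rintro ⟨m, σ, x⟩ ⟨n, τ, y⟩ h
  obtain ⟨rfl, h⟩ := Sigma.mk.inj_iff.1 h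
  simp only [heq_eq_eq, Prod.mk.injEq] at h
  obtain ⟨rfl, h⟩ := h
  rw [Subtype.ext h]

theorem isHom_permInclusion :
    (permOps k Y.toDecorationSet).IsHom (permOps k X) (permInclusion k Y) where
  map_mul a b := by
    induction a using permSpace_induction with
    | h0 => simp
    | hadd _ _ h₁ h₂ => simp only [map_add, LinearMap.add_apply, h₁, h₂]
    | hsmul _ _ h => simp only [map_smul, LinearMap.smul_apply, h]
    | hF d =>
    induction b using permSpace_induction with
    | h0 => simp
    | hadd _ _ h₁ h₂ => simp only [map_add, h₁, h₂]
    | hsmul _ _ h => simp only [map_smul, h]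
    | hF e =>
    rw [permOps_mul_basisF, permInclusion_basisF, permInclusion_basisF, permOps_mul_basisF,
      map_sum]
    exact Finset.sum_congr rfl fun ρ _ => permInclusion_basisF Y _
  map_comul a := by
    induction a using permSpace_induction with
    | h0 => simp
    | hadd _ _ h₁ h₂ => simp only [map_add, h₁, h₂]
    | hsmul _ _ h => simp only [map_smul, h]
    | hF d =>
    rw [permOps_comul_basisF, permInclusion_basisF, permOps_comul_basisF, map_sum]
    refine Finset.sum_congr rfl fun i _ => ?_
    rw [TensorProduct.map_tmul, permInclusion_basisF, permInclusion_basisF]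
    rfl

/-- The restricted map assigns the same ideal to `x`, so diagrams and fibers are unchanged and
generators go to generators. -/
theorem map_diagramSpaceDeg_le (Ψ : ArcMap X) (n : ℕ) :
    (diagramSpaceDeg k (Y.restrict Ψ) n).map (permInclusion k Y) ≤ diagramSpaceDeg k Ψ n := by
  rw [diagramSpaceDeg, Submodule.map_span_le]
  rintro _ ⟨x, D, h₁, h₂, rfl⟩
  refine Submodule.subset_span ⟨x.1, D, h₁, h₂, ?_⟩
  rw [diagramSum, map_sum]
  exact Finset.sum_congr rfl fun σ _ => permInclusion_basisF Y _

theorem map_diagramSpace_le (Ψ : ArcMap X) :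
    (diagramSpace k (Y.restrict Ψ)).map (permInclusion k Y) ≤ diagramSpace k Ψ := by
  rw [diagramSpace, Submodule.map_iSup]
  exact iSup_mono fun n => Y.map_diagramSpaceDeg_le Ψ n

end DecorationSubset

theorem mainTheorem10 {k : Type v} [Field k] (X' : DecorationSet.{u}) (X : DecorationSubset X')
    (Ψ' : ArcMap X') (hΨ' : IsConservative X' Ψ') :
    IsConservative X.toDecorationSet (X.restrict Ψ') ∧
    ∃ (H : HopfOps k (diagramSpace k (X.restrict Ψ'))) (H' : HopfOps k (diagramSpace k Ψ')),
      H.IsHom (permOps k X.toDecorationSet) (diagramSpace k (X.restrict Ψ')).subtype ∧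
      H'.IsHom (permOps k X') (diagramSpace k Ψ').subtype ∧
      H.IsGradedHopf (diagramGrading k (X.restrict Ψ')) ∧
      H'.IsGradedHopf (diagramGrading k Ψ') ∧
      ∃ j : diagramSpace k (X.restrict Ψ') →ₗ[k] diagramSpace k Ψ',
        (∀ v, (j v : PermSpace k X') = permInclusion k X (v : PermSpace k X.toDecorationSet)) ∧
        Function.Injective j ∧
        H.IsHom H' j ∧
        (∀ n, (diagramGrading k (X.restrict Ψ') n).map j ≤ diagramGrading k Ψ' n) ∧
        H'.IsHopfSubalgebra (LinearMap.range j) := by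
  have hΨ := X.isConservative_restrict hΨ'
  obtain ⟨H, hH⟩ := (isHopfSubalgebra_diagramSpace (k := k) hΨ).exists_isHom
  obtain ⟨H', hH'⟩ := (isHopfSubalgebra_diagramSpace (k := k) hΨ').exists_isHom
  let j : diagramSpace k (X.restrict Ψ') →ₗ[k] diagramSpace k Ψ' :=
    (permInclusion k X ∘ₗ (diagramSpace k (X.restrict Ψ')).subtype).codRestrict _
      fun v => X.map_diagramSpace_le Ψ' ⟨v, v.2, rfl⟩
  -- Followed by the inclusion into the larger space of decorated permutations, `j` is a composite
  -- of homomorphisms; that last inclusion is injective and can be cancelled.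
  have hj : H.IsHom H' j := hH'.of_comp (Submodule.injective_subtype _)
    (X.isHom_permInclusion.comp hH)
  refine ⟨hΨ, H, H', hH, hH', isGradedHopf_diagramSpace hΨ hH, isGradedHopf_diagramSpace hΨ' hH',
    j, fun _ => rfl, fun a b h => ?_, hj, fun n => ?_, hj.isHopfSubalgebra_range⟩
  · exact Subtype.ext (X.permInclusion_injective (congrArg Subtype.val h))
  · rintro _ ⟨a, ha, rfl⟩
    exact X.map_diagramSpaceDeg_le Ψ' n ⟨a, ha, rfl⟩
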